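/- For integers $m\ge n\ge 1$ let $\mathcal T_{n,m}$ be the Babuška–Aziz (Schwarz) triangulation of the unit square $[0,1]^2$ cut out by the lines $y=\frac{j}{2m}$ ($1\le j\le 2m-1$), $y=\frac nm x+\frac jm$ ($1-m\le j\le m-1$) and $y=-\frac nm x+\frac jm$ ($1\le j\le 2m-1$). Let $V_{n,m}$ be the nonconforming P1 (Crouzeix–Raviart) space: all functions that are linear polynomials on each triangle of $\mathcal T_{n,m}$, whose integrals along every interior edge agree from both sides, and whose integrals along every boundary edge vanish. Write $(v,w)_{n,m}=\sum_{\Delta\in\mathcal T_{n,m}}\int_\Delta\nabla v\cdot\nabla w\,dx\,dy$ and $|v|_{n,m}=(v,v)_{n,m}^{1/2}$ (the discrete $H^1$ norm). Let $u(x,y)=x(1-x)y(1-y)$, the solution of $-\Delta u=f:=2(x(1-x)+y(1-y))$ on $[0,1]^2$ with zero boundary values. Then for all $m\ge n\ge1$ there is a unique Galerkin solution $u_{n,m}\in V_{n,m}$, i.e. $(u_{n,m},w)_{n,m}=\int_{[0,1]^2} f w\,dx\,dy$ for all $w\in V_{n,m}$, and, with $E_{n,m}=|u-u_{n,m}|_{n,m}$: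 (i) there are constants $C,C'>0$, independent of $n$ and $m$, such that $$C'\min\Big(1,\frac m{n^2}\Big)\le E_{n,m}\le C\min\Big(1,\frac m{n^2}\Big)\qquad\text{for all } m\ge n\ge1;$$ (ii) consequently, if $m_l\ge n_l\ge 1$, $n_l\to\infty$ and $E_{n_l,m_l}\to0$ as $l\to\infty$, then $m_l/n_l^2\to0$; (iii) the loss of convergence is due to the consistency error and not to the best approximation error: there are constants $C_1,C_1'>0$ with $$\frac{C_1'}{n}\le\inf_{v\in V_{n,m}}|u-v|_{n,m}\le\frac{C_1}n\qquad\text{for all } m\ge n\ge1,$$ whereas the consistency error $E^{C}_{n,m}=\sup\{|(u,w)_{n,m}-\int_{[0,1]^2} f w\,dx\,dy| : w\in V_{n,m},\ |w|_{n,m}=1\}$ satisfies, with constants $C_2,C_2'>0$, $K$ and $n_0$, the bounds $E^{C}_{n,m}\le C_2\min(1,m/n^2)$ for all $m\ge n\ge1$ and $E^{C}_{n,m}\ge C_2'\min(1,m/n^2)$ for all $m\ge n\ge n_0$ with $m\ge Kn$. -/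

import Mathlib

open MeasureTheory Filter Topology

noncomputable section

namespace NonconformingP1

/-- The plane; only its linear, topological and measure structure is used (Euclidean lengths are
written out in coordinates). -/
abbrev Plane : Type := ℝ × ℝ

/-- The partial derivative `g_x`. -/
def dx (g : Plane → ℝ) (p : Plane) : ℝ := fderiv ℝ g p (1, 0)

/-- The partial derivative `g_y`. -/
def dy (g : Plane → ℝ) (p : Plane) : ℝ := fderiv ℝ g p (0, 1)

/-- The line integral `∫_e g ds` over the segment `e` from `a` to `b` (`ds` is arc length). -/
def edgeIntegral (g : Plane → ℝ) (a b : Plane) : ℝ :=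
  Real.sqrt ((b.1 - a.1) ^ 2 + (b.2 - a.2) ^ 2) *
    ∫ t in (0 : ℝ)..1, g (AffineMap.lineMap a b t)

section Triangulation

/-! A triangulation is given by a finite family `T` of triangles, each by its three vertices. -/

variable {ι : Type}

/-- The closed triangle with index `i`. -/
def triangle (T : ι → Fin 3 → Plane) (i : ι) : Set Plane := convexHull ℝ (Set.range (T i))

/-- The edge of triangle `i` opposite to its vertex `k`, as an unordered pair of end points. -/
def edge (T : ι → Fin 3 → Plane) (i : ι) (k : Fin 3) : Sym2 Plane := s(T i (k + 1), T i (k + 2))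

/-- The integral of `g` along the edge of triangle `i` opposite to its vertex `k`. -/
def integralOnEdge (T : ι → Fin 3 → Plane) (i : ι) (k : Fin 3) (g : Plane → ℝ) : ℝ :=
  edgeIntegral g (T i (k + 1)) (T i (k + 2))

/-- A boundary edge: an edge that belongs to one triangle only. -/
def IsBoundaryEdge (T : ι → Fin 3 → Plane) (i : ι) (k : Fin 3) : Prop :=
  ∀ i₂ k₂, edge T i₂ k₂ = edge T i k → i₂ = i

/-- The space `V_T` of nonconforming P1 (Crouzeix–Raviart) elements with homogeneous Dirichlet
boundary conditions. An element is a family of linear polynomials, one on each triangle, such that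
the integrals along an interior edge agree from both sides, and the integrals along boundary edges
vanish. -/
def crouzeixRaviart (T : ι → Fin 3 → Plane) : Set (ι → (Plane →ᵃ[ℝ] ℝ)) :=
  {v | (∀ i i₂ k k₂, i ≠ i₂ → edge T i k = edge T i₂ k₂ →
          integralOnEdge T i k (v i) = integralOnEdge T i₂ k₂ (v i₂)) ∧
       (∀ i k, IsBoundaryEdge T i k → integralOnEdge T i k (v i) = 0)}

/-- The function family underlying an element of `V_T`. -/
def pieces (v : ι → (Plane →ᵃ[ℝ] ℝ)) : ι → Plane → ℝ := fun i p => v i p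

variable [Fintype ι]

/-- The scalar product `(g, h)_{H¹,T} = ∑_Δ ∫_Δ ∇g · ∇h` of piecewise smooth functions, which are
given by one smooth function on the plane for each triangle. -/
def brokenInner (T : ι → Fin 3 → Plane) (g h : ι → Plane → ℝ) : ℝ :=
  ∑ i, ∫ p in triangle T i, (dx (g i) p * dx (h i) p + dy (g i) p * dy (h i) p)

/-- The discrete (broken) `H¹` norm `|g|_{H¹,T}`. -/
def brokenNorm (T : ι → Fin 3 → Plane) (g : ι → Plane → ℝ) : ℝ :=
  Real.sqrt (∑ i, ∫ p in triangle T i, ((dx (g i) p) ^ 2 + (dy (g i) p) ^ 2))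

/-- The scalar product `(f, h)_{L₂}` with a piecewise defined `h`. -/
def load (T : ι → Fin 3 → Plane) (f : Plane → ℝ) (h : ι → Plane → ℝ) : ℝ :=
  ∑ i, ∫ p in triangle T i, f p * h i p

/-- `v` is a Galerkin solution in `V_T` of `-Δu = f` with zero boundary values. -/
def IsGalerkinSolution (T : ι → Fin 3 → Plane) (f : Plane → ℝ) (v : ι → (Plane →ᵃ[ℝ] ℝ)) : Prop :=
  v ∈ crouzeixRaviart T ∧
    ∀ w ∈ crouzeixRaviart T, brokenInner T (pieces v) (pieces w) = load T f (pieces w)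

/-- The error `|u - v|_{H¹,T}`. -/
def brokenError (T : ι → Fin 3 → Plane) (u : Plane → ℝ) (v : ι → (Plane →ᵃ[ℝ] ℝ)) : ℝ :=
  brokenNorm T (fun i p => u p - v i p)

/-- The best approximation error `inf {|u - v|_{H¹,T} : v ∈ V_T}`. -/
def bestApproxError (T : ι → Fin 3 → Plane) (u : Plane → ℝ) : ℝ :=
  sInf {r | ∃ v ∈ crouzeixRaviart T, r = brokenError T u v}

/-- The consistency error
`sup {|(u, w)_{H¹,T} - (f, w)_{L₂}| : w ∈ V_T, |w|_{H¹,T} = 1}`. -/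
def consistencyError (T : ι → Fin 3 → Plane) (u f : Plane → ℝ) : ℝ :=
  sSup {r | ∃ w ∈ crouzeixRaviart T, brokenNorm T (pieces w) = 1 ∧
    r = |brokenInner T (fun _ => u) (pieces w) - load T f (pieces w)|}

end Triangulation

/-- The grid point `P_{i,j} = (i / (2n), j / (2m))`. -/
def gridPoint (n m i j : ℕ) : Plane := ((i : ℝ) / (2 * n), (j : ℝ) / (2 * m))

/-- The Babuška–Aziz (Schwarz) triangulation `T_{n,m}` of the unit square. For `j < 2m`, the strip
between the lines `y = j / (2m)` and `y = (j+1) / (2m)` is bounded by one line with even index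
`2 * ((j + 1) / 2)` and one with odd index `2 * (j / 2) + 1` (with division in `ℕ`). It consists of
`n` triangles whose horizontal edge lies on the even line and `n + 1` triangles whose horizontal
edge lies on the odd line; the first and the last of the latter (where `2 * a - 1` is truncated to
`0` in `ℕ`, and `2 * a + 1` is cut down to `2 * n`) are the right-angled ones at the vertical sides
of the square. -/
def babuskaAziz (n m : ℕ) : Fin (2 * m) × (Fin n ⊕ Fin (n + 1)) → Fin 3 → Plane
  | (j, Sum.inl a) =>
      ![gridPoint n m (2 * a) (2 * ((j + 1) / 2)),
        gridPoint n m (2 * a + 2) (2 * ((j + 1) / 2)),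
        gridPoint n m (2 * a + 1) (2 * (j / 2) + 1)]
  | (j, Sum.inr a) =>
      ![gridPoint n m (2 * a - 1) (2 * (j / 2) + 1),
        gridPoint n m (min (2 * a + 1) (2 * n)) (2 * (j / 2) + 1),
        gridPoint n m (2 * a) (2 * ((j + 1) / 2))]

/-- The solution `u(x,y) = x(1-x)y(1-y)` of the model problem. -/
def modelU (p : Plane) : ℝ := p.1 * (1 - p.1) * (p.2 * (1 - p.2))

/-- The right-hand side `f = -Δu = 2(x(1-x) + y(1-y))` of the model problem. -/
def modelF (p : Plane) : ℝ := 2 * (p.1 * (1 - p.1) + p.2 * (1 - p.2))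

end NonconformingP1

end

/-! The error is governed by two quantities, as in the second Strang lemma: the best approximation
error, which is of exact order 1/n, and the consistency functional `consistency`, w ↦ (u, w) - (f,
w) on V. Since n ≤ m gives 1/n ≤ min(1, m/n²), only the second one can spoil convergence.

Consistency. On a triangle, Gauss's theorem turns ∫ (∇u·∇w - f w) into boundary integrals of w
∂u/∂ν. On each edge w is its midpoint value plus a linear part that vanishes at the midpoint
(`setIntegral_grad_sub_load`). The midpoint values agree from both sides and vanish on the boundary,
so their contributions cancel, and only the edge defects, where ∂u/∂ν is tested with the linear
part, remain (`consistency_eq_sum_defect`). Each defect is O(n⁻³ |∇w|), because edges have length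
O(1/n), whereas a triangle has area of order 1/(nm). The quotient of the two is the factor m/n². The
competing bound by a constant comes from a discrete Poincaré inequality along the midlines of the
strips, on which w is continuous (`abs_nodal_le`, `abs_load_le`). Together they give
`abs_consistency_le`.

Sharpness. The factor m/n² is attained by a function that changes sign from node to node along each
midline and from strip to strip. On a triangle its x-slope carries the orientation of that triangle,
so the leading defects of upward and downward triangles add up instead of cancelling. A slowly
varying amplitude matched to the weight (1-2x)(1-2y) makes all rows and columns contribute
positively on balance. Hence the functional is at least of order m/n² on it
(`le_abs_consistency_oscillating`), while its energy norm is at most of order max(1, m/n²)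
(`energy_oscillating_le`). As min · max = m/n², the quotient is at least of order min(1, m/n²).

Approximation. The lower bound 1/n holds because u_x is not constant along horizontal lines
(`le_brokenError`). The upper bound needs an interpolant adapted to flat triangles: the value at a
horizontal midpoint is a mean of two values of u, chosen so that the y-slope is a mean of difference
quotients in y (`approximant`).

Existence and uniqueness follow from definiteness of the energy form in finite dimension. For small
n the lower bound for the Galerkin error comes from the approximation bound. -/

noncomputable section
namespace NonconformingP1

/-! ### Integration over a triangle with a horizontal edge -/

section Triangle

variable {p q r b e : ℝ}

theorem mem_convexHull_triangle {z : Plane} :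
    z ∈ convexHull ℝ (Set.range (![(p, b), (q, b), (r, e)] : Fin 3 → Plane)) ↔
      ∃ t ∈ Set.Icc (0 : ℝ) 1, ∃ s ∈ Set.Icc (0 : ℝ) 1,
        z = ((1 - t) * (p + s * (q - p)) + t * r, b + t * (e - b)) := by
  have h1 : Set.range (![(p, b), (q, b), (r, e)] : Fin 3 → Plane) =
      insert (r, e) {(p, b), (q, b)} := by
    ext z
    simp only [Matrix.range_cons, Matrix.range_empty, Set.mem_union, Set.mem_singleton_iff,
      Set.mem_insert_iff, Set.mem_empty_iff_false]
    tauto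
  rw [h1, convexHull_insert (by simp), convexHull_pair, mem_convexJoin]
  constructor
  · rintro ⟨a, ha, c, hc, hz⟩
    rw [Set.mem_singleton_iff] at ha
    subst ha
    obtain ⟨s, hs, rfl⟩ := (segment_eq_image_lineMap ℝ ((p, b) : Plane) (q, b)) ▸ hc
    rw [segment_symm] at hz
    obtain ⟨t, ht, rfl⟩ := (segment_eq_image_lineMap ℝ _ ((r, e) : Plane)) ▸ hz
    refine ⟨t, ht, s, hs, ?_⟩
    simp only [AffineMap.lineMap_apply, Prod.ext_iff]
    simp
    constructor <;> ring
  · rintro ⟨t, ht, s, hs, rfl⟩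
    refine ⟨(r, e), rfl, (p + s * (q - p), b), ?_, ?_⟩
    · rw [segment_eq_image_lineMap]
      refine ⟨s, hs, ?_⟩
      simp only [AffineMap.lineMap_apply, Prod.ext_iff]
      simp
      ring
    · rw [segment_symm, segment_eq_image_lineMap]
      refine ⟨t, ht, ?_⟩
      simp only [AffineMap.lineMap_apply, Prod.ext_iff]
      simp
      constructor <;> ring

theorem isCompact_convexHull_range (T : Fin 3 → Plane) :
    IsCompact (convexHull ℝ (Set.range T)) :=
  (Set.finite_range T).isCompact_convexHull ℝ

/-- Fubini with horizontal slices: at relative height t the slice is a segment of length (1 - t)(q -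
p), which is rescaled to [0, 1]. -/
theorem setIntegral_triangle (hpq : p < q) (hbe : b ≠ e) {f : Plane → ℝ} (hf : Continuous f) :
    ∫ z in convexHull ℝ (Set.range (![(p, b), (q, b), (r, e)] : Fin 3 → Plane)), f z =
      (q - p) * |e - b| * ∫ t in (0 : ℝ)..1, (1 - t) *
        ∫ s in (0 : ℝ)..1, f ((1 - t) * (p + s * (q - p)) + t * r, b + t * (e - b)) := by
  set D := convexHull ℝ (Set.range (![(p, b), (q, b), (r, e)] : Fin 3 → Plane)) with hD
  have hDc : IsCompact D := isCompact_convexHull_range _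
  have hDm : MeasurableSet D := hDc.measurableSet
  have hint : Integrable (D.indicator f) :=
    (integrable_indicator_iff hDm).2 (hf.continuousOn.integrableOn_compact hDc)
  have heb : e - b ≠ 0 := sub_ne_zero.2 hbe.symm
  rw [← integral_indicator hDm, Measure.volume_eq_prod, integral_prod_symm _ hint]
  have h1 : ∀ G : ℝ → ℝ, ∫ y, G y = |e - b| * ∫ t, G (b + (e - b) * t) := by
    intro G
    rw [Measure.integral_comp_mul_left (fun y => G (b + y)) (e - b),
      integral_add_left_eq_self G b, smul_eq_mul, abs_inv, ← mul_assoc,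
      mul_inv_cancel₀ (abs_ne_zero.2 heb), one_mul]
  rw [h1]
  have h2 : ∀ᵐ t : ℝ, (∫ x, D.indicator f (x, b + (e - b) * t)) =
      (Set.Icc (0 : ℝ) 1).indicator (fun t => (q - p) * ((1 - t) *
        ∫ s in (0 : ℝ)..1, f ((1 - t) * (p + s * (q - p)) + t * r, b + t * (e - b)))) t := by
    -- At t = 1 the slice shrinks to the apex and cannot be rescaled to the unit interval.
    have : ∀ᵐ t : ℝ, t ≠ 1 := by simp [ae_iff, measure_singleton]
    filter_upwards [this] with t ht1
    by_cases ht : t ∈ Set.Icc (0 : ℝ) 1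
    · rw [Set.indicator_of_mem ht]
      have ht' : 0 < 1 - t := by
        have := lt_of_le_of_ne ht.2 ht1
        linarith
      have hw : 0 < (1 - t) * (q - p) := mul_pos ht' (sub_pos.2 hpq)
      have h3 : ∀ G : ℝ → ℝ, ∫ x, G x = (1 - t) * (q - p) *
          ∫ s, G (((1 - t) * p + t * r) + ((1 - t) * (q - p)) * s) := by
        intro G
        rw [Measure.integral_comp_mul_left (fun y => G (((1 - t) * p + t * r) + y))
            ((1 - t) * (q - p)), integral_add_left_eq_self G, smul_eq_mul, abs_inv,
            abs_of_pos hw, ← mul_assoc, mul_inv_cancel₀ hw.ne', one_mul]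
      rw [h3]
      have h4 : (fun s : ℝ => D.indicator f
          (((1 - t) * p + t * r) + ((1 - t) * (q - p)) * s, b + (e - b) * t)) =
          (Set.Icc (0 : ℝ) 1).indicator
            (fun s => f ((1 - t) * (p + s * (q - p)) + t * r, b + t * (e - b))) := by
        ext s
        have e1 : (((1 - t) * p + t * r) + ((1 - t) * (q - p)) * s, b + (e - b) * t) =
          (((1 - t) * (p + s * (q - p)) + t * r, b + t * (e - b)) : Plane) := by
          ext <;> simp <;> ring
        rw [e1]
        by_cases hs : s ∈ Set.Icc (0 : ℝ) 1
        · rw [Set.indicator_of_mem hs, Set.indicator_of_mem]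
          exact mem_convexHull_triangle.2 ⟨t, ht, s, hs, rfl⟩
        · rw [Set.indicator_of_notMem hs, Set.indicator_of_notMem]
          intro hmem
          obtain ⟨t', -, s', hs', heq⟩ := mem_convexHull_triangle.1 hmem
          rw [Prod.ext_iff] at heq
          have e2 : t' = t := by
            have := heq.2
            simp only at this
            have h5 : (t' - t) * (e - b) = 0 := by linarith
            rcases mul_eq_zero.1 h5 with h | h
            · linarith
            · exact absurd h heb
          subst e2
          have e3 : s' = s := by
            have := heq.1
            simp only at this
            have h5 : (s' - s) * ((1 - t') * (q - p)) = 0 := by linarith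
            rcases mul_eq_zero.1 h5 with h | h
            · linarith
            · exact absurd h hw.ne'
          exact hs (e3 ▸ hs')
      rw [h4, integral_indicator measurableSet_Icc, integral_Icc_eq_integral_Ioc,
        ← intervalIntegral.integral_of_le zero_le_one]
      ring
    · rw [Set.indicator_of_notMem ht]
      have h4 : (fun x : ℝ => D.indicator f (x, b + (e - b) * t)) = fun _ => 0 := by
        ext x
        rw [Set.indicator_of_notMem]
        intro hmem
        obtain ⟨t', ht', s', hs', heq⟩ := mem_convexHull_triangle.1 hmem
        rw [Prod.ext_iff] at heq
        have := heq.2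
        simp only at this
        have h5 : (t' - t) * (e - b) = 0 := by linarith
        rcases mul_eq_zero.1 h5 with h | h
        · exact ht ((by linarith : t' = t) ▸ ht')
        · exact heb h
      rw [h4, integral_zero]
  rw [integral_congr_ae h2, integral_indicator measurableSet_Icc, integral_Icc_eq_integral_Ioc,
        ← intervalIntegral.integral_of_le zero_le_one, intervalIntegral.integral_const_mul]
  ring

/-- Degree five is needed for the weight (1 - t)³t² in `le_setIntegral_modelUx_sub_sq`; polynomials
of lower degree are padded with zero coefficients. -/
theorem integral_quintic (a₀ a₁ a₂ a₃ a₄ a₅ : ℝ) :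
    ∫ s in (0 : ℝ)..1, (a₀ + a₁ * s + a₂ * s ^ 2 + a₃ * s ^ 3 + a₄ * s ^ 4 + a₅ * s ^ 5) =
      a₀ + a₁ / 2 + a₂ / 3 + a₃ / 4 + a₄ / 5 + a₅ / 6 := by
  rw [intervalIntegral.integral_eq_sub_of_hasDerivAt
    (f := fun s => a₀ * s + a₁ / 2 * s ^ 2 + a₂ / 3 * s ^ 3 + a₃ / 4 * s ^ 4 + a₄ / 5 * s ^ 5 +
      a₅ / 6 * s ^ 6)]
  · ring
  · intro x _
    have := ((((((hasDerivAt_id x).const_mul a₀).add ((hasDerivAt_pow 2 x).const_mul (a₁ / 2))).add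
      ((hasDerivAt_pow 3 x).const_mul (a₂ / 3))).add ((hasDerivAt_pow 4 x).const_mul (a₃ / 4))).add
      ((hasDerivAt_pow 5 x).const_mul (a₄ / 5))).add ((hasDerivAt_pow 6 x).const_mul (a₅ / 6))
    exact this.congr_deriv (by push_cast; ring)
  · exact Continuous.intervalIntegrable (by fun_prop) _ _

/-- The integral over a triangle of a cubic polynomial, given by its Taylor coefficients at the
first vertex. -/
theorem setIntegral_triangle_cubic (hpq : p < q) (hbe : b ≠ e) {f : Plane → ℝ}
    (hc : Continuous f) {c₀₀ c₁₀ c₀₁ c₂₀ c₁₁ c₀₂ c₃₀ c₂₁ c₁₂ c₀₃ : ℝ}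
    (hf : ∀ X Y : ℝ, f (p + X, b + Y) = c₀₀ + c₁₀ * X + c₀₁ * Y + c₂₀ * X ^ 2 + c₁₁ * X * Y +
      c₀₂ * Y ^ 2 + c₃₀ * X ^ 3 + c₂₁ * X ^ 2 * Y + c₁₂ * X * Y ^ 2 + c₀₃ * Y ^ 3) :
    ∫ z in convexHull ℝ (Set.range (![(p, b), (q, b), (r, e)] : Fin 3 → Plane)), f z =
      (q - p) * |e - b| * (c₀₀ / 2 + (c₁₀ * (q - p) + (c₁₀ * (r - p) + c₀₁ * (e - b))) / 6 +
        c₂₀ * (q - p) ^ 2 / 12 + (2 * c₂₀ * (r - p) + c₁₁ * (e - b)) * (q - p) / 24 +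
        (c₂₀ * (r - p) ^ 2 + c₁₁ * (r - p) * (e - b) + c₀₂ * (e - b) ^ 2) / 12 +
        c₃₀ * (q - p) ^ 3 / 20 + (3 * c₃₀ * (r - p) + c₂₁ * (e - b)) * (q - p) ^ 2 / 60 +
        (3 * c₃₀ * (r - p) ^ 2 + 2 * c₂₁ * (r - p) * (e - b) + c₁₂ * (e - b) ^ 2) *
          (q - p) / 60 +
        (c₃₀ * (r - p) ^ 3 + c₂₁ * (r - p) ^ 2 * (e - b) + c₁₂ * (r - p) * (e - b) ^ 2 +
          c₀₃ * (e - b) ^ 3) / 20) := by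
  rw [setIntegral_triangle hpq hbe hc]
  congr 1
  set P := q - p with hP
  set R := r - p with hR
  set E := e - b with hE
  have inner : ∀ t : ℝ, ∫ s in (0 : ℝ)..1, f ((1 - t) * (p + s * P) + t * r, b + t * E) =
      (c₀₀ + (c₁₀ * R + c₀₁ * E) * t + (c₂₀ * R ^ 2 + c₁₁ * R * E + c₀₂ * E ^ 2) * t ^ 2 +
        (c₃₀ * R ^ 3 + c₂₁ * R ^ 2 * E + c₁₂ * R * E ^ 2 + c₀₃ * E ^ 3) * t ^ 3) +
      (c₁₀ * P + (2 * c₂₀ * R + c₁₁ * E) * P * t +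
        (3 * c₃₀ * R ^ 2 + 2 * c₂₁ * R * E + c₁₂ * E ^ 2) * P * t ^ 2) * (1 - t) / 2 +
      (c₂₀ * P ^ 2 + (3 * c₃₀ * R + c₂₁ * E) * P ^ 2 * t) * (1 - t) ^ 2 / 3 +
      c₃₀ * P ^ 3 * (1 - t) ^ 3 / 4 := by
    intro t
    have : ∀ s : ℝ, f ((1 - t) * (p + s * P) + t * r, b + t * E) =
      (c₀₀ + (c₁₀ * R + c₀₁ * E) * t + (c₂₀ * R ^ 2 + c₁₁ * R * E + c₀₂ * E ^ 2) * t ^ 2 +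
        (c₃₀ * R ^ 3 + c₂₁ * R ^ 2 * E + c₁₂ * R * E ^ 2 + c₀₃ * E ^ 3) * t ^ 3) +
      ((c₁₀ * P + (2 * c₂₀ * R + c₁₁ * E) * P * t +
        (3 * c₃₀ * R ^ 2 + 2 * c₂₁ * R * E + c₁₂ * E ^ 2) * P * t ^ 2) * (1 - t)) * s +
      ((c₂₀ * P ^ 2 + (3 * c₃₀ * R + c₂₁ * E) * P ^ 2 * t) * (1 - t) ^ 2) * s ^ 2 +
      (c₃₀ * P ^ 3 * (1 - t) ^ 3) * s ^ 3 + 0 * s ^ 4 + 0 * s ^ 5 := by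
      intro s
      have h1 : (1 - t) * (p + s * P) + t * r = p + ((1 - t) * s * P + t * R) := by
        rw [hR]; ring
      rw [h1, hf]
      ring
    simp_rw [this]
    rw [integral_quintic]
    ring
  simp_rw [inner]
  -- The letters A, B, C, D collect the coefficients of s⁰, s¹, s², s³ after the inner integration;
  -- each power of s brings a factor 1 - t.
  have outer : ∀ A₀ A₁ A₂ A₃ B₀ B₁ B₂ C₀ C₁ D₀ : ℝ, ∫ t in (0 : ℝ)..1, (1 - t) *
      ((A₀ + A₁ * t + A₂ * t ^ 2 + A₃ * t ^ 3) + (B₀ + B₁ * t + B₂ * t ^ 2) * (1 - t) / 2 +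
      (C₀ + C₁ * t) * (1 - t) ^ 2 / 3 + D₀ * (1 - t) ^ 3 / 4) =
      A₀ / 2 + A₁ / 6 + A₂ / 12 + A₃ / 20 + B₀ / 6 + B₁ / 24 + B₂ / 60 + C₀ / 12 + C₁ / 60 +
        D₀ / 20 := by
    intro A₀ A₁ A₂ A₃ B₀ B₁ B₂ C₀ C₁ D₀
    have : ∀ t : ℝ, (1 - t) *
      ((A₀ + A₁ * t + A₂ * t ^ 2 + A₃ * t ^ 3) + (B₀ + B₁ * t + B₂ * t ^ 2) * (1 - t) / 2 +
      (C₀ + C₁ * t) * (1 - t) ^ 2 / 3 + D₀ * (1 - t) ^ 3 / 4) =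
      (A₀ + B₀ / 2 + C₀ / 3 + D₀ / 4) +
      (A₁ - A₀ + (B₁ - 2 * B₀) / 2 + (C₁ - 3 * C₀) / 3 - D₀) * t +
      (A₂ - A₁ + (B₂ - 2 * B₁ + B₀) / 2 + (3 * C₀ - 3 * C₁) / 3 + 6 * D₀ / 4) * t ^ 2 +
      (A₃ - A₂ + (B₁ - 2 * B₂) / 2 + (3 * C₁ - C₀) / 3 - D₀) * t ^ 3 +
      (-A₃ + B₂ / 2 - C₁ / 3 + D₀ / 4) * t ^ 4 + 0 * t ^ 5 := by
      intro t
      ring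
    simp_rw [this]
    rw [integral_quintic]
    ring
  rw [outer]
  ring

end Triangle

/-! ### Affine functions, and derivatives of the model solution -/

section AffineFunctions

/-- The constant partial derivative in `x` of an affine function. -/
def slopeX (w : Plane →ᵃ[ℝ] ℝ) : ℝ := w.linear (1, 0)

/-- The constant partial derivative in `y` of an affine function. -/
def slopeY (w : Plane →ᵃ[ℝ] ℝ) : ℝ := w.linear (0, 1)

theorem affine_apply_eq (w : Plane →ᵃ[ℝ] ℝ) (z : Plane) :
    w z = w 0 + slopeX w * z.1 + slopeY w * z.2 := by
  have h1 : w z = w.linear z + w 0 := congrFun (AffineMap.decomp w) z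
  have h2 : z = z.1 • ((1, 0) : Plane) + z.2 • ((0, 1) : Plane) := by ext <;> simp
  have h3 : w.linear z = slopeX w * z.1 + slopeY w * z.2 := by
    conv_lhs => rw [h2]
    rw [map_add, map_smul, map_smul, slopeX, slopeY, smul_eq_mul, smul_eq_mul]
    ring
  rw [h1, h3]
  ring

theorem continuous_affine (w : Plane →ᵃ[ℝ] ℝ) : Continuous w := by
  have : (w : Plane → ℝ) = fun z => w 0 + slopeX w * z.1 + slopeY w * z.2 :=
    funext (affine_apply_eq w)
  rw [this]
  fun_prop

/-- The affine function `α + β x + γ y`. -/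
def affineOfCoeffs (α β γ : ℝ) : Plane →ᵃ[ℝ] ℝ where
  toFun z := α + β * z.1 + γ * z.2
  linear := β • LinearMap.fst ℝ ℝ ℝ + γ • LinearMap.snd ℝ ℝ ℝ
  map_vadd' z v := by simp; ring

@[simp] theorem affineOfCoeffs_apply (α β γ : ℝ) (z : Plane) :
    affineOfCoeffs α β γ z = α + β * z.1 + γ * z.2 := rfl

@[simp] theorem slopeX_affineOfCoeffs (α β γ : ℝ) : slopeX (affineOfCoeffs α β γ) = β := by
  simp [slopeX, affineOfCoeffs]

@[simp] theorem slopeY_affineOfCoeffs (α β γ : ℝ) : slopeY (affineOfCoeffs α β γ) = γ := by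
  simp [slopeY, affineOfCoeffs]

@[simp] theorem slopeX_add (v w : Plane →ᵃ[ℝ] ℝ) : slopeX (v + w) = slopeX v + slopeX w := by
  simp [slopeX]

@[simp] theorem slopeY_add (v w : Plane →ᵃ[ℝ] ℝ) : slopeY (v + w) = slopeY v + slopeY w := by
  simp [slopeY]

@[simp] theorem slopeX_sub (v w : Plane →ᵃ[ℝ] ℝ) : slopeX (v - w) = slopeX v - slopeX w := by
  simp [slopeX]

@[simp] theorem slopeY_sub (v w : Plane →ᵃ[ℝ] ℝ) : slopeY (v - w) = slopeY v - slopeY w := by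
  simp [slopeY]

@[simp] theorem slopeX_smul (c : ℝ) (w : Plane →ᵃ[ℝ] ℝ) : slopeX (c • w) = c * slopeX w := by
  simp [slopeX]

@[simp] theorem slopeY_smul (c : ℝ) (w : Plane →ᵃ[ℝ] ℝ) : slopeY (c • w) = c * slopeY w := by
  simp [slopeY]

theorem hasFDerivAt_affine (w : Plane →ᵃ[ℝ] ℝ) (z : Plane) :
    HasFDerivAt w (slopeX w • ContinuousLinearMap.fst ℝ ℝ ℝ +
      slopeY w • ContinuousLinearMap.snd ℝ ℝ ℝ) z := by
  have h : (w : Plane → ℝ) = fun z => w 0 + (slopeX w • ContinuousLinearMap.fst ℝ ℝ ℝ +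
      slopeY w • ContinuousLinearMap.snd ℝ ℝ ℝ) z := by
    ext z
    rw [affine_apply_eq]
    simp
    ring
  rw [h]
  exact (ContinuousLinearMap.hasFDerivAt _).const_add _

theorem dx_affine (w : Plane →ᵃ[ℝ] ℝ) (z : Plane) : dx (fun p => w p) z = slopeX w := by
  rw [dx, (hasFDerivAt_affine w z).fderiv]
  simp

theorem dy_affine (w : Plane →ᵃ[ℝ] ℝ) (z : Plane) : dy (fun p => w p) z = slopeY w := by
  rw [dy, (hasFDerivAt_affine w z).fderiv]
  simp

/-- The partial derivative of `modelU` in `x`. -/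
def modelUx (z : Plane) : ℝ := (1 - 2 * z.1) * (z.2 * (1 - z.2))

/-- The partial derivative of `modelU` in `y`. -/
def modelUy (z : Plane) : ℝ := (1 - 2 * z.2) * (z.1 * (1 - z.1))

theorem continuous_modelUx : Continuous modelUx := by unfold modelUx; fun_prop

theorem continuous_modelUy : Continuous modelUy := by unfold modelUy; fun_prop

theorem continuous_modelF : Continuous modelF := by unfold modelF; fun_prop

theorem hasFDerivAt_modelU (z : Plane) :
    HasFDerivAt modelU (modelUx z • ContinuousLinearMap.fst ℝ ℝ ℝ +
      modelUy z • ContinuousLinearMap.snd ℝ ℝ ℝ) z := by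
  have hx : HasFDerivAt (fun p : Plane => p.1) (ContinuousLinearMap.fst ℝ ℝ ℝ) z :=
    hasFDerivAt_fst
  have hy : HasFDerivAt (fun p : Plane => p.2) (ContinuousLinearMap.snd ℝ ℝ ℝ) z :=
    hasFDerivAt_snd
  have h := (hx.mul (hx.const_sub 1)).mul (hy.mul (hy.const_sub 1))
  refine h.congr_fderiv ?_
  ext <;> simp [modelUx, modelUy] <;> ring

theorem dx_modelU (z : Plane) : dx modelU z = modelUx z := by
  rw [dx, (hasFDerivAt_modelU z).fderiv]
  simp

theorem dy_modelU (z : Plane) : dy modelU z = modelUy z := by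
  rw [dy, (hasFDerivAt_modelU z).fderiv]
  simp

theorem dx_modelU_sub (w : Plane →ᵃ[ℝ] ℝ) (z : Plane) :
    dx (fun p => modelU p - w p) z = modelUx z - slopeX w := by
  rw [dx, ((hasFDerivAt_modelU z).fun_sub (hasFDerivAt_affine w z)).fderiv]
  simp

theorem dy_modelU_sub (w : Plane →ᵃ[ℝ] ℝ) (z : Plane) :
    dy (fun p => modelU p - w p) z = modelUy z - slopeY w := by
  rw [dy, ((hasFDerivAt_modelU z).fun_sub (hasFDerivAt_affine w z)).fderiv]
  simp

/-- The midpoint rule is exact for affine functions; this turns conditions on edge integrals into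
conditions on midpoint values. -/
theorem edgeIntegral_affine (w : Plane →ᵃ[ℝ] ℝ) (P Q : Plane) :
    edgeIntegral w P Q = Real.sqrt ((Q.1 - P.1) ^ 2 + (Q.2 - P.2) ^ 2) * w (midpoint ℝ P Q) := by
  unfold edgeIntegral
  congr 1
  have : ∀ t : ℝ, w (AffineMap.lineMap P Q t) = w P + (w Q - w P) * t + 0 * t ^ 2 + 0 * t ^ 3 +
      0 * t ^ 4 + 0 * t ^ 5 := by
    intro t
    rw [AffineMap.apply_lineMap, AffineMap.lineMap_apply]
    simp
    ring
  simp_rw [this]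
  rw [integral_quintic, AffineMap.map_midpoint, midpoint_eq_smul_add, smul_eq_mul, invOf_eq_inv]
  ring

end AffineFunctions

/-! ### The consistency functional on a single triangle -/

section TriangleEstimates

variable {p q r b e : ℝ}

theorem setIntegral_triangle_const (hpq : p < q) (hbe : b ≠ e) (c : ℝ) :
    ∫ _ in convexHull ℝ (Set.range (![(p, b), (q, b), (r, e)] : Fin 3 → Plane)), c =
      (q - p) * |e - b| / 2 * c := by
  rw [setIntegral_triangle_cubic (f := fun _ => c) (c₀₀ := c) (c₁₀ := 0) (c₀₁ := 0) (c₂₀ := 0)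
    (c₁₁ := 0) (c₀₂ := 0) (c₃₀ := 0) (c₂₁ := 0) (c₁₂ := 0) (c₀₃ := 0) hpq hbe continuous_const
    (by intro X Y; ring)]
  ring

theorem setIntegral_triangle_le (hpq : p < q) (hbe : b ≠ e) {f : Plane → ℝ} (hf : Continuous f)
    {M : ℝ} (h : ∀ t ∈ Set.Icc (0 : ℝ) 1, ∀ s ∈ Set.Icc (0 : ℝ) 1,
      f ((1 - t) * (p + s * (q - p)) + t * r, b + t * (e - b)) ≤ M) :
    ∫ z in convexHull ℝ (Set.range (![(p, b), (q, b), (r, e)] : Fin 3 → Plane)), f z ≤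
      (q - p) * |e - b| / 2 * M := by
  have hc := isCompact_convexHull_range (![(p, b), (q, b), (r, e)] : Fin 3 → Plane)
  rw [← setIntegral_triangle_const (r := r) hpq hbe M]
  refine setIntegral_mono_on (hf.continuousOn.integrableOn_compact hc)
    (continuous_const.continuousOn.integrableOn_compact hc) hc.measurableSet ?_
  intro z hz
  obtain ⟨t, ht, s, hs, rfl⟩ := mem_convexHull_triangle.1 hz
  exact h t ht s hs

/-- The flux of the gradient of `modelU` through the edge `P Q`, by the Simpson rule. -/
def flux (P Q : Plane) : ℝ :=
  ((Q.2 - P.2) * (modelUx P + 4 * modelUx ((P.1 + Q.1) / 2, (P.2 + Q.2) / 2) + modelUx Q) -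
    (Q.1 - P.1) *
      (modelUy P + 4 * modelUy ((P.1 + Q.1) / 2, (P.2 + Q.2) / 2) + modelUy Q)) / 6

/-- The integral over the edge `P Q` of the normal derivative of `modelU`, multiplied by the linear
function with gradient `(β, γ)` that vanishes at the midpoint. -/
def edgeDefect (β γ : ℝ) (P Q : Plane) : ℝ :=
  (β * (Q.1 - P.1) + γ * (Q.2 - P.2)) *
    ((Q.2 - P.2) * (((1 - (P.1 + Q.1)) * (1 - (P.2 + Q.2)) * (Q.2 - P.2) -
        2 * (Q.1 - P.1) * ((P.2 + Q.2) / 2 * (1 - (P.2 + Q.2) / 2))) / 12 +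
        (Q.1 - P.1) * (Q.2 - P.2) ^ 2 / 40) -
      (Q.1 - P.1) * (((1 - (P.1 + Q.1)) * (1 - (P.2 + Q.2)) * (Q.1 - P.1) -
        2 * (Q.2 - P.2) * ((P.1 + Q.1) / 2 * (1 - (P.1 + Q.1) / 2))) / 12 +
        (Q.2 - P.2) * (Q.1 - P.1) ^ 2 / 40))

/-- The consistency functional on one triangle in terms of the values at the edge midpoints. -/
theorem setIntegral_grad_sub_load (hpq : p < q) (hbe : b ≠ e) (w : Plane →ᵃ[ℝ] ℝ) :
    ∫ z in convexHull ℝ (Set.range (![(p, b), (q, b), (r, e)] : Fin 3 → Plane)),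
        (modelUx z * slopeX w + modelUy z * slopeY w - modelF z * w z) =
      |e - b| / (e - b) *
        (flux (p, b) (q, b) * w ((p + q) / 2, b) +
          flux (q, b) (r, e) * w ((q + r) / 2, (b + e) / 2) +
          flux (r, e) (p, b) * w ((p + r) / 2, (b + e) / 2) +
          (edgeDefect (slopeX w) (slopeY w) (p, b) (q, b) +
            edgeDefect (slopeX w) (slopeY w) (q, b) (r, e) +
            edgeDefect (slopeX w) (slopeY w) (r, e) (p, b))) := by
  have heb : e - b ≠ 0 := sub_ne_zero.2 hbe.symm
  -- The identity is Gauss's theorem for the field w∇u, whose divergence is ∇u·∇w - f w. The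
  -- gradient of u is cubic along an edge, so the Simpson rule gives the flux exactly. The sign |e -
  -- b|/(e - b) records whether the traversal of the vertices is counterclockwise. It is verified as
  -- a polynomial identity, from the Taylor coefficients of the integrand at (p, b).
  rw [setIntegral_triangle_cubic
    (c₀₀ := (1 - 2 * p) * (b * (1 - b)) * slopeX w + (1 - 2 * b) * (p * (1 - p)) * slopeY w -
      2 * (p * (1 - p) + b * (1 - b)) * w (p, b))
    (c₁₀ := -2 * (b * (1 - b)) * slopeX w + (1 - 2 * b) * (1 - 2 * p) * slopeY w -
      (2 * (p * (1 - p) + b * (1 - b)) * slopeX w + 2 * (1 - 2 * p) * w (p, b)))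
    (c₀₁ := (1 - 2 * b) * (1 - 2 * p) * slopeX w - 2 * (p * (1 - p)) * slopeY w -
      (2 * (p * (1 - p) + b * (1 - b)) * slopeY w + 2 * (1 - 2 * b) * w (p, b)))
    (c₂₀ := -(1 - 2 * b) * slopeY w - (-2 * w (p, b) + 2 * (1 - 2 * p) * slopeX w))
    (c₁₁ := -2 * (1 - 2 * b) * slopeX w - 2 * (1 - 2 * p) * slopeY w -
      (2 * (1 - 2 * p) * slopeY w + 2 * (1 - 2 * b) * slopeX w))
    (c₀₂ := -(1 - 2 * p) * slopeX w - (-2 * w (p, b) + 2 * (1 - 2 * b) * slopeY w))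
    (c₃₀ := 2 * slopeX w) (c₂₁ := 2 * slopeY w + 2 * slopeY w)
    (c₁₂ := 2 * slopeX w + 2 * slopeX w) (c₀₃ := 2 * slopeY w) hpq hbe]
  · rw [div_mul_eq_mul_div, eq_div_iff heb, affine_apply_eq w (p, b),
      affine_apply_eq w ((p + q) / 2, b), affine_apply_eq w ((q + r) / 2, (b + e) / 2),
      affine_apply_eq w ((p + r) / 2, (b + e) / 2)]
    simp only [flux, edgeDefect, modelUx, modelUy]
    generalize w 0 = α
    generalize slopeX w = β
    generalize slopeY w = γ
    ring
  · exact ((continuous_modelUx.mul continuous_const).add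
      (continuous_modelUy.mul continuous_const)).sub (continuous_modelF.mul (continuous_affine w))
  · intro X Y
    rw [affine_apply_eq w (p, b), affine_apply_eq w (p + X, b + Y)]
    simp only [modelUx, modelUy, modelF]
    ring

end TriangleEstimates

/-! ### Bounds on a single triangle -/

section TriangleBounds

variable {p q r b e : ℝ}

/-- The expression is the first moment about the midpoint (x, y) of u_x along an edge with
increments (X, Y): a twelfth of the first directional derivative plus 1/480 of the third, which is
12XY². Exchanging the coordinates gives the moment of u_y. -/
theorem abs_moment_le {x y X Y l : ℝ} (hx : x ∈ Set.Icc (0 : ℝ) 1) (hy : y ∈ Set.Icc (0 : ℝ) 1)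
    (hX : |X| ≤ l) (hY : |Y| ≤ l) (hl : l ≤ 1) :
    |((1 - 2 * x) * (1 - 2 * y) * Y - 2 * X * (y * (1 - y))) / 12 + X * Y ^ 2 / 40| ≤ l := by
  have hl0 : 0 ≤ l := (abs_nonneg X).trans hX
  have h1 : |(1 - 2 * x) * (1 - 2 * y) * Y| ≤ l := by
    rw [abs_mul, abs_mul]
    have a1 : |1 - 2 * x| ≤ 1 := abs_le.2 ⟨by linarith [hx.2], by linarith [hx.1]⟩
    have a2 : |1 - 2 * y| ≤ 1 := abs_le.2 ⟨by linarith [hy.2], by linarith [hy.1]⟩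
    calc |1 - 2 * x| * |1 - 2 * y| * |Y| ≤ 1 * 1 * l := by gcongr
      _ = l := by ring
  have h2 : |2 * X * (y * (1 - y))| ≤ 2 * l := by
    have a2 : |y * (1 - y)| ≤ 1 := abs_le.2 ⟨by nlinarith [hy.1, hy.2], by nlinarith [hy.1, hy.2]⟩
    rw [abs_mul, abs_mul, abs_two]
    calc 2 * |X| * |y * (1 - y)| ≤ 2 * l * 1 := by gcongr
      _ = 2 * l := by ring
  have h3 : |X * Y ^ 2| ≤ l := by
    rw [abs_mul, abs_pow]
    calc |X| * |Y| ^ 2 ≤ l * 1 ^ 2 := by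
          gcongr
          exact hY.trans hl
      _ = l := by ring
  rw [abs_le] at *
  constructor <;> linarith [h1.1, h1.2, h2.1, h2.2, h3.1, h3.2]

/-- Each of three factors contributes one power of l: the increment of the affine function, the
first moment of ∇u, and the length of the edge. -/
theorem abs_edgeDefect_le {P Q : Plane} {l : ℝ} (β γ : ℝ)
    (h1 : (P.1 + Q.1) / 2 ∈ Set.Icc (0 : ℝ) 1) (h2 : (P.2 + Q.2) / 2 ∈ Set.Icc (0 : ℝ) 1)
    (hX : |Q.1 - P.1| ≤ l) (hY : |Q.2 - P.2| ≤ l) (hl : l ≤ 1) :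
    |edgeDefect β γ P Q| ≤ 2 * l ^ 3 * (|β| + |γ|) := by
  have hl0 : 0 ≤ l := (abs_nonneg _).trans hX
  have m1 := abs_moment_le h1 h2 hX hY hl
  have m2 := abs_moment_le h2 h1 hY hX hl
  have e1 : edgeDefect β γ P Q = (β * (Q.1 - P.1) + γ * (Q.2 - P.2)) *
      ((Q.2 - P.2) * (((1 - 2 * ((P.1 + Q.1) / 2)) * (1 - 2 * ((P.2 + Q.2) / 2)) * (Q.2 - P.2) -
        2 * (Q.1 - P.1) * ((P.2 + Q.2) / 2 * (1 - (P.2 + Q.2) / 2))) / 12 +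
        (Q.1 - P.1) * (Q.2 - P.2) ^ 2 / 40) -
      (Q.1 - P.1) * (((1 - 2 * ((P.2 + Q.2) / 2)) * (1 - 2 * ((P.1 + Q.1) / 2)) * (Q.1 - P.1) -
        2 * (Q.2 - P.2) * ((P.1 + Q.1) / 2 * (1 - (P.1 + Q.1) / 2))) / 12 +
        (Q.2 - P.2) * (Q.1 - P.1) ^ 2 / 40)) := by
    unfold edgeDefect
    ring
  rw [e1, abs_mul]
  have h3 : |β * (Q.1 - P.1) + γ * (Q.2 - P.2)| ≤ (|β| + |γ|) * l := by
    refine (abs_add_le _ _).trans ?_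
    rw [abs_mul, abs_mul, add_mul]
    gcongr
  refine (mul_le_mul h3 (b := _) (d := l * l + l * l) ?_ (abs_nonneg _) (by positivity)).trans
    (le_of_eq (by ring))
  refine (abs_sub _ _).trans ?_
  rw [abs_mul, abs_mul]
  gcongr

theorem mem_Icc_of_mem_triangle (hp : p ∈ Set.Icc (0 : ℝ) 1)
    (hq : q ∈ Set.Icc (0 : ℝ) 1) (hr : r ∈ Set.Icc (0 : ℝ) 1) (hb : b ∈ Set.Icc (0 : ℝ) 1)
    (he : e ∈ Set.Icc (0 : ℝ) 1) {t s : ℝ} (ht : t ∈ Set.Icc (0 : ℝ) 1)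
    (hs : s ∈ Set.Icc (0 : ℝ) 1) :
    (1 - t) * (p + s * (q - p)) + t * r ∈ Set.Icc (0 : ℝ) 1 ∧
      b + t * (e - b) ∈ Set.Icc (0 : ℝ) 1 := by
  constructor
  · have h1 : p + s * (q - p) ∈ Set.Icc (0 : ℝ) 1 := by
      have := (convex_Icc (0 : ℝ) 1) hp hq (sub_nonneg.2 hs.2) hs.1 (by ring)
      simpa [smul_eq_mul, show (1 - s) * p + s * q = p + s * (q - p) by ring] using this
    simpa [smul_eq_mul] using
      (convex_Icc (0 : ℝ) 1) h1 hr (sub_nonneg.2 ht.2) ht.1 (by ring)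
  · have := (convex_Icc (0 : ℝ) 1) hb he (sub_nonneg.2 ht.2) ht.1 (by ring)
    simpa [smul_eq_mul, show (1 - t) * b + t * e = b + t * (e - b) by ring] using this

theorem abs_setIntegral_load_le (hpq : p < q) (hbe : b ≠ e) (hp : p ∈ Set.Icc (0 : ℝ) 1)
    (hq : q ∈ Set.Icc (0 : ℝ) 1) (hr : r ∈ Set.Icc (0 : ℝ) 1) (hb : b ∈ Set.Icc (0 : ℝ) 1)
    (he : e ∈ Set.Icc (0 : ℝ) 1) (w : Plane →ᵃ[ℝ] ℝ) :
    |∫ z in convexHull ℝ (Set.range (![(p, b), (q, b), (r, e)] : Fin 3 → Plane)),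
        modelF z * w z| ≤ (q - p) * |e - b| / 2 *
      (|w ((p + q) / 2, b)| + |w ((q + r) / 2, (b + e) / 2)| +
        |w ((p + r) / 2, (b + e) / 2)|) := by
  set M := |w ((p + q) / 2, b)| + |w ((q + r) / 2, (b + e) / 2)| +
        |w ((p + r) / 2, (b + e) / 2)| with hM
  have key : ∀ t ∈ Set.Icc (0 : ℝ) 1, ∀ s ∈ Set.Icc (0 : ℝ) 1,
      |modelF ((1 - t) * (p + s * (q - p)) + t * r, b + t * (e - b)) *
        w ((1 - t) * (p + s * (q - p)) + t * r, b + t * (e - b))| ≤ M := by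
    intro t ht s hs
    obtain ⟨hx, hy⟩ := mem_Icc_of_mem_triangle hp hq hr hb he ht hs
    have hf : |modelF ((1 - t) * (p + s * (q - p)) + t * r, b + t * (e - b))| ≤ 1 := by
      unfold modelF
      generalize (1 - t) * (p + s * (q - p)) + t * r = x at hx ⊢
      generalize b + t * (e - b) = y at hy ⊢
      simp only
      obtain ⟨h1, h2⟩ := hx
      obtain ⟨h3, h4⟩ := hy
      rw [abs_of_nonneg (by
        have := mul_nonneg h1 (sub_nonneg.2 h2)
        have := mul_nonneg h3 (sub_nonneg.2 h4)
        linarith)]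
      nlinarith [sq_nonneg (2 * x - 1), sq_nonneg (2 * y - 1)]
    -- In the barycentric coordinates t, (1 - t)(1 - s), (1 - t)s, the nodal basis for the edge
    -- midpoints consists of the functions 1 - 2λ, which are bounded by 1 in absolute value.
    have hw : w ((1 - t) * (p + s * (q - p)) + t * r, b + t * (e - b)) =
        (1 - 2 * t) * w ((p + q) / 2, b) +
        (1 - 2 * ((1 - t) * (1 - s))) * w ((q + r) / 2, (b + e) / 2) +
        (1 - 2 * ((1 - t) * s)) * w ((p + r) / 2, (b + e) / 2) := by
      rw [affine_apply_eq w ((p + q) / 2, b), affine_apply_eq w ((q + r) / 2, (b + e) / 2),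
        affine_apply_eq w ((p + r) / 2, (b + e) / 2), affine_apply_eq w (_, b + t * (e - b))]
      ring
    have habs : ∀ c ∈ Set.Icc (0 : ℝ) 1, ∀ g : ℝ, |(1 - 2 * c) * g| ≤ |g| := by
      intro c hc g
      rw [abs_mul]
      have : |1 - 2 * c| ≤ 1 := abs_le.2 ⟨by linarith [hc.2], by linarith [hc.1]⟩
      exact mul_le_of_le_one_left (abs_nonneg _) this
    rw [abs_mul]
    refine (mul_le_of_le_one_left (abs_nonneg _) hf).trans ?_
    rw [hw]
    have ht' : 1 - t ∈ Set.Icc (0 : ℝ) 1 := ⟨by linarith [ht.2], by linarith [ht.1]⟩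
    have hs' : 1 - s ∈ Set.Icc (0 : ℝ) 1 := ⟨by linarith [hs.2], by linarith [hs.1]⟩
    refine (abs_add_three _ _ _).trans (add_le_add_three (habs _ ht _) (habs _ ?_ _) (habs _ ?_ _))
    · exact ⟨mul_nonneg ht'.1 hs'.1, mul_le_one₀ ht'.2 hs'.1 hs'.2⟩
    · exact ⟨mul_nonneg ht'.1 hs.1, mul_le_one₀ ht'.2 hs.1 hs.2⟩
  have hc : Continuous fun z => modelF z * w z := continuous_modelF.mul (continuous_affine w)
  rw [abs_le]
  constructor
  · rw [neg_le, ← integral_neg]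
    exact setIntegral_triangle_le hpq hbe hc.neg
      fun t ht s hs => (neg_le_abs _).trans (key t ht s hs)
  · exact setIntegral_triangle_le hpq hbe hc
      fun t ht s hs => (le_abs_self _).trans (key t ht s hs)

/-- Along a horizontal slice u_x is linear in the parameter s with slope A, so it deviates from any
constant by at least A²/12 in mean square. The constant 180 comes from ∫ (1 - t)³t² dt = 1/60. -/
theorem le_setIntegral_modelUx_sub_sq (hpq : p < q) (hbe : b ≠ e) (hb : b ∈ Set.Icc (0 : ℝ) 1)
    (he : e ∈ Set.Icc (0 : ℝ) 1) (c : ℝ) :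
    (q - p) ^ 3 * |e - b| * (e * (1 - e)) ^ 2 / 180 ≤
      ∫ z in convexHull ℝ (Set.range (![(p, b), (q, b), (r, e)] : Fin 3 → Plane)),
        (modelUx z - c) ^ 2 := by
  rw [setIntegral_triangle (f := fun z => (modelUx z - c) ^ 2) hpq hbe
    ((continuous_modelUx.sub continuous_const).pow 2)]
  have hpq' : 0 < q - p := sub_pos.2 hpq
  obtain ⟨Y, hYc, hYe⟩ : ∃ Y : ℝ → ℝ, Continuous Y ∧
      ∀ t, Y t = (b + t * (e - b)) * (1 - (b + t * (e - b))) := ⟨_, by fun_prop, fun _ => rfl⟩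
  obtain ⟨A, hAc, hAe⟩ : ∃ A : ℝ → ℝ, Continuous A ∧
      ∀ t, A t = -2 * (1 - t) * (q - p) * Y t := ⟨_, by fun_prop, fun _ => rfl⟩
  obtain ⟨B, hBc, hBe⟩ : ∃ B : ℝ → ℝ, Continuous B ∧
      ∀ t, B t = (1 - 2 * ((1 - t) * p + t * r)) * Y t - c := ⟨_, by fun_prop, fun _ => rfl⟩
  have inner : ∀ t : ℝ, ∫ s in (0 : ℝ)..1,
      (modelUx ((1 - t) * (p + s * (q - p)) + t * r, b + t * (e - b)) - c) ^ 2 =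
      A t ^ 2 / 3 + A t * B t + B t ^ 2 := by
    intro t
    have : ∀ s : ℝ, (modelUx ((1 - t) * (p + s * (q - p)) + t * r, b + t * (e - b)) - c) ^ 2 =
      B t ^ 2 + 2 * A t * B t * s + A t ^ 2 * s ^ 2 + 0 * s ^ 3 + 0 * s ^ 4 + 0 * s ^ 5 := by
      intro s
      have h : modelUx ((1 - t) * (p + s * (q - p)) + t * r, b + t * (e - b)) - c =
          B t + A t * s := by
        simp only [modelUx, hBe, hAe, ← hYe]
        ring
      rw [h]
      ring
    simp_rw [this]
    rw [integral_quintic]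
    ring
  simp_rw [inner]
  have outer : ∫ t in (0 : ℝ)..1, (1 - t) ^ 3 * t ^ 2 * ((q - p) ^ 2 * (e * (1 - e)) ^ 2 / 3) =
      (q - p) ^ 2 * (e * (1 - e)) ^ 2 / 180 := by
    set k := (q - p) ^ 2 * (e * (1 - e)) ^ 2 / 3 with hk
    have : ∀ t : ℝ, (1 - t) ^ 3 * t ^ 2 * k =
        0 + 0 * t + k * t ^ 2 + (-3 * k) * t ^ 3 + (3 * k) * t ^ 4 + (-k) * t ^ 5 := by
      intro t
      ring
    simp_rw [this]
    rw [integral_quintic, hk]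
    ring
  have h1 : (q - p) ^ 3 * |e - b| * (e * (1 - e)) ^ 2 / 180 =
      (q - p) * |e - b| * ((q - p) ^ 2 * (e * (1 - e)) ^ 2 / 180) := by ring
  rw [h1, ← outer]
  refine mul_le_mul_of_nonneg_left ?_ (by positivity)
  refine intervalIntegral.integral_mono_on zero_le_one
    (Continuous.intervalIntegrable (by fun_prop) _ _)
    (Continuous.intervalIntegrable (by fun_prop) _ _) ?_
  intro t ht
  have ht' : 0 ≤ 1 - t := sub_nonneg.2 ht.2
  -- Concavity of y(1 - y) between b and e.
  have hY : t * (e * (1 - e)) ≤ Y t := by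
    have : Y t = t * (e * (1 - e)) + (1 - t) * (b * (1 - b)) + t * (1 - t) * (e - b) ^ 2 := by
      rw [hYe]
      ring
    rw [this]
    have h2 : 0 ≤ (1 - t) * (b * (1 - b)) :=
      mul_nonneg ht' (mul_nonneg hb.1 (sub_nonneg.2 hb.2))
    have h3 : 0 ≤ t * (1 - t) * (e - b) ^ 2 := mul_nonneg (mul_nonneg ht.1 ht') (sq_nonneg _)
    linarith
  have hY0 : 0 ≤ t * (e * (1 - e)) := mul_nonneg ht.1 (mul_nonneg he.1 (sub_nonneg.2 he.2))
  have hsq : (t * (e * (1 - e))) ^ 2 ≤ Y t ^ 2 := pow_le_pow_left₀ hY0 hY 2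
  have h4 : (1 - t) ^ 3 * t ^ 2 * ((q - p) ^ 2 * (e * (1 - e)) ^ 2 / 3) =
      (1 - t) * ((1 - t) ^ 2 * (q - p) ^ 2 * (t * (e * (1 - e))) ^ 2 / 3) := by ring
  rw [h4]
  refine mul_le_mul_of_nonneg_left ?_ ht'
  have h5 : (1 - t) ^ 2 * (q - p) ^ 2 * (t * (e * (1 - e))) ^ 2 / 3 ≤
      (1 - t) ^ 2 * (q - p) ^ 2 * Y t ^ 2 / 3 := by gcongr
  have h6 : A t ^ 2 = 4 * ((1 - t) ^ 2 * (q - p) ^ 2 * Y t ^ 2) := by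
    rw [hAe]
    ring
  -- A²/3 + AB + B² = A²/12 + (B + A/2)².
  linarith [sq_nonneg (B t + A t / 2)]

/-- The slopes of an affine function in terms of its values at the edge midpoints. -/
theorem slopeX_eq_of_midpoint_values (hpq : p < q) (w : Plane →ᵃ[ℝ] ℝ) :
    slopeX w = 2 * (w ((q + r) / 2, (b + e) / 2) - w ((p + r) / 2, (b + e) / 2)) / (q - p) := by
  have : q - p ≠ 0 := (sub_pos.2 hpq).ne'
  rw [eq_div_iff this, affine_apply_eq w ((q + r) / 2, (b + e) / 2),
    affine_apply_eq w ((p + r) / 2, (b + e) / 2)]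
  ring

theorem base_midpoint_value (w : Plane →ᵃ[ℝ] ℝ) :
    w ((p + q) / 2, b) = w ((p + r) / 2, (b + e) / 2) + slopeX w * (q - r) / 2 -
      slopeY w * (e - b) / 2 := by
  rw [affine_apply_eq w ((p + q) / 2, b), affine_apply_eq w ((p + r) / 2, (b + e) / 2)]
  ring

end TriangleBounds

/-! ### Midpoint values instead of edge integrals -/

section EdgeMidpoints

variable {ι : Type} (T : ι → Fin 3 → Plane)

/-- The midpoint of the edge of triangle `i` opposite to its vertex `k`. -/
def edgeMidpoint (i : ι) (k : Fin 3) : Plane := midpoint ℝ (T i (k + 1)) (T i (k + 2))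

variable {T}

/-- The nonconforming P1 space in terms of the values at the edge midpoints. -/
theorem mem_crouzeixRaviart_iff (hT : ∀ i k, T i (k + 1) ≠ T i (k + 2))
    (v : ι → (Plane →ᵃ[ℝ] ℝ)) :
    v ∈ crouzeixRaviart T ↔
      (∀ i i₂ k k₂, i ≠ i₂ → edge T i k = edge T i₂ k₂ →
        v i (edgeMidpoint T i k) = v i₂ (edgeMidpoint T i₂ k₂)) ∧
      (∀ i k, IsBoundaryEdge T i k → v i (edgeMidpoint T i k) = 0) := by
  have hpos : ∀ i k, 0 < Real.sqrt (((T i (k + 2)).1 - (T i (k + 1)).1) ^ 2 +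
      ((T i (k + 2)).2 - (T i (k + 1)).2) ^ 2) := by
    intro i k
    apply Real.sqrt_pos.2
    by_contra hcon
    have s1 := sq_nonneg ((T i (k + 2)).1 - (T i (k + 1)).1)
    have s2 := sq_nonneg ((T i (k + 2)).2 - (T i (k + 1)).2)
    have h1 : (T i (k + 2)).1 - (T i (k + 1)).1 = 0 := pow_eq_zero_iff two_ne_zero |>.1 (by linarith)
    have h2 : (T i (k + 2)).2 - (T i (k + 1)).2 = 0 := pow_eq_zero_iff two_ne_zero |>.1 (by linarith)
    exact hT i k (Prod.ext (by linarith) (by linarith))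
  have hlen : ∀ i i₂ k k₂, edge T i k = edge T i₂ k₂ →
      Real.sqrt (((T i (k + 2)).1 - (T i (k + 1)).1) ^ 2 +
        ((T i (k + 2)).2 - (T i (k + 1)).2) ^ 2) =
      Real.sqrt (((T i₂ (k₂ + 2)).1 - (T i₂ (k₂ + 1)).1) ^ 2 +
        ((T i₂ (k₂ + 2)).2 - (T i₂ (k₂ + 1)).2) ^ 2) := by
    intro i i₂ k k₂ h
    unfold edge at h
    rcases Sym2.eq_iff.1 h with ⟨h1, h2⟩ | ⟨h1, h2⟩
    · rw [h1, h2]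
    · rw [h1, h2]
      congr 1
      ring
  have hedge : ∀ i k, integralOnEdge T i k (v i) =
      Real.sqrt (((T i (k + 2)).1 - (T i (k + 1)).1) ^ 2 +
        ((T i (k + 2)).2 - (T i (k + 1)).2) ^ 2) * v i (edgeMidpoint T i k) :=
    fun i k => edgeIntegral_affine _ _ _
  simp only [crouzeixRaviart, Set.mem_ofPred_eq, hedge]
  constructor
  · rintro ⟨h1, h2⟩
    refine ⟨fun i i₂ k k₂ hi he => ?_, fun i k hb => ?_⟩
    · have := h1 i i₂ k k₂ hi he
      rw [hlen i i₂ k k₂ he] at this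
      exact mul_left_cancel₀ (hpos i₂ k₂).ne' this
    · exact (mul_eq_zero.1 (h2 i k hb)).resolve_left (hpos i k).ne'
  · rintro ⟨h1, h2⟩
    refine ⟨fun i i₂ k k₂ hi he => ?_, fun i k hb => ?_⟩
    · rw [hlen i i₂ k k₂ he, h1 i i₂ k k₂ hi he]
    · rw [h2 i k hb, mul_zero]

end EdgeMidpoints

/-! ### Combinatorics of the mesh and nodal values -/

section Mesh

variable {n m : ℕ}

/-- The horizontal grid index of a vertex of a triangle of the mesh. -/
def vertexX (n : ℕ) : Fin n ⊕ Fin (n + 1) → Fin 3 → ℕ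
  | Sum.inl a => ![2 * a, 2 * a + 2, 2 * a + 1]
  | Sum.inr a => ![2 * a - 1, min (2 * a + 1) (2 * n), 2 * a]

/-- The vertical grid index of a vertex of a triangle of the mesh. -/
def vertexY (n j : ℕ) : Fin n ⊕ Fin (n + 1) → Fin 3 → ℕ
  | Sum.inl _ => ![2 * ((j + 1) / 2), 2 * ((j + 1) / 2), 2 * (j / 2) + 1]
  | Sum.inr _ => ![2 * (j / 2) + 1, 2 * (j / 2) + 1, 2 * ((j + 1) / 2)]

theorem babuskaAziz_apply (j : Fin (2 * m)) (s : Fin n ⊕ Fin (n + 1)) (k : Fin 3) :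
    babuskaAziz n m (j, s) k = gridPoint n m (vertexX n s k) (vertexY n j s k) := by
  rcases s with a | a <;> fin_cases k <;> rfl

theorem gridPoint_injective (hn : 1 ≤ n) (hm : 1 ≤ m) {i j i' j' : ℕ}
    (h : gridPoint n m i j = gridPoint n m i' j') : i = i' ∧ j = j' := by
  have hn' : (0 : ℝ) < 2 * n := by positivity
  have hm' : (0 : ℝ) < 2 * m := by positivity
  unfold gridPoint at h
  rw [Prod.ext_iff] at h
  have h1 := h.1
  have h2 := h.2
  simp only at h1 h2
  rw [div_left_inj' hn'.ne'] at h1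
  rw [div_left_inj' hm'.ne'] at h2
  exact ⟨by exact_mod_cast h1, by exact_mod_cast h2⟩

/-- The index sums encode the midpoint of the edge and so do not depend on the order of its end
points; they reduce questions about coinciding edges to arithmetic in ℕ. -/
theorem edge_index_sum_eq (hn : 1 ≤ n) (hm : 1 ≤ m) {j j' : Fin (2 * m)}
    {s s' : Fin n ⊕ Fin (n + 1)} {k k' : Fin 3}
    (h : edge (babuskaAziz n m) (j, s) k = edge (babuskaAziz n m) (j', s') k') :
    vertexX n s (k + 1) + vertexX n s (k + 2) = vertexX n s' (k' + 1) + vertexX n s' (k' + 2) ∧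
    vertexY n j s (k + 1) + vertexY n j s (k + 2) =
      vertexY n j' s' (k' + 1) + vertexY n j' s' (k' + 2) := by
  unfold edge at h
  simp only [babuskaAziz_apply] at h
  rcases Sym2.eq_iff.1 h with ⟨h1, h2⟩ | ⟨h1, h2⟩
  · have h3 := gridPoint_injective hn hm h1
    have h4 := gridPoint_injective hn hm h2
    omega
  · have h3 := gridPoint_injective hn hm h1
    have h4 := gridPoint_injective hn hm h2
    omega

theorem babuskaAziz_vertices_ne (hn : 1 ≤ n) (hm : 1 ≤ m) (i : Fin (2 * m) × (Fin n ⊕ Fin (n + 1)))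
    (k : Fin 3) : babuskaAziz n m i (k + 1) ≠ babuskaAziz n m i (k + 2) := by
  obtain ⟨j, s⟩ := i
  intro h
  rw [babuskaAziz_apply, babuskaAziz_apply] at h
  have := gridPoint_injective hn hm h
  rcases s with a | a <;> fin_cases k <;> simp [vertexX, vertexY] at this <;> omega

/-- The values of `w` at the edge midpoints are given by nodal functions: `S j i` on the `2 * n + 2`
midpoints of the non-horizontal edges in the strip `j`, `H k a` and `O k a` on the midpoints of the
horizontal edges on the lines with index `2k` and `2k + 1`, respectively; the nodal values on the
boundary vanish. -/
structure HasNodalValues (n m : ℕ) (w : Fin (2 * m) × (Fin n ⊕ Fin (n + 1)) → (Plane →ᵃ[ℝ] ℝ))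
    (S H O : ℕ → ℕ → ℝ) : Prop where
  left : ∀ j, S j 0 = 0
  right : ∀ j, S j (2 * n + 1) = 0
  bot : ∀ a, H 0 a = 0
  top : ∀ a, H m a = 0
  inl : ∀ (j : Fin (2 * m)) (a : Fin n),
    w (j, Sum.inl a) (edgeMidpoint (babuskaAziz n m) (j, Sum.inl a) 0) = S j (2 * a + 2) ∧
    w (j, Sum.inl a) (edgeMidpoint (babuskaAziz n m) (j, Sum.inl a) 1) = S j (2 * a + 1) ∧
    w (j, Sum.inl a) (edgeMidpoint (babuskaAziz n m) (j, Sum.inl a) 2) = H ((j + 1) / 2) a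
  inr : ∀ (j : Fin (2 * m)) (a : Fin (n + 1)),
    w (j, Sum.inr a) (edgeMidpoint (babuskaAziz n m) (j, Sum.inr a) 0) = S j (2 * a + 1) ∧
    w (j, Sum.inr a) (edgeMidpoint (babuskaAziz n m) (j, Sum.inr a) 1) = S j (2 * a) ∧
    w (j, Sum.inr a) (edgeMidpoint (babuskaAziz n m) (j, Sum.inr a) 2) = O (j / 2) a

theorem edge_eq_of_index_eq {j j' : Fin (2 * m)} {s s' : Fin n ⊕ Fin (n + 1)} {k k' : Fin 3}
    (h : (vertexX n s (k + 1) = vertexX n s' (k' + 1) ∧ vertexX n s (k + 2) = vertexX n s' (k' + 2) ∧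
      vertexY n j s (k + 1) = vertexY n j' s' (k' + 1) ∧
      vertexY n j s (k + 2) = vertexY n j' s' (k' + 2)) ∨
      (vertexX n s (k + 1) = vertexX n s' (k' + 2) ∧ vertexX n s (k + 2) = vertexX n s' (k' + 1) ∧
      vertexY n j s (k + 1) = vertexY n j' s' (k' + 2) ∧
      vertexY n j s (k + 2) = vertexY n j' s' (k' + 1))) :
    edge (babuskaAziz n m) (j, s) k = edge (babuskaAziz n m) (j', s') k' := by
  unfold edge
  simp only [babuskaAziz_apply]
  rcases h with ⟨h1, h2, h3, h4⟩ | ⟨h1, h2, h3, h4⟩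
  · rw [h1, h2, h3, h4]
  · rw [h1, h2, h3, h4, Sym2.eq_swap]

/-- This and the next three lemmas supply all adjacencies of the mesh: two types of slanted edges
inside a strip, and horizontal edges on even and on odd lines between consecutive strips. -/
theorem edge_inl_zero (j : Fin (2 * m)) (a : Fin n) :
    edge (babuskaAziz n m) (j, Sum.inl a) 0 = edge (babuskaAziz n m) (j, Sum.inr a.succ) 1 := by
  apply edge_eq_of_index_eq
  left
  have := a.2
  simp [vertexX, vertexY]
  omega

theorem edge_inl_one (j : Fin (2 * m)) (a : Fin n) :
    edge (babuskaAziz n m) (j, Sum.inl a) 1 =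
      edge (babuskaAziz n m) (j, Sum.inr a.castSucc) 0 := by
  apply edge_eq_of_index_eq
  left
  have := a.2
  simp [vertexX, vertexY]

theorem edge_inl_two {j j' : Fin (2 * m)} (h : ((j : ℕ) + 1) / 2 = (j' + 1) / 2) (a : Fin n) :
    edge (babuskaAziz n m) (j, Sum.inl a) 2 = edge (babuskaAziz n m) (j', Sum.inl a) 2 := by
  apply edge_eq_of_index_eq
  left
  simp [vertexX, vertexY]
  omega

theorem edge_inr_two {j j' : Fin (2 * m)} (h : (j : ℕ) / 2 = j' / 2) (a : Fin (n + 1)) :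
    edge (babuskaAziz n m) (j, Sum.inr a) 2 = edge (babuskaAziz n m) (j', Sum.inr a) 2 := by
  apply edge_eq_of_index_eq
  left
  simp [vertexX, vertexY]
  omega

/-- The nodal value at the point `(X / (4 * n), Y / (4 * m))`. -/
def nodalLookup (n : ℕ) (S H O : ℕ → ℕ → ℝ) (X Y : ℕ) : ℝ :=
  if Y % 2 = 1 then S (Y / 2) (if X = 4 * n then 2 * n + 1 else (X + 1) / 2)
  else if Y % 4 = 0 then H (Y / 4) (X / 4) else O (Y / 4) ((X + 1) / 4)

/-- The separate case X = 4n is the edge on the side x = 1: there the rule (X + 1)/2 would give 2n,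
the index of the last interior node. -/
theorem nodalLookup_odd {S H O : ℕ → ℕ → ℝ} {X Y i j : ℕ} (hY : Y = 2 * j + 1)
    (hX : (X = 4 * n ∧ i = 2 * n + 1) ∨ (X ≠ 4 * n ∧ (X + 1) / 2 = i)) :
    nodalLookup n S H O X Y = S j i := by
  unfold nodalLookup
  rw [if_pos (by omega)]
  rcases hX with ⟨h1, h2⟩ | ⟨h1, h2⟩
  · rw [if_pos h1, h2]
    congr 1
    omega
  · rw [if_neg h1, h2]
    congr 1
    omega

theorem nodalLookup_four_mul {S H O : ℕ → ℕ → ℝ} {X Y k a : ℕ} (hY : Y = 4 * k)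
    (hX : X / 4 = a) : nodalLookup n S H O X Y = H k a := by
  unfold nodalLookup
  rw [if_neg (by omega), if_pos (by omega), hX]
  congr 1
  omega

/-- The shift in (X + 1)/4 accommodates the horizontal edges of half length at the vertical sides,
where X is 1 or 4n - 1 instead of 4a. -/
theorem nodalLookup_four_mul_add_two {S H O : ℕ → ℕ → ℝ} {X Y k a : ℕ} (hY : Y = 4 * k + 2)
    (hX : (X + 1) / 4 = a) : nodalLookup n S H O X Y = O k a := by
  unfold nodalLookup
  rw [if_neg (by omega), if_neg (by omega), hX]
  congr 1
  omega

/-- Functions with nodal values belong to the nonconforming P1 space. -/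
theorem HasNodalValues.mem (hn : 1 ≤ n) (hm : 1 ≤ m)
    {w : Fin (2 * m) × (Fin n ⊕ Fin (n + 1)) → (Plane →ᵃ[ℝ] ℝ)} {S H O : ℕ → ℕ → ℝ}
    (h : HasNodalValues n m w S H O) : w ∈ crouzeixRaviart (babuskaAziz n m) := by
  rw [mem_crouzeixRaviart_iff (babuskaAziz_vertices_ne hn hm)]
  constructor
  -- The nodal value depends on the midpoint of the edge only, hence is the same for both triangles
  -- that share the edge.
  · have key : ∀ (j : Fin (2 * m)) (s : Fin n ⊕ Fin (n + 1)) (k : Fin 3),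
        w (j, s) (edgeMidpoint (babuskaAziz n m) (j, s) k) =
          nodalLookup n S H O (vertexX n s (k + 1) + vertexX n s (k + 2))
            (vertexY n j s (k + 1) + vertexY n j s (k + 2)) := by
      intro j s k
      rcases s with a | a
      · obtain ⟨h0, h1, h2⟩ := h.inl j a
        have ha := a.2
        fin_cases k
        · refine h0.trans (nodalLookup_odd ?_ ?_).symm <;> simp [vertexX, vertexY] <;> omega
        · refine h1.trans (nodalLookup_odd ?_ ?_).symm <;> simp [vertexX, vertexY] <;> omega
        · refine h2.trans (nodalLookup_four_mul ?_ ?_).symm <;> simp [vertexX, vertexY] <;> omega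
      · obtain ⟨h0, h1, h2⟩ := h.inr j a
        have ha := a.2
        fin_cases k
        · refine h0.trans (nodalLookup_odd ?_ ?_).symm <;> simp [vertexX, vertexY] <;> omega
        · refine h1.trans (nodalLookup_odd ?_ ?_).symm <;> simp [vertexX, vertexY] <;> omega
        · refine h2.trans (nodalLookup_four_mul_add_two ?_ ?_).symm <;>
            simp [vertexX, vertexY] <;> omega
    rintro ⟨j, s⟩ ⟨j', s'⟩ k k' - he
    obtain ⟨h1, h2⟩ := edge_index_sum_eq hn hm he
    rw [key, key, h1, h2]
  -- Edges off the boundary of the square have a second triangle, which contradicts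
  -- `IsBoundaryEdge`; on the remaining ones the nodal value is zero by assumption.
  · rintro ⟨j, s⟩ k hb
    have hj := j.2
    rcases s with a | a
    · obtain ⟨h0, h1, h2⟩ := h.inl j a
      fin_cases k
      · exact absurd (hb _ _ (edge_inl_zero j a).symm) (by simp)
      · exact absurd (hb _ _ (edge_inl_one j a).symm) (by simp)
      · refine h2.trans ?_
        by_cases hj0 : (j : ℕ) = 0
        · rw [hj0]
          exact h.bot _
        by_cases hj1 : (j : ℕ) = 2 * m - 1
        · rw [show ((j : ℕ) + 1) / 2 = m by omega]
          exact h.top _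
        exfalso
        rcases Nat.even_or_odd' (j : ℕ) with ⟨c, hc | hc⟩
        · have := hb _ _ (edge_inl_two (n := n) (j := ⟨(j : ℕ) - 1, by omega⟩) (j' := j)
            (by simp only; omega) a)
          simp [Fin.ext_iff] at this
          omega
        · have := hb _ _ (edge_inl_two (n := n) (j := ⟨(j : ℕ) + 1, by omega⟩) (j' := j)
            (by simp only; omega) a)
          simp [Fin.ext_iff] at this
    · obtain ⟨h0, h1, h2⟩ := h.inr j a
      have ha := a.2
      fin_cases k
      · refine h0.trans ?_
        by_cases han : (a : ℕ) = n
        · rw [han]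
          exact h.right _
        · exact absurd (hb _ _ (edge_inl_one (n := n) j ⟨a, by omega⟩)) (by simp)
      · refine h1.trans ?_
        by_cases ha0 : (a : ℕ) = 0
        · rw [ha0]
          exact h.left _
        · have : a = Fin.succ ⟨(a : ℕ) - 1, by omega⟩ := by
            ext
            simp
            omega
          exact absurd (hb (j, Sum.inl ⟨(a : ℕ) - 1, by omega⟩) 0
            ((edge_inl_zero (n := n) j ⟨(a : ℕ) - 1, by omega⟩).trans (by rw [← this]; rfl)))
            (by simp)
      · exfalso
        rcases Nat.even_or_odd' (j : ℕ) with ⟨c, hc | hc⟩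
        · have := hb _ _ (edge_inr_two (n := n) (j := ⟨(j : ℕ) + 1, by omega⟩) (j' := j)
            (by simp only; omega) a)
          simp [Fin.ext_iff] at this
        · have := hb _ _ (edge_inr_two (n := n) (j := ⟨(j : ℕ) - 1, by omega⟩) (j' := j)
            (by simp only; omega) a)
          simp [Fin.ext_iff] at this
          omega

/-- The elements of the nonconforming P1 space have nodal values. -/
theorem exists_hasNodalValues (hn : 1 ≤ n) (hm : 1 ≤ m)
    {w : Fin (2 * m) × (Fin n ⊕ Fin (n + 1)) → (Plane →ᵃ[ℝ] ℝ)}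
    (hw : w ∈ crouzeixRaviart (babuskaAziz n m)) :
    ∃ S H O : ℕ → ℕ → ℝ, HasNodalValues n m w S H O := by
  rw [mem_crouzeixRaviart_iff (babuskaAziz_vertices_ne hn hm)] at hw
  obtain ⟨hint, hbd⟩ := hw
  set val : Fin (2 * m) → (Fin n ⊕ Fin (n + 1)) → Fin 3 → ℝ :=
    fun j s k => w (j, s) (edgeMidpoint (babuskaAziz n m) (j, s) k) with hval
  have eq_of_edge : ∀ j s k j' s' k', (j, s) ≠ (j', s') →
      edge (babuskaAziz n m) (j, s) k = edge (babuskaAziz n m) (j', s') k' →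
      val j s k = val j' s' k' := fun j s k j' s' k' h1 h2 => hint _ _ _ _ h1 h2
  -- For edges on the sides of the square the index sums determine the triangle, so these edges are
  -- boundary edges.
  have hleft : ∀ j (a : Fin (n + 1)), (a : ℕ) = 0 → val j (Sum.inr a) 1 = 0 := by
    intro j a ha
    apply hbd
    rintro ⟨j', s'⟩ k' he
    obtain ⟨h1, h2⟩ := edge_index_sum_eq hn hm he
    rcases s' with a' | a' <;> fin_cases k' <;>
      simp [vertexX, vertexY, Fin.ext_iff] at h1 h2 ⊢ <;> omega
  have hright : ∀ j (a : Fin (n + 1)), (a : ℕ) = n → val j (Sum.inr a) 0 = 0 := by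
    intro j a ha
    apply hbd
    rintro ⟨j', s'⟩ k' he
    obtain ⟨h1, h2⟩ := edge_index_sum_eq hn hm he
    rcases s' with a' | a' <;> fin_cases k' <;>
      simp [vertexX, vertexY, Fin.ext_iff] at h1 h2 ⊢ <;> omega
  have hbot : ∀ (j : Fin (2 * m)) a, (j : ℕ) = 0 → val j (Sum.inl a) 2 = 0 := by
    intro j a hj
    apply hbd
    rintro ⟨j', s'⟩ k' he
    obtain ⟨h1, h2⟩ := edge_index_sum_eq hn hm he
    rcases s' with a' | a' <;> fin_cases k' <;>
      simp [vertexX, vertexY, Fin.ext_iff] at h1 h2 ⊢ <;> omega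
  have htop : ∀ (j : Fin (2 * m)) a, (j : ℕ) = 2 * m - 1 → val j (Sum.inl a) 2 = 0 := by
    intro j a hj
    apply hbd
    rintro ⟨j', s'⟩ k' he
    obtain ⟨h1, h2⟩ := edge_index_sum_eq hn hm he
    rcases s' with a' | a' <;> fin_cases k' <;>
      simp [vertexX, vertexY, Fin.ext_iff] at h1 h2 ⊢ <;> omega
  -- Slanted values are read off from the `Sum.inr` triangles, which have all 2n + 2 slanted edges
  -- of a strip among their edges; horizontal values are read off in the strip of even index 2k. The
  -- default value 0 for k = m fits the top side, where the function vanishes.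
  refine ⟨fun j i => if h : j < 2 * m ∧ i < 2 * n + 2 then
      val ⟨j, h.1⟩ (Sum.inr ⟨i / 2, by omega⟩) (if i % 2 = 0 then 1 else 0) else 0,
    fun k a => if h : k < m ∧ a < n then val ⟨2 * k, by omega⟩ (Sum.inl ⟨a, h.2⟩) 2 else 0,
    fun k a => if h : k < m ∧ a < n + 1 then val ⟨2 * k, by omega⟩ (Sum.inr ⟨a, h.2⟩) 2 else 0,
    ?_, ?_, ?_, ?_, ?_, ?_⟩
  · intro j
    by_cases h : j < 2 * m ∧ 0 < 2 * n + 2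
    · rw [dif_pos h]
      exact hleft ⟨j, h.1⟩ _ rfl
    · rw [dif_neg h]
  · intro j
    by_cases h : j < 2 * m ∧ 2 * n + 1 < 2 * n + 2
    · rw [dif_pos h, if_neg (by omega)]
      exact hright ⟨j, h.1⟩ _ (by simp only; omega)
    · rw [dif_neg h]
  · intro a
    split_ifs with h
    · exact hbot _ _ rfl
    · rfl
  · intro a
    rw [dif_neg (by omega)]
  · intro j a
    have ha := a.2
    have hj := j.2
    refine ⟨?_, ?_, ?_⟩
    · rw [dif_pos (by omega), if_pos (by omega)]
      refine (eq_of_edge j (Sum.inl a) 0 j (Sum.inr a.succ) 1 (by simp) (edge_inl_zero j a)).trans ?_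
      congr 2
      ext
      simp
    · rw [dif_pos (by omega), if_neg (by omega)]
      refine (eq_of_edge j (Sum.inl a) 1 j (Sum.inr a.castSucc) 0 (by simp)
        (edge_inl_one j a)).trans ?_
      congr 2
      ext
      simp
      omega
    · split_ifs with h
      · by_cases hj' : (j : ℕ) = 2 * (((j : ℕ) + 1) / 2)
        · change val j (Sum.inl a) 2 = _
          congr 1
          ext
          exact hj'
        · exact eq_of_edge j (Sum.inl a) 2 ⟨2 * (((j : ℕ) + 1) / 2), by omega⟩ (Sum.inl a) 2
            (by simpa [Fin.ext_iff] using hj') (edge_inl_two (by simp only; omega) a)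
      · exact htop j a (by omega)
  · intro j a
    have ha := a.2
    have hj := j.2
    refine ⟨?_, ?_, ?_⟩
    · rw [dif_pos (by omega), if_neg (by omega)]
      change val j (Sum.inr a) 0 = _
      congr 2
      ext
      simp only
      omega
    · rw [dif_pos (by omega), if_pos (by omega)]
      change val j (Sum.inr a) 1 = _
      congr 2
      ext
      simp
    · rw [dif_pos (by omega)]
      by_cases hj' : (j : ℕ) = 2 * ((j : ℕ) / 2)
      · change val j (Sum.inr a) 2 = _
        congr 1
        ext
        exact hj'
      · exact eq_of_edge j (Sum.inr a) 2 ⟨2 * ((j : ℕ) / 2), by omega⟩ (Sum.inr a) 2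
          (by simpa [Fin.ext_iff] using hj') (edge_inr_two (by simp only; omega) a)

end Mesh

/-! ### Coordinates, orientation and area of the mesh triangles -/

section MeshGeometry

variable {n m : ℕ}

/-- The left end of the horizontal edge of a triangle of the mesh. -/
def baseLeft (s : Fin n ⊕ Fin (n + 1)) : ℝ := (vertexX n s 0 : ℝ) / (2 * n)

/-- The right end of the horizontal edge of a triangle of the mesh. -/
def baseRight (s : Fin n ⊕ Fin (n + 1)) : ℝ := (vertexX n s 1 : ℝ) / (2 * n)

/-- The abscissa of the vertex opposite to the horizontal edge. -/
def apexX (s : Fin n ⊕ Fin (n + 1)) : ℝ := (vertexX n s 2 : ℝ) / (2 * n)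

/-- The ordinate of the horizontal edge of a triangle of the mesh. -/
def baseY (m : ℕ) (j : ℕ) (s : Fin n ⊕ Fin (n + 1)) : ℝ := (vertexY n j s 0 : ℝ) / (2 * m)

/-- The ordinate of the vertex opposite to the horizontal edge. -/
def apexY (m : ℕ) (j : ℕ) (s : Fin n ⊕ Fin (n + 1)) : ℝ := (vertexY n j s 2 : ℝ) / (2 * m)

theorem babuskaAziz_eq (j : Fin (2 * m)) (s : Fin n ⊕ Fin (n + 1)) :
    babuskaAziz n m (j, s) =
      ![(baseLeft s, baseY m j s), (baseRight s, baseY m j s), (apexX s, apexY m j s)] := by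
  funext k
  rw [babuskaAziz_apply]
  rcases s with a | a <;> fin_cases k <;> rfl

theorem triangle_babuskaAziz (j : Fin (2 * m)) (s : Fin n ⊕ Fin (n + 1)) :
    triangle (babuskaAziz n m) (j, s) = convexHull ℝ (Set.range
      (![(baseLeft s, baseY m j s), (baseRight s, baseY m j s), (apexX s, apexY m j s)] :
        Fin 3 → Plane)) := by
  unfold triangle
  rw [babuskaAziz_eq]

theorem midpoint_plane (P Q : Plane) : midpoint ℝ P Q = ((P.1 + Q.1) / 2, (P.2 + Q.2) / 2) := by
  rw [midpoint_eq_smul_add]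
  ext <;> simp <;> ring

theorem edgeMidpoint_zero (j : Fin (2 * m)) (s : Fin n ⊕ Fin (n + 1)) :
    edgeMidpoint (babuskaAziz n m) (j, s) 0 =
      ((baseRight s + apexX s) / 2, (baseY m j s + apexY m j s) / 2) := by
  unfold edgeMidpoint
  rw [babuskaAziz_eq, midpoint_plane]
  rfl

theorem edgeMidpoint_one (j : Fin (2 * m)) (s : Fin n ⊕ Fin (n + 1)) :
    edgeMidpoint (babuskaAziz n m) (j, s) 1 =
      ((baseLeft s + apexX s) / 2, (baseY m j s + apexY m j s) / 2) := by
  unfold edgeMidpoint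
  rw [babuskaAziz_eq, midpoint_plane, add_comm (baseLeft s), add_comm (baseY m j s)]
  rfl

theorem edgeMidpoint_two (j : Fin (2 * m)) (s : Fin n ⊕ Fin (n + 1)) :
    edgeMidpoint (babuskaAziz n m) (j, s) 2 =
      ((baseLeft s + baseRight s) / 2, baseY m j s) := by
  unfold edgeMidpoint
  rw [babuskaAziz_eq, midpoint_plane]
  change ((baseLeft s + baseRight s) / 2, (baseY m j s + baseY m j s) / 2) = _
  rw [add_self_div_two]

theorem baseLeft_lt_baseRight (hn : 1 ≤ n) (s : Fin n ⊕ Fin (n + 1)) :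
    baseLeft s < baseRight s := by
  have hn' : (0 : ℝ) < 2 * n := by positivity
  unfold baseLeft baseRight
  rw [div_lt_div_iff_of_pos_right hn', Nat.cast_lt]
  rcases s with a | a
  · simp [vertexX]
  · have := a.2
    simp [vertexX]
    omega

theorem baseRight_sub_baseLeft_le (hn : 1 ≤ n) (s : Fin n ⊕ Fin (n + 1)) :
    baseRight s - baseLeft s ≤ 1 / n := by
  have hn' : (0 : ℝ) < 2 * n := by positivity
  have h : vertexX n s 1 ≤ vertexX n s 0 + 2 := by
    rcases s with a | a
    · simp [vertexX]
    · have := a.2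
      simp [vertexX]
      omega
  have h' : (vertexX n s 1 : ℝ) ≤ vertexX n s 0 + 2 := by exact_mod_cast h
  unfold baseLeft baseRight
  rw [← sub_div, show (1 : ℝ) / n = 2 / (2 * n) by field_simp,
    div_le_div_iff_of_pos_right hn']
  linarith

theorem baseLeft_le_apexX (s : Fin n ⊕ Fin (n + 1)) : baseLeft s ≤ apexX s := by
  unfold baseLeft apexX
  gcongr
  rcases s with a | a <;> simp [vertexX]

theorem apexX_le_baseRight (s : Fin n ⊕ Fin (n + 1)) : apexX s ≤ baseRight s := by
  unfold baseRight apexX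
  gcongr
  rcases s with a | a
  · simp [vertexX]
  · have := a.2
    simp [vertexX]
    omega

theorem baseLeft_nonneg (s : Fin n ⊕ Fin (n + 1)) : 0 ≤ baseLeft s := by
  unfold baseLeft
  positivity

theorem baseRight_le_one (hn : 1 ≤ n) (s : Fin n ⊕ Fin (n + 1)) : baseRight s ≤ 1 := by
  have hn' : (0 : ℝ) < 2 * n := by positivity
  have h : vertexX n s 1 ≤ 2 * n := by
    rcases s with a | a
    · have := a.2
      simp [vertexX]
      omega
    · simp [vertexX]
  have h' : (vertexX n s 1 : ℝ) ≤ 2 * n := by exact_mod_cast h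
  unfold baseRight
  rw [div_le_one hn']
  exact h'

theorem baseLeft_mem (hn : 1 ≤ n) (s : Fin n ⊕ Fin (n + 1)) :
    baseLeft s ∈ Set.Icc (0 : ℝ) 1 :=
  ⟨baseLeft_nonneg s, (baseLeft_lt_baseRight hn s).le.trans (baseRight_le_one hn s)⟩

theorem baseRight_mem (hn : 1 ≤ n) (s : Fin n ⊕ Fin (n + 1)) :
    baseRight s ∈ Set.Icc (0 : ℝ) 1 :=
  ⟨(baseLeft_nonneg s).trans (baseLeft_lt_baseRight hn s).le, baseRight_le_one hn s⟩

theorem apexX_mem (hn : 1 ≤ n) (s : Fin n ⊕ Fin (n + 1)) : apexX s ∈ Set.Icc (0 : ℝ) 1 :=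
  ⟨(baseLeft_nonneg s).trans (baseLeft_le_apexX s),
    (apexX_le_baseRight s).trans (baseRight_le_one hn s)⟩

theorem vertexY_le {j : ℕ} (hj : j < 2 * m) (s : Fin n ⊕ Fin (n + 1)) (k : Fin 3) :
    vertexY n j s k ≤ 2 * m := by
  rcases s with a | a <;> fin_cases k <;> simp [vertexY] <;> omega

theorem baseY_mem {j : ℕ} (hj : j < 2 * m) (s : Fin n ⊕ Fin (n + 1)) :
    baseY m j s ∈ Set.Icc (0 : ℝ) 1 := by
  have hm' : (0 : ℝ) < 2 * m := by
    have : 0 < m := by omega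
    positivity
  have h' : (vertexY n j s 0 : ℝ) ≤ 2 * m := by exact_mod_cast vertexY_le hj s 0
  unfold baseY
  exact ⟨by positivity, (div_le_one hm').2 h'⟩

theorem apexY_mem {j : ℕ} (hj : j < 2 * m) (s : Fin n ⊕ Fin (n + 1)) :
    apexY m j s ∈ Set.Icc (0 : ℝ) 1 := by
  have hm' : (0 : ℝ) < 2 * m := by
    have : 0 < m := by omega
    positivity
  have h' : (vertexY n j s 2 : ℝ) ≤ 2 * m := by exact_mod_cast vertexY_le hj s 2
  unfold apexY
  exact ⟨by positivity, (div_le_one hm').2 (by linarith)⟩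

/-- The orientation of a triangle of the mesh: `1` if its apex lies above its horizontal edge,
and `-1` otherwise. -/
def orient (n j : ℕ) : Fin n ⊕ Fin (n + 1) → ℝ
  | Sum.inl _ => (-1) ^ j
  | Sum.inr _ => -(-1) ^ j

theorem abs_orient (j : ℕ) (s : Fin n ⊕ Fin (n + 1)) : |orient n j s| = 1 := by
  rcases s with a | a <;> simp [orient]

theorem apexY_sub_baseY (j : ℕ) (s : Fin n ⊕ Fin (n + 1)) :
    apexY m j s - baseY m j s = orient n j s / (2 * m) := by
  unfold apexY baseY
  rw [← sub_div]
  congr 1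
  rcases Nat.even_or_odd' j with ⟨c, rfl | rfl⟩
  · have h1 : (2 * c + 1) / 2 = c := by omega
    rcases s with a | a <;> simp [vertexY, orient, h1]
  · have h1 : (2 * c + 1) / 2 = c := by omega
    have h2 : (2 * c + 1 + 1) / 2 = c + 1 := by omega
    rcases s with a | a <;> simp [vertexY, orient, h1, h2, pow_succ] <;> ring

theorem abs_apexY_sub_baseY (j : ℕ) (s : Fin n ⊕ Fin (n + 1)) :
    |apexY m j s - baseY m j s| = 1 / (2 * m) := by
  rw [apexY_sub_baseY, abs_div, abs_orient, abs_of_nonneg (by positivity : (0 : ℝ) ≤ 2 * m)]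

theorem baseY_ne_apexY (hm : 1 ≤ m) (j : ℕ) (s : Fin n ⊕ Fin (n + 1)) :
    baseY m j s ≠ apexY m j s := by
  have h := abs_apexY_sub_baseY (m := m) j s
  have hm' : (0 : ℝ) < 1 / (2 * m) := by positivity
  intro heq
  rw [heq, sub_self, abs_zero] at h
  exact hm'.ne h

theorem abs_div_apexY_sub_baseY (hm : 1 ≤ m) (j : ℕ) (s : Fin n ⊕ Fin (n + 1)) :
    |apexY m j s - baseY m j s| / (apexY m j s - baseY m j s) = orient n j s := by
  have hm' : (0 : ℝ) < 2 * m := by positivity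
  have h0 := sub_ne_zero.2 (baseY_ne_apexY hm j s).symm
  have h1 : orient n j s * orient n j s = 1 := by
    rw [← abs_mul_abs_self, abs_orient, one_mul]
  rw [div_eq_iff h0, abs_apexY_sub_baseY, apexY_sub_baseY, mul_div_assoc', h1]

/-- The area of a triangle of the mesh. -/
def area (n m : ℕ) (s : Fin n ⊕ Fin (n + 1)) : ℝ :=
  (baseRight s - baseLeft s) * (1 / (2 * m)) / 2

theorem area_pos (hn : 1 ≤ n) (hm : 1 ≤ m) (s : Fin n ⊕ Fin (n + 1)) : 0 < area n m s := by
  have := sub_pos.2 (baseLeft_lt_baseRight hn s)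
  unfold area
  positivity

end MeshGeometry

/-! ### Broken norms and the consistency functional as finite sums -/

section MeshIntegrals

variable {n m : ℕ}

theorem setIntegral_mesh_const (hn : 1 ≤ n) (hm : 1 ≤ m) (j : Fin (2 * m))
    (s : Fin n ⊕ Fin (n + 1)) (c : ℝ) :
    ∫ _ in triangle (babuskaAziz n m) (j, s), c = area n m s * c := by
  rw [triangle_babuskaAziz, setIntegral_triangle_const (baseLeft_lt_baseRight hn s)
    (baseY_ne_apexY hm j s), abs_apexY_sub_baseY, area]

theorem integrableOn_mesh {f : Plane → ℝ} (hf : Continuous f)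
    (i : Fin (2 * m) × (Fin n ⊕ Fin (n + 1))) :
    IntegrableOn f (triangle (babuskaAziz n m) i) :=
  hf.continuousOn.integrableOn_compact (isCompact_convexHull_range _)

theorem dx_pieces {ι : Type} (w : ι → (Plane →ᵃ[ℝ] ℝ)) (i : ι) (z : Plane) :
    dx (pieces w i) z = slopeX (w i) := dx_affine (w i) z

theorem dy_pieces {ι : Type} (w : ι → (Plane →ᵃ[ℝ] ℝ)) (i : ι) (z : Plane) :
    dy (pieces w i) z = slopeY (w i) := dy_affine (w i) z

/-- The broken scalar product of elements of the nonconforming P1 space. -/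
def energy (n m : ℕ) (v w : Fin (2 * m) × (Fin n ⊕ Fin (n + 1)) → (Plane →ᵃ[ℝ] ℝ)) : ℝ :=
  ∑ i, area n m i.2 * (slopeX (v i) * slopeX (w i) + slopeY (v i) * slopeY (w i))

theorem brokenInner_pieces (hn : 1 ≤ n) (hm : 1 ≤ m)
    (v w : Fin (2 * m) × (Fin n ⊕ Fin (n + 1)) → (Plane →ᵃ[ℝ] ℝ)) :
    brokenInner (babuskaAziz n m) (pieces v) (pieces w) = energy n m v w := by
  unfold brokenInner energy
  refine Finset.sum_congr rfl fun i _ => ?_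
  simp only [dx_pieces, dy_pieces]
  exact setIntegral_mesh_const hn hm i.1 i.2 _

theorem brokenNorm_pieces (hn : 1 ≤ n) (hm : 1 ≤ m)
    (w : Fin (2 * m) × (Fin n ⊕ Fin (n + 1)) → (Plane →ᵃ[ℝ] ℝ)) :
    brokenNorm (babuskaAziz n m) (pieces w) = Real.sqrt (energy n m w w) := by
  unfold brokenNorm energy
  congr 1
  refine Finset.sum_congr rfl fun i _ => ?_
  simp only [dx_pieces, dy_pieces, ← pow_two]
  exact setIntegral_mesh_const hn hm i.1 i.2 _

theorem energy_self_nonneg (hn : 1 ≤ n) (hm : 1 ≤ m)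
    (w : Fin (2 * m) × (Fin n ⊕ Fin (n + 1)) → (Plane →ᵃ[ℝ] ℝ)) : 0 ≤ energy n m w w := by
  refine Finset.sum_nonneg fun i _ => mul_nonneg (area_pos hn hm _).le ?_
  nlinarith [sq_nonneg (slopeX (w i)), sq_nonneg (slopeY (w i))]

theorem brokenError_eq (v : Fin (2 * m) × (Fin n ⊕ Fin (n + 1)) → (Plane →ᵃ[ℝ] ℝ)) :
    brokenError (babuskaAziz n m) modelU v =
      Real.sqrt (∑ i, ∫ p in triangle (babuskaAziz n m) i,
        ((modelUx p - slopeX (v i)) ^ 2 + (modelUy p - slopeY (v i)) ^ 2)) := by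
  unfold brokenError brokenNorm
  simp only [dx_modelU_sub, dy_modelU_sub]

/-- The consistency functional `(u, w) - (f, w)`. -/
def consistency (n m : ℕ) (w : Fin (2 * m) × (Fin n ⊕ Fin (n + 1)) → (Plane →ᵃ[ℝ] ℝ)) : ℝ :=
  brokenInner (babuskaAziz n m) (fun _ => modelU) (pieces w) -
    load (babuskaAziz n m) modelF (pieces w)

theorem continuous_grad_modelU (β γ : ℝ) :
    Continuous fun z => modelUx z * β + modelUy z * γ :=
  (continuous_modelUx.mul continuous_const).add (continuous_modelUy.mul continuous_const)

theorem brokenInner_modelU (w : Fin (2 * m) × (Fin n ⊕ Fin (n + 1)) → (Plane →ᵃ[ℝ] ℝ)) :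
    brokenInner (babuskaAziz n m) (fun _ => modelU) (pieces w) =
      ∑ i, ∫ p in triangle (babuskaAziz n m) i,
        (modelUx p * slopeX (w i) + modelUy p * slopeY (w i)) := by
  unfold brokenInner
  simp only [dx_pieces, dy_pieces, dx_modelU, dy_modelU]

theorem consistency_eq (hn : 1 ≤ n) (hm : 1 ≤ m)
    (w : Fin (2 * m) × (Fin n ⊕ Fin (n + 1)) → (Plane →ᵃ[ℝ] ℝ)) :
    consistency n m w = ∑ i : Fin (2 * m) × (Fin n ⊕ Fin (n + 1)), orient n i.1 i.2 *
        (flux (baseLeft i.2, baseY m i.1 i.2) (baseRight i.2, baseY m i.1 i.2) *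
            w i (edgeMidpoint (babuskaAziz n m) i 2) +
          flux (baseRight i.2, baseY m i.1 i.2) (apexX i.2, apexY m i.1 i.2) *
            w i (edgeMidpoint (babuskaAziz n m) i 0) +
          flux (apexX i.2, apexY m i.1 i.2) (baseLeft i.2, baseY m i.1 i.2) *
            w i (edgeMidpoint (babuskaAziz n m) i 1) +
          (edgeDefect (slopeX (w i)) (slopeY (w i))
              (baseLeft i.2, baseY m i.1 i.2) (baseRight i.2, baseY m i.1 i.2) +
            edgeDefect (slopeX (w i)) (slopeY (w i))
              (baseRight i.2, baseY m i.1 i.2) (apexX i.2, apexY m i.1 i.2) +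
            edgeDefect (slopeX (w i)) (slopeY (w i))
              (apexX i.2, apexY m i.1 i.2) (baseLeft i.2, baseY m i.1 i.2))) := by
  unfold consistency
  rw [brokenInner_modelU]
  unfold load
  rw [← Finset.sum_sub_distrib]
  refine Finset.sum_congr rfl fun i _ => ?_
  obtain ⟨j, s⟩ := i
  simp only [pieces]
  rw [← integral_sub (integrableOn_mesh (continuous_grad_modelU _ _) _)
    (integrableOn_mesh (f := fun z => modelF z * w (j, s) z)
      (continuous_modelF.mul (continuous_affine _)) _),
    triangle_babuskaAziz, setIntegral_grad_sub_load (baseLeft_lt_baseRight hn s)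
    (baseY_ne_apexY hm j s), abs_div_apexY_sub_baseY hm, edgeMidpoint_zero, edgeMidpoint_one,
    edgeMidpoint_two]

end MeshIntegrals

/-! ### Cancellation of the midpoint contributions -/

section FluxCancellation

variable {n m : ℕ}

theorem sum_mesh (F : Fin (2 * m) × (Fin n ⊕ Fin (n + 1)) → ℝ) :
    ∑ i, F i = ∑ j, (∑ a, F (j, Sum.inl a) + ∑ a, F (j, Sum.inr a)) := by
  rw [Fintype.sum_prod_type]
  simp only [Fintype.sum_sum_type]

theorem baseRight_inr_castSucc (a : Fin n) :
    baseRight (Sum.inr a.castSucc : Fin n ⊕ Fin (n + 1)) = apexX (Sum.inl a) := by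
  have := a.2
  unfold baseRight apexX
  congr 2
  simp [vertexX]

theorem apexX_inr_castSucc (a : Fin n) :
    apexX (Sum.inr a.castSucc : Fin n ⊕ Fin (n + 1)) = baseLeft (Sum.inl a) := rfl

theorem apexX_inr_succ (a : Fin n) :
    apexX (Sum.inr a.succ : Fin n ⊕ Fin (n + 1)) = baseRight (Sum.inl a) := rfl

theorem baseLeft_inr_succ (a : Fin n) :
    baseLeft (Sum.inr a.succ : Fin n ⊕ Fin (n + 1)) = apexX (Sum.inl a) := rfl

theorem baseY_inr (j : ℕ) (a : Fin (n + 1)) (a' : Fin n) :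
    baseY m j (Sum.inr a : Fin n ⊕ Fin (n + 1)) = apexY m j (Sum.inl a') := rfl

theorem apexY_inr (j : ℕ) (a : Fin (n + 1)) (a' : Fin n) :
    apexY m j (Sum.inr a : Fin n ⊕ Fin (n + 1)) = baseY m j (Sum.inl a') := rfl

/-- The strips 2k - 1 and 2k meet on an even line and carry opposite signs; only the bottom and the
top side are left. -/
theorem sum_range_neg_one_pow_mul_half_succ (φ : ℕ → ℝ) (m : ℕ) :
    ∑ j ∈ Finset.range (2 * m), (-1) ^ j * φ ((j + 1) / 2) = φ 0 - φ m := by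
  induction m with
  | zero => simp
  | succ m ih =>
    rw [mul_add, mul_one, Finset.sum_range_succ, Finset.sum_range_succ, ih,
      show (2 * m + 1) / 2 = m by omega, show (2 * m + 1 + 1) / 2 = m + 1 by omega, pow_succ,
      pow_mul]
    norm_num
    ring

theorem sum_range_neg_one_pow_mul_half (φ : ℕ → ℝ) (m : ℕ) :
    ∑ j ∈ Finset.range (2 * m), (-1) ^ j * φ (j / 2) = 0 := by
  induction m with
  | zero => simp
  | succ m ih =>
    rw [mul_add, mul_one, Finset.sum_range_succ, Finset.sum_range_succ, ih,
      show (2 * m) / 2 = m by omega, show (2 * m + 1) / 2 = m by omega, pow_succ,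
      pow_mul]
    norm_num

variable {w : Fin (2 * m) × (Fin n ⊕ Fin (n + 1)) → (Plane →ᵃ[ℝ] ℝ)} {S H O : ℕ → ℕ → ℝ}

/-- Neighbours in a strip have opposite orientation, while the common edge enters both fluxes with
the same ordered end points and the same nodal value. The two edges left over lie on the vertical
sides, where the nodal values vanish. -/
theorem sum_flux_slanted_eq_zero (h : HasNodalValues n m w S H O) (j : Fin (2 * m)) :
    ∑ s : Fin n ⊕ Fin (n + 1), orient n j s *
      (flux (baseRight s, baseY m j s) (apexX s, apexY m j s) *
          w (j, s) (edgeMidpoint (babuskaAziz n m) (j, s) 0) +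
        flux (apexX s, apexY m j s) (baseLeft s, baseY m j s) *
          w (j, s) (edgeMidpoint (babuskaAziz n m) (j, s) 1)) = 0 := by
  rw [Fintype.sum_sum_type]
  simp only [(h.inl _ _).1, (h.inl _ _).2.1, (h.inr _ _).1, (h.inr _ _).2.1, orient]
  simp only [mul_add, Finset.sum_add_distrib]
  rw [Fin.sum_univ_castSucc (n := n) (f := fun a : Fin (n + 1) => -(-1 : ℝ) ^ (j : ℕ) *
    (flux (baseRight (Sum.inr a), baseY m j (Sum.inr a))
      (apexX (Sum.inr a), apexY m j (Sum.inr a)) * S j (2 * a + 1))),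
    Fin.sum_univ_succ (n := n) (f := fun a : Fin (n + 1) => -(-1 : ℝ) ^ (j : ℕ) *
    (flux (apexX (Sum.inr a), apexY m j (Sum.inr a))
      (baseLeft (Sum.inr a), baseY m j (Sum.inr a)) * S j (2 * a)))]
  simp only [Fin.val_last, h.right, Fin.val_zero, mul_zero, h.left, add_zero, zero_add,
    baseRight_inr_castSucc, apexX_inr_castSucc, apexX_inr_succ, baseLeft_inr_succ,
    Fin.val_castSucc, Fin.val_succ]
  have e1 : ∀ a : Fin n, -(-1 : ℝ) ^ (j : ℕ) *
      (flux (apexX (Sum.inl a), baseY m j (Sum.inr a.castSucc : Fin n ⊕ Fin (n + 1)))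
        (baseLeft (Sum.inl a), apexY m j (Sum.inr a.castSucc : Fin n ⊕ Fin (n + 1))) *
          S j (2 * a + 1)) =
      -((-1 : ℝ) ^ (j : ℕ) * (flux (apexX (Sum.inl a), apexY m j (Sum.inl a))
        (baseLeft (Sum.inl a), baseY m j (Sum.inl a)) * S j (2 * a + 1))) := by
    intro a
    rw [baseY_inr j _ a, apexY_inr j _ a]
    ring
  have e2 : ∀ a : Fin n, -(-1 : ℝ) ^ (j : ℕ) *
      (flux (baseRight (Sum.inl a), apexY m j (Sum.inr a.succ : Fin n ⊕ Fin (n + 1)))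
        (apexX (Sum.inl a), baseY m j (Sum.inr a.succ : Fin n ⊕ Fin (n + 1))) *
          S j (2 * (a + 1))) =
      -((-1 : ℝ) ^ (j : ℕ) * (flux (baseRight (Sum.inl a), baseY m j (Sum.inl a))
        (apexX (Sum.inl a), apexY m j (Sum.inl a)) * S j (2 * a + 2))) := by
    intro a
    rw [baseY_inr j _ a, apexY_inr j _ a, mul_add_one]
    ring
  simp only [e1, e2, Finset.sum_neg_distrib]
  ring

/-- Two triangles with a common horizontal edge lie in consecutive strips, so (-1)^j gives them
opposite signs. -/
theorem sum_flux_horizontal_eq_zero (h : HasNodalValues n m w S H O) :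
    ∑ j : Fin (2 * m), ∑ s : Fin n ⊕ Fin (n + 1), orient n j s *
      (flux (baseLeft s, baseY m j s) (baseRight s, baseY m j s) *
          w (j, s) (edgeMidpoint (babuskaAziz n m) (j, s) 2)) = 0 := by
  simp only [Fintype.sum_sum_type, (h.inl _ _).2.2, (h.inr _ _).2.2, orient]
  rw [Finset.sum_add_distrib]
  have e1 : ∑ j : Fin (2 * m), ∑ a : Fin n, (-1 : ℝ) ^ (j : ℕ) *
      (flux (baseLeft (Sum.inl a), baseY m j (Sum.inl a))
        (baseRight (Sum.inl a), baseY m j (Sum.inl a)) * H (((j : ℕ) + 1) / 2) a) = 0 := by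
    have := sum_range_neg_one_pow_mul_half_succ (fun k => ∑ a : Fin n,
      flux (baseLeft (Sum.inl a), ((2 * k : ℕ) : ℝ) / (2 * m))
        (baseRight (Sum.inl a), ((2 * k : ℕ) : ℝ) / (2 * m)) * H k a) m
    simp only [h.bot, h.top, mul_zero, Finset.sum_const_zero, sub_zero] at this
    rw [Finset.sum_range] at this
    rw [← this]
    refine Finset.sum_congr rfl fun j _ => ?_
    rw [Finset.mul_sum]
    rfl
  have e2 : ∑ j : Fin (2 * m), ∑ a : Fin (n + 1), -(-1 : ℝ) ^ (j : ℕ) *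
      (flux (baseLeft (Sum.inr a), baseY m j (Sum.inr a))
        (baseRight (Sum.inr a), baseY m j (Sum.inr a)) * O ((j : ℕ) / 2) a) = 0 := by
    have := sum_range_neg_one_pow_mul_half (fun k => -∑ a : Fin (n + 1),
      flux (baseLeft (Sum.inr a), ((2 * k + 1 : ℕ) : ℝ) / (2 * m))
        (baseRight (Sum.inr a), ((2 * k + 1 : ℕ) : ℝ) / (2 * m)) * O k a) m
    rw [Finset.sum_range] at this
    rw [← this]
    refine Finset.sum_congr rfl fun j _ => ?_
    rw [← neg_mul_comm, Finset.mul_sum]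
    rfl
  rw [e1, e2, add_zero]

/-- The sum of the three edge defects of a triangle. -/
def triangleDefect (m : ℕ) (j : ℕ) (s : Fin n ⊕ Fin (n + 1)) (β γ : ℝ) : ℝ :=
  edgeDefect β γ (baseLeft s, baseY m j s) (baseRight s, baseY m j s) +
    edgeDefect β γ (baseRight s, baseY m j s) (apexX s, apexY m j s) +
    edgeDefect β γ (apexX s, apexY m j s) (baseLeft s, baseY m j s)

/-- On the nonconforming P1 space, only the edge defects contribute to the consistency
functional. -/
theorem consistency_eq_sum_defect (hn : 1 ≤ n) (hm : 1 ≤ m) (h : HasNodalValues n m w S H O) :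
    consistency n m w = ∑ i : Fin (2 * m) × (Fin n ⊕ Fin (n + 1)),
      orient n i.1 i.2 * triangleDefect m i.1 i.2 (slopeX (w i)) (slopeY (w i)) := by
  rw [consistency_eq hn hm, ← sub_eq_zero, ← Finset.sum_sub_distrib, Fintype.sum_prod_type]
  have h1 := sum_flux_horizontal_eq_zero h
  have h2 : ∑ j : Fin (2 * m), ∑ s : Fin n ⊕ Fin (n + 1), orient n j s *
      (flux (baseRight s, baseY m j s) (apexX s, apexY m j s) *
          w (j, s) (edgeMidpoint (babuskaAziz n m) (j, s) 0) +
        flux (apexX s, apexY m j s) (baseLeft s, baseY m j s) *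
          w (j, s) (edgeMidpoint (babuskaAziz n m) (j, s) 1)) = 0 :=
    Finset.sum_eq_zero fun j _ => sum_flux_slanted_eq_zero h j
  refine Eq.trans ?_ ((congrArg₂ (· + ·) h1 h2).trans (add_zero 0))
  rw [← Finset.sum_add_distrib]
  refine Finset.sum_congr rfl fun j _ => ?_
  rw [← Finset.sum_add_distrib]
  refine Finset.sum_congr rfl fun s _ => ?_
  simp only [triangleDefect]
  ring

end FluxCancellation

/-! ### Upper bounds for the consistency functional -/

section ConsistencyUpperBound

variable {n m : ℕ}

theorem le_baseRight_sub_baseLeft (hn : 1 ≤ n) (s : Fin n ⊕ Fin (n + 1)) :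
    1 / (2 * n) ≤ baseRight s - baseLeft s := by
  have hn' : (0 : ℝ) < 2 * n := by positivity
  have h : vertexX n s 0 + 1 ≤ vertexX n s 1 := by
    rcases s with a | a
    · simp [vertexX]
    · have := a.2
      simp [vertexX]
      omega
  have h' : (vertexX n s 0 : ℝ) + 1 ≤ vertexX n s 1 := by exact_mod_cast h
  unfold baseLeft baseRight
  rw [← sub_div, div_le_div_iff_of_pos_right hn']
  linarith

theorem area_le (hn : 1 ≤ n) (s : Fin n ⊕ Fin (n + 1)) : area n m s ≤ 1 / (4 * n * m) := by
  have h := baseRight_sub_baseLeft_le hn s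
  calc area n m s ≤ (1 / n) * (1 / (2 * m)) / 2 := by
        unfold area
        gcongr
    _ = 1 / (4 * n * m) := by
        field_simp
        ring

/-- A crude count in which the two right-angled triangles are treated as full ones; hence the total
area bound 3/2 instead of 1. -/
theorem sum_area_strip_le (hn : 1 ≤ n) :
    ∑ s : Fin n ⊕ Fin (n + 1), area n m s ≤ 3 / (4 * m) := by
  have hn' : (1 : ℝ) ≤ n := by exact_mod_cast hn
  calc ∑ s : Fin n ⊕ Fin (n + 1), area n m s ≤ ∑ _s : Fin n ⊕ Fin (n + 1), 1 / (4 * n * m : ℝ) :=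
        Finset.sum_le_sum fun s _ => area_le hn s
    _ = (2 * n + 1) / n * (1 / (4 * m)) := by
        rw [Finset.sum_const, Finset.card_univ, Fintype.card_sum, Fintype.card_fin,
          Fintype.card_fin, nsmul_eq_mul]
        push_cast
        field_simp
        ring
    _ ≤ 3 * (1 / (4 * m)) := by
        gcongr
        rw [div_le_iff₀ (by positivity)]
        linarith
    _ = 3 / (4 * m) := by ring

theorem sum_area_le (hn : 1 ≤ n) (hm : 1 ≤ m) :
    ∑ i : Fin (2 * m) × (Fin n ⊕ Fin (n + 1)), area n m i.2 ≤ 3 / 2 := by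
  have hm' : (0 : ℝ) < m := by positivity
  rw [Fintype.sum_prod_type]
  calc ∑ _j : Fin (2 * m), ∑ s : Fin n ⊕ Fin (n + 1), area n m s
      ≤ ∑ _j : Fin (2 * m), 3 / (4 * m : ℝ) :=
        Finset.sum_le_sum fun _ _ => sum_area_strip_le hn
    _ = 3 / 2 := by
        rw [Finset.sum_const, Finset.card_univ, Fintype.card_fin, nsmul_eq_mul]
        push_cast
        field_simp
        ring

/-- The `L₁` norm of the broken gradient. -/
def gradSum (n m : ℕ) (w : Fin (2 * m) × (Fin n ⊕ Fin (n + 1)) → (Plane →ᵃ[ℝ] ℝ)) : ℝ :=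
  ∑ i, area n m i.2 * (|slopeX (w i)| + |slopeY (w i)|)

/-- Cauchy-Schwarz with the areas as weights, and (a + b)² ≤ 2(a² + b²). -/
theorem gradSum_le (hn : 1 ≤ n) (hm : 1 ≤ m)
    (w : Fin (2 * m) × (Fin n ⊕ Fin (n + 1)) → (Plane →ᵃ[ℝ] ℝ)) :
    gradSum n m w ≤ 2 * Real.sqrt (energy n m w w) := by
  have hA : ∀ i : Fin (2 * m) × (Fin n ⊕ Fin (n + 1)), 0 ≤ area n m i.2 :=
    fun i => (area_pos hn hm i.2).le
  have h1 : gradSum n m w ^ 2 ≤ (∑ i : Fin (2 * m) × (Fin n ⊕ Fin (n + 1)), area n m i.2) *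
      ∑ i, area n m i.2 * (|slopeX (w i)| + |slopeY (w i)|) ^ 2 := by
    refine Finset.sum_sq_le_sum_mul_sum_of_sq_le_mul _ (fun i _ => hA i)
      (fun i _ => mul_nonneg (hA i) (sq_nonneg _)) fun i _ => le_of_eq (by ring)
  have h2 : ∑ i, area n m i.2 * (|slopeX (w i)| + |slopeY (w i)|) ^ 2 ≤
      2 * energy n m w w := by
    unfold energy
    rw [Finset.mul_sum]
    refine Finset.sum_le_sum fun i _ => ?_
    rw [mul_left_comm]
    refine mul_le_mul_of_nonneg_left ?_ (hA i)
    nlinarith [sq_nonneg (|slopeX (w i)| - |slopeY (w i)|), sq_abs (slopeX (w i)),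
      sq_abs (slopeY (w i))]
  have h3 : gradSum n m w ^ 2 ≤ (2 * Real.sqrt (energy n m w w)) ^ 2 := by
    rw [mul_pow, Real.sq_sqrt (energy_self_nonneg hn hm w)]
    have := mul_le_mul (sum_area_le hn hm) h2
      (Finset.sum_nonneg fun i _ => mul_nonneg (hA i) (sq_nonneg _)) (by norm_num)
    have := energy_self_nonneg hn hm w
    linarith
  exact abs_le_of_sq_le_sq' h3 (by positivity) |>.2

variable {w : Fin (2 * m) × (Fin n ⊕ Fin (n + 1)) → (Plane →ᵃ[ℝ] ℝ)} {S H O : ℕ → ℕ → ℝ}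

theorem mem_Icc_midpoint {x y : ℝ} (hx : x ∈ Set.Icc (0 : ℝ) 1) (hy : y ∈ Set.Icc (0 : ℝ) 1) :
    (x + y) / 2 ∈ Set.Icc (0 : ℝ) 1 :=
  ⟨by linarith [hx.1, hy.1], by linarith [hx.2, hy.2]⟩

/-- Three edges with increments at most 1/n; the assumption n ≤ m ensures this for the vertical
increment 1/(2m). -/
theorem abs_triangleDefect_le (hn : 1 ≤ n) (hnm : n ≤ m) (j : Fin (2 * m))
    (s : Fin n ⊕ Fin (n + 1)) (β γ : ℝ) :
    |triangleDefect m j s β γ| ≤ 6 * (1 / n) ^ 3 * (|β| + |γ|) := by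
  have hn' : (1 : ℝ) ≤ n := by exact_mod_cast hn
  have hnm' : (n : ℝ) ≤ m := by exact_mod_cast hnm
  have hl : (1 : ℝ) / n ≤ 1 := by
    rw [div_le_one (by positivity)]
    exact hn'
  have hl0 : (0 : ℝ) ≤ 1 / n := by positivity
  have hY : |apexY m j s - baseY m j s| ≤ 1 / n := by
    rw [abs_apexY_sub_baseY]
    exact one_div_le_one_div_of_le (by positivity) (by linarith)
  have hw := baseRight_sub_baseLeft_le hn s
  have h1 := baseLeft_le_apexX s
  have h2 := apexX_le_baseRight s
  have mp := baseLeft_mem hn s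
  have mq := baseRight_mem hn s
  have mr := apexX_mem hn s
  have mb := baseY_mem j.2 s
  have me := apexY_mem j.2 s
  have a1 := abs_edgeDefect_le (P := (baseLeft s, baseY m j s)) (Q := (baseRight s, baseY m j s))
    (l := 1 / n) β γ (mem_Icc_midpoint mp mq) (mem_Icc_midpoint mb mb)
    (abs_le.2 ⟨by simp only; linarith, by simp only; linarith⟩)
    (by simp only [sub_self, abs_zero]; exact hl0) hl
  have a2 := abs_edgeDefect_le (P := (baseRight s, baseY m j s)) (Q := (apexX s, apexY m j s))
    (l := 1 / n) β γ (mem_Icc_midpoint mq mr) (mem_Icc_midpoint mb me)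
    (abs_le.2 ⟨by simp only; linarith, by simp only; linarith⟩) hY hl
  have a3 := abs_edgeDefect_le (P := (apexX s, apexY m j s)) (Q := (baseLeft s, baseY m j s))
    (l := 1 / n) β γ (mem_Icc_midpoint mr mp) (mem_Icc_midpoint me mb)
    (abs_le.2 ⟨by simp only; linarith, by simp only; linarith⟩)
    (by simp only; rw [abs_sub_comm]; exact hY) hl
  unfold triangleDefect
  refine (abs_add_three _ _ _).trans ?_
  linarith

/-- The defect bound 6/n³ is compared with the smallest possible area 1/(8nm), which yields 48 m/n².
-/
theorem abs_consistency_le_ratio (hn : 1 ≤ n) (hnm : n ≤ m) (h : HasNodalValues n m w S H O) :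
    |consistency n m w| ≤ 48 * (m / n ^ 2) * gradSum n m w := by
  have hm : 1 ≤ m := hn.trans hnm
  rw [consistency_eq_sum_defect hn hm h, gradSum, Finset.mul_sum]
  refine (Finset.abs_sum_le_sum_abs _ _).trans (Finset.sum_le_sum fun i _ => ?_)
  rw [abs_mul, abs_orient, one_mul]
  refine (abs_triangleDefect_le hn hnm i.1 i.2 _ _).trans ?_
  rw [← mul_assoc]
  refine mul_le_mul_of_nonneg_right ?_ (by positivity)
  have hw := le_baseRight_sub_baseLeft hn i.2
  calc (6 : ℝ) * (1 / n) ^ 3 = 48 * (m / n ^ 2) * (1 / (2 * n) * (1 / (2 * m)) / 2) := by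
        field_simp
        ring
    _ ≤ 48 * (m / n ^ 2) * area n m i.2 := by
        unfold area
        gcongr

theorem sum_range_two_mul_add_one (f : ℕ → ℝ) (n : ℕ) :
    ∑ c ∈ Finset.range (2 * n + 1), f c =
      ∑ a ∈ Finset.range n, f (2 * a + 1) + ∑ a ∈ Finset.range (n + 1), f (2 * a) := by
  induction n with
  | zero => simp
  | succ n ih =>
    rw [show 2 * (n + 1) + 1 = 2 * n + 1 + 1 + 1 by ring, Finset.sum_range_succ,
      Finset.sum_range_succ, ih,
      Finset.sum_range_succ (fun a => f (2 * a)) (n + 1),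
      Finset.sum_range_succ (fun a => f (2 * a + 1)) n, show 2 * n + 1 + 1 = 2 * (n + 1) by ring]
    linarith

/-- Neighbouring nodes on a midline are joined inside one triangle by a segment of half the length
of its base. -/
theorem nodal_sub_inl (hn : 1 ≤ n) (h : HasNodalValues n m w S H O) (j : Fin (2 * m))
    (a : Fin n) : S j (2 * a + 2) - S j (2 * a + 1) =
      slopeX (w (j, Sum.inl a)) * (baseRight (Sum.inl a) - baseLeft (Sum.inl a)) / 2 := by
  have hpq := baseLeft_lt_baseRight hn (Sum.inl a : Fin n ⊕ Fin (n + 1))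
  have h0 : baseRight (Sum.inl a : Fin n ⊕ Fin (n + 1)) - baseLeft (Sum.inl a) ≠ 0 :=
    (sub_pos.2 hpq).ne'
  rw [← (h.inl j a).1, ← (h.inl j a).2.1, edgeMidpoint_zero, edgeMidpoint_one,
    slopeX_eq_of_midpoint_values (r := apexX (Sum.inl a)) (b := baseY m j (Sum.inl a))
      (e := apexY m j (Sum.inl a)) hpq, div_mul_cancel₀ _ h0]
  ring

theorem nodal_sub_inr (hn : 1 ≤ n) (h : HasNodalValues n m w S H O) (j : Fin (2 * m))
    (a : Fin (n + 1)) : S j (2 * a + 1) - S j (2 * a) =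
      slopeX (w (j, Sum.inr a)) * (baseRight (Sum.inr a : Fin n ⊕ Fin (n + 1)) -
        baseLeft (Sum.inr a : Fin n ⊕ Fin (n + 1))) / 2 := by
  have hpq := baseLeft_lt_baseRight hn (Sum.inr a : Fin n ⊕ Fin (n + 1))
  have h0 : baseRight (Sum.inr a : Fin n ⊕ Fin (n + 1)) - baseLeft (Sum.inr a) ≠ 0 :=
    (sub_pos.2 hpq).ne'
  rw [← (h.inr j a).1, ← (h.inr j a).2.1, edgeMidpoint_zero, edgeMidpoint_one,
    slopeX_eq_of_midpoint_values (r := apexX (Sum.inr a)) (b := baseY m j (Sum.inr a))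
      (e := apexY m j (Sum.inr a)) hpq, div_mul_cancel₀ _ h0]
  ring

/-- The variation along the midline of a strip. -/
def stripVariation (w : Fin (2 * m) × (Fin n ⊕ Fin (n + 1)) → (Plane →ᵃ[ℝ] ℝ))
    (j : Fin (2 * m)) : ℝ :=
  ∑ s : Fin n ⊕ Fin (n + 1), |slopeX (w (j, s))| * (baseRight s - baseLeft s) / 2

/-- A discrete Poincaré inequality along the midline of a strip, on which the elements of the
nonconforming P1 space are continuous. -/
theorem abs_nodal_le (hn : 1 ≤ n) (h : HasNodalValues n m w S H O) (j : Fin (2 * m)) {i : ℕ}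
    (hi : i ≤ 2 * n + 1) : |S j i| ≤ stripVariation w j := by
  have h1 : S j i = ∑ c ∈ Finset.range i, (S j (c + 1) - S j c) := by
    rw [Finset.sum_range_sub, h.left, sub_zero]
  rw [h1]
  refine (Finset.abs_sum_le_sum_abs _ _).trans ?_
  refine (Finset.sum_le_sum_of_subset_of_nonneg (Finset.range_mono hi)
    fun _ _ _ => abs_nonneg _).trans ?_
  rw [sum_range_two_mul_add_one, stripVariation, Fintype.sum_sum_type, Finset.sum_range,
    Finset.sum_range]
  refine le_of_eq (congrArg₂ _ (Finset.sum_congr rfl fun a _ => ?_)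
    (Finset.sum_congr rfl fun a _ => ?_))
  · rw [nodal_sub_inl hn h, abs_div, abs_mul, abs_two,
      abs_of_pos (sub_pos.2 (baseLeft_lt_baseRight hn _))]
  · rw [nodal_sub_inr hn h, abs_div, abs_mul, abs_two,
      abs_of_pos (sub_pos.2 (baseLeft_lt_baseRight hn _))]

theorem abs_slanted_values_le (hn : 1 ≤ n) (h : HasNodalValues n m w S H O) (j : Fin (2 * m))
    (s : Fin n ⊕ Fin (n + 1)) :
    |w (j, s) (edgeMidpoint (babuskaAziz n m) (j, s) 0)| ≤ stripVariation w j ∧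
    |w (j, s) (edgeMidpoint (babuskaAziz n m) (j, s) 1)| ≤ stripVariation w j := by
  rcases s with a | a
  · rw [(h.inl j a).1, (h.inl j a).2.1]
    have := a.2
    exact ⟨abs_nodal_le hn h j (by omega), abs_nodal_le hn h j (by omega)⟩
  · rw [(h.inr j a).1, (h.inr j a).2.1]
    have := a.2
    exact ⟨abs_nodal_le hn h j (by omega), abs_nodal_le hn h j (by omega)⟩

theorem stripVariation_term_nonneg (hn : 1 ≤ n)
    (w : Fin (2 * m) × (Fin n ⊕ Fin (n + 1)) → (Plane →ᵃ[ℝ] ℝ)) (j : Fin (2 * m))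
    (s : Fin n ⊕ Fin (n + 1)) :
    0 ≤ |slopeX (w (j, s))| * (baseRight s - baseLeft s) / 2 := by
  have := sub_pos.2 (baseLeft_lt_baseRight hn s)
  positivity

/-- The base midpoint is reached from the midline by one horizontal and one vertical move inside the
triangle. -/
theorem abs_base_value_le (hn : 1 ≤ n) (hm : 1 ≤ m) (h : HasNodalValues n m w S H O)
    (j : Fin (2 * m)) (s : Fin n ⊕ Fin (n + 1)) :
    |w (j, s) (edgeMidpoint (babuskaAziz n m) (j, s) 2)| ≤
      2 * stripVariation w j + |slopeY (w (j, s))| := by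
  have h1 := (abs_slanted_values_le hn h j s).2
  rw [edgeMidpoint_one] at h1
  rw [edgeMidpoint_two, base_midpoint_value (r := apexX s) (e := apexY m j s)]
  have h2 : |slopeX (w (j, s)) * (baseRight s - apexX s) / 2| ≤ stripVariation w j := by
    have h3 : |slopeX (w (j, s))| * (baseRight s - baseLeft s) / 2 ≤ stripVariation w j :=
      Finset.single_le_sum (f := fun s => |slopeX (w (j, s))| * (baseRight s - baseLeft s) / 2)
        (fun s _ => stripVariation_term_nonneg hn w j s) (Finset.mem_univ s)
    refine le_trans ?_ h3
    rw [abs_div, abs_mul, abs_two, abs_of_nonneg (sub_nonneg.2 (apexX_le_baseRight s))]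
    gcongr
    exact baseLeft_le_apexX s
  have h4 : |slopeY (w (j, s)) * (apexY m j s - baseY m j s) / 2| ≤ |slopeY (w (j, s))| := by
    rw [abs_div, abs_mul, abs_two, abs_apexY_sub_baseY]
    have hm' : (1 : ℝ) ≤ m := by exact_mod_cast hm
    have : 1 / (2 * (m : ℝ)) ≤ 1 := by
      rw [div_le_one (by positivity)]
      linarith
    have := mul_le_of_le_one_right (abs_nonneg (slopeY (w (j, s)))) this
    linarith [abs_nonneg (slopeY (w (j, s)))]
  refine (abs_sub _ _).trans ?_
  linarith [abs_add_le (w (j, s) ((baseLeft s + apexX s) / 2, (baseY m j s + apexY m j s) / 2))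
    (slopeX (w (j, s)) * (baseRight s - apexX s) / 2)]

/-- The midline bound controls all values of w in a strip up to the y-slope. Multiplying the
variation of a strip by its area gives back an area-weighted sum of |slopeX|, since both are
proportional to the widths of the triangles. -/
theorem abs_load_le (hn : 1 ≤ n) (hm : 1 ≤ m) (h : HasNodalValues n m w S H O) :
    |load (babuskaAziz n m) modelF (pieces w)| ≤ 6 * gradSum n m w := by
  have hm' : (0 : ℝ) < m := by positivity
  have h1 : |load (babuskaAziz n m) modelF (pieces w)| ≤
      ∑ i : Fin (2 * m) × (Fin n ⊕ Fin (n + 1)), area n m i.2 *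
        (4 * stripVariation w i.1 + |slopeY (w i)|) := by
    unfold load
    refine (Finset.abs_sum_le_sum_abs _ _).trans (Finset.sum_le_sum fun i _ => ?_)
    obtain ⟨j, s⟩ := i
    simp only [pieces]
    rw [triangle_babuskaAziz]
    refine (abs_setIntegral_load_le (baseLeft_lt_baseRight hn s) (baseY_ne_apexY hm j s)
      (baseLeft_mem hn s) (baseRight_mem hn s) (apexX_mem hn s) (baseY_mem j.2 s)
      (apexY_mem j.2 s) (w (j, s))).trans ?_
    rw [abs_apexY_sub_baseY, ← edgeMidpoint_zero, ← edgeMidpoint_one, ← edgeMidpoint_two]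
    refine mul_le_mul_of_nonneg_left ?_ (area_pos hn hm s).le
    have h2 := abs_slanted_values_le hn h j s
    have h3 := abs_base_value_le hn hm h j s
    linarith [h2.1, h2.2]
  refine h1.trans ?_
  have h2 : ∑ i : Fin (2 * m) × (Fin n ⊕ Fin (n + 1)), area n m i.2 *
      (4 * stripVariation w i.1) ≤ ∑ i, area n m i.2 * (6 * |slopeX (w i)|) := by
    rw [Fintype.sum_prod_type, Fintype.sum_prod_type]
    refine Finset.sum_le_sum fun j _ => ?_
    simp only
    rw [← Finset.sum_mul]
    have h3 : 0 ≤ stripVariation w j :=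
      Finset.sum_nonneg fun s _ => stripVariation_term_nonneg hn w j s
    refine (mul_le_mul_of_nonneg_right (sum_area_strip_le hn) (by positivity)).trans ?_
    rw [stripVariation, Finset.mul_sum, Finset.mul_sum]
    refine Finset.sum_le_sum fun s _ => le_of_eq ?_
    unfold area
    field_simp
    ring
  simp only [mul_add, Finset.sum_add_distrib]
  unfold gradSum
  rw [Finset.mul_sum]
  have h4 : ∑ i : Fin (2 * m) × (Fin n ⊕ Fin (n + 1)), 6 * (area n m i.2 *
      (|slopeX (w i)| + |slopeY (w i)|)) = ∑ i, area n m i.2 * (6 * |slopeX (w i)|) +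
      6 * ∑ i, area n m i.2 * |slopeY (w i)| := by
    rw [Finset.mul_sum, ← Finset.sum_add_distrib]
    exact Finset.sum_congr rfl fun i _ => by ring
  have h5 : 0 ≤ ∑ i, area n m i.2 * |slopeY (w i)| :=
    Finset.sum_nonneg fun i _ => mul_nonneg (area_pos hn hm i.2).le (abs_nonneg _)
  rw [h4]
  linarith

theorem abs_modelUx_le {z : Plane} (hx : z.1 ∈ Set.Icc (0 : ℝ) 1) (hy : z.2 ∈ Set.Icc (0 : ℝ) 1) :
    |modelUx z| ≤ 1 := by
  unfold modelUx
  rw [abs_mul]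
  refine mul_le_one₀ (abs_le.2 ⟨by linarith [hx.2], by linarith [hx.1]⟩) (abs_nonneg _) ?_
  exact abs_le.2 ⟨by nlinarith [hy.1, hy.2], by nlinarith [hy.1, hy.2]⟩

theorem abs_modelUy_le {z : Plane} (hx : z.1 ∈ Set.Icc (0 : ℝ) 1) (hy : z.2 ∈ Set.Icc (0 : ℝ) 1) :
    |modelUy z| ≤ 1 :=
  abs_modelUx_le (z := (z.2, z.1)) hy hx

theorem abs_brokenInner_modelU_le (hn : 1 ≤ n) (hm : 1 ≤ m)
    (w : Fin (2 * m) × (Fin n ⊕ Fin (n + 1)) → (Plane →ᵃ[ℝ] ℝ)) :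
    |brokenInner (babuskaAziz n m) (fun _ => modelU) (pieces w)| ≤ gradSum n m w := by
  rw [brokenInner_modelU]
  refine (Finset.abs_sum_le_sum_abs _ _).trans (Finset.sum_le_sum fun i _ => ?_)
  obtain ⟨j, s⟩ := i
  have key : ∀ t ∈ Set.Icc (0 : ℝ) 1, ∀ x ∈ Set.Icc (0 : ℝ) 1,
      |(fun z => modelUx z * slopeX (w (j, s)) + modelUy z * slopeY (w (j, s)))
        ((1 - t) * (baseLeft s + x * (baseRight s - baseLeft s)) + t * apexX s,
          baseY m j s + t * (apexY m j s - baseY m j s))| ≤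
      |slopeX (w (j, s))| + |slopeY (w (j, s))| := by
    intro t ht x hx
    obtain ⟨h1, h2⟩ := mem_Icc_of_mem_triangle (baseLeft_mem hn s) (baseRight_mem hn s)
      (apexX_mem hn s) (baseY_mem j.2 s) (apexY_mem j.2 s) ht hx
    refine (abs_add_le _ _).trans ?_
    rw [abs_mul, abs_mul]
    exact add_le_add (mul_le_of_le_one_left (abs_nonneg _) (abs_modelUx_le h1 h2))
      (mul_le_of_le_one_left (abs_nonneg _) (abs_modelUy_le h1 h2))
  have hA : area n m s =
      (baseRight s - baseLeft s) * |apexY m j s - baseY m j s| / 2 := by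
    rw [abs_apexY_sub_baseY, area]
  simp only
  rw [triangle_babuskaAziz, hA, abs_le]
  constructor
  · rw [neg_le, ← integral_neg]
    exact setIntegral_triangle_le (baseLeft_lt_baseRight hn s) (baseY_ne_apexY hm j s)
      (continuous_grad_modelU _ _).neg fun t ht x hx => (neg_le_abs _).trans (key t ht x hx)
  · exact setIntegral_triangle_le (baseLeft_lt_baseRight hn s) (baseY_ne_apexY hm j s)
      (continuous_grad_modelU _ _) fun t ht x hx => (le_abs_self _).trans (key t ht x hx)

/-- The upper bound for the consistency functional on the nonconforming P1 space. -/
theorem abs_consistency_le (hn : 1 ≤ n) (hnm : n ≤ m) (h : HasNodalValues n m w S H O) :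
    |consistency n m w| ≤ 96 * min 1 ((m : ℝ) / n ^ 2) * Real.sqrt (energy n m w w) := by
  have hm : 1 ≤ m := hn.trans hnm
  have hg0 : 0 ≤ gradSum n m w :=
    Finset.sum_nonneg fun i _ => mul_nonneg (area_pos hn hm i.2).le (by positivity)
  have hg := gradSum_le hn hm w
  have h1 := abs_consistency_le_ratio hn hnm h
  -- The bounds for both parts add up to 7; the larger constant matches the one in the ratio bound,
  -- so that the minimum can be taken.
  have h2 : |consistency n m w| ≤ 48 * 1 * gradSum n m w := by
    have h3 := abs_brokenInner_modelU_le hn hm w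
    have h4 := abs_load_le hn hm h
    have h5 : |consistency n m w| ≤ |brokenInner (babuskaAziz n m) (fun _ => modelU) (pieces w)| +
      |load (babuskaAziz n m) modelF (pieces w)| := abs_sub _ _
    linarith
  have h3 : |consistency n m w| ≤ 48 * min 1 ((m : ℝ) / n ^ 2) * gradSum n m w := by
    rcases min_choice 1 ((m : ℝ) / n ^ 2) with h | h <;> rw [h] <;> assumption
  have h4 : 0 ≤ min 1 ((m : ℝ) / n ^ 2) := by positivity
  calc |consistency n m w| ≤ 48 * min 1 ((m : ℝ) / n ^ 2) * gradSum n m w := h3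
    _ ≤ 48 * min 1 ((m : ℝ) / n ^ 2) * (2 * Real.sqrt (energy n m w w)) := by gcongr
    _ = 96 * min 1 ((m : ℝ) / n ^ 2) * Real.sqrt (energy n m w w) := by ring

/-- The broken scalar product is definite on the nonconforming P1 space. -/
theorem eq_zero_of_energy_eq_zero (hn : 1 ≤ n) (hm : 1 ≤ m) (h : HasNodalValues n m w S H O)
    (hw : energy n m w w = 0) : w = 0 := by
  have h1 : ∀ i, slopeX (w i) = 0 ∧ slopeY (w i) = 0 := by
    intro i
    have h2 := (Finset.sum_eq_zero_iff_of_nonneg (fun i _ =>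
      mul_nonneg (area_pos hn hm i.2).le
        (add_nonneg (mul_self_nonneg (slopeX (w i))) (mul_self_nonneg (slopeY (w i)))))).1
        hw i (Finset.mem_univ i)
    have h3 := (mul_eq_zero.1 h2).resolve_left (area_pos hn hm i.2).ne'
    have h4 := mul_self_nonneg (slopeX (w i))
    have h5 := mul_self_nonneg (slopeY (w i))
    exact ⟨mul_self_eq_zero.1 (by linarith), mul_self_eq_zero.1 (by linarith)⟩
  funext i
  obtain ⟨j, s⟩ := i
  have h2 : stripVariation w j = 0 :=
    Finset.sum_eq_zero fun s _ => by rw [(h1 (j, s)).1, abs_zero, zero_mul, zero_div]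
  have h3 := (abs_slanted_values_le hn h j s).1
  rw [h2] at h3
  have h4 := abs_nonpos_iff.1 h3
  ext z
  rw [affine_apply_eq, (h1 (j, s)).1, (h1 (j, s)).2] at h4 ⊢
  simpa using h4

end ConsistencyUpperBound

/-! ### Functions with prescribed nodal values -/

section NodalFunctions

variable {n m : ℕ}

/-- The affine function with values `g₀`, `g₁`, `g₂` at the edge midpoints of the triangle with
horizontal edge from `(p, b)` to `(q, b)` and apex `(r, e)`. -/
def affineOfMidpoints (p q r b e g₀ g₁ g₂ : ℝ) : Plane →ᵃ[ℝ] ℝ :=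
  affineOfCoeffs
    (g₁ - 2 * (g₀ - g₁) / (q - p) * ((p + r) / 2) -
      2 * (g₁ + 2 * (g₀ - g₁) / (q - p) * (q - r) / 2 - g₂) / (e - b) * ((b + e) / 2))
    (2 * (g₀ - g₁) / (q - p))
    (2 * (g₁ + 2 * (g₀ - g₁) / (q - p) * (q - r) / 2 - g₂) / (e - b))

theorem affineOfMidpoints_zero {p q : ℝ} (hpq : p < q) (r b e g₀ g₁ g₂ : ℝ) :
    affineOfMidpoints p q r b e g₀ g₁ g₂ ((q + r) / 2, (b + e) / 2) = g₀ := by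
  have : q - p ≠ 0 := (sub_pos.2 hpq).ne'
  rw [affineOfMidpoints, affineOfCoeffs_apply]
  field_simp
  ring

theorem affineOfMidpoints_one (p q r b e g₀ g₁ g₂ : ℝ) :
    affineOfMidpoints p q r b e g₀ g₁ g₂ ((p + r) / 2, (b + e) / 2) = g₁ := by
  rw [affineOfMidpoints, affineOfCoeffs_apply]
  ring

theorem affineOfMidpoints_two {b e : ℝ} (hbe : b ≠ e) (p q r g₀ g₁ g₂ : ℝ) :
    affineOfMidpoints p q r b e g₀ g₁ g₂ ((p + q) / 2, b) = g₂ := by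
  have : e - b ≠ 0 := sub_ne_zero.2 hbe.symm
  rw [affineOfMidpoints, affineOfCoeffs_apply]
  generalize 2 * (g₀ - g₁) / (q - p) = β
  field_simp
  ring

/-- The piecewise affine function with the given nodal values. -/
def nodalFunction (n m : ℕ) (S H O : ℕ → ℕ → ℝ) :
    Fin (2 * m) × (Fin n ⊕ Fin (n + 1)) → (Plane →ᵃ[ℝ] ℝ)
  | (j, Sum.inl a) =>
      affineOfMidpoints (baseLeft (Sum.inl a)) (baseRight (Sum.inl a)) (apexX (Sum.inl a))
        (baseY m j (Sum.inl a)) (apexY m j (Sum.inl a))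
        (S j (2 * a + 2)) (S j (2 * a + 1)) (H ((j + 1) / 2) a)
  | (j, Sum.inr a) =>
      affineOfMidpoints (baseLeft (Sum.inr a : Fin n ⊕ Fin (n + 1))) (baseRight (Sum.inr a))
        (apexX (Sum.inr a)) (baseY m j (Sum.inr a : Fin n ⊕ Fin (n + 1)))
        (apexY m j (Sum.inr a : Fin n ⊕ Fin (n + 1)))
        (S j (2 * a + 1)) (S j (2 * a)) (O (j / 2) a)

theorem hasNodalValues_nodalFunction (hn : 1 ≤ n) (hm : 1 ≤ m) {S H O : ℕ → ℕ → ℝ}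
    (hl : ∀ j, S j 0 = 0) (hr : ∀ j, S j (2 * n + 1) = 0) (hb : ∀ a, H 0 a = 0)
    (ht : ∀ a, H m a = 0) : HasNodalValues n m (nodalFunction n m S H O) S H O := by
  refine ⟨hl, hr, hb, ht, fun j a => ?_, fun j a => ?_⟩
  · rw [edgeMidpoint_zero, edgeMidpoint_one, edgeMidpoint_two]
    exact ⟨affineOfMidpoints_zero (baseLeft_lt_baseRight hn _) _ _ _ _ _ _,
      affineOfMidpoints_one _ _ _ _ _ _ _ _,
      affineOfMidpoints_two (baseY_ne_apexY hm _ _) _ _ _ _ _ _⟩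
  · rw [edgeMidpoint_zero, edgeMidpoint_one, edgeMidpoint_two]
    exact ⟨affineOfMidpoints_zero (baseLeft_lt_baseRight hn _) _ _ _ _ _ _,
      affineOfMidpoints_one _ _ _ _ _ _ _ _,
      affineOfMidpoints_two (baseY_ne_apexY hm _ _) _ _ _ _ _ _⟩

/-- The abscissae of the nodes on the midline of a strip. -/
def nodeX (n i : ℕ) : ℝ := if i = 0 then 0 else if i = 2 * n + 1 then 1 else (2 * i - 1) / (4 * n)

theorem midpoint_inl_zero (hn : 1 ≤ n) (a : Fin n) :
    (baseRight (Sum.inl a) + apexX (Sum.inl a)) / 2 = nodeX n (2 * a + 2) := by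
  have hn' : (0 : ℝ) < n := by positivity
  unfold nodeX
  rw [if_neg (by omega), if_neg (by omega)]
  simp [baseRight, apexX, vertexX]
  field_simp
  ring

theorem midpoint_inl_one (hn : 1 ≤ n) (a : Fin n) :
    (baseLeft (Sum.inl a) + apexX (Sum.inl a)) / 2 = nodeX n (2 * a + 1) := by
  have hn' : (0 : ℝ) < n := by positivity
  unfold nodeX
  rw [if_neg (by omega), if_neg (by omega)]
  simp [baseLeft, apexX, vertexX]
  field_simp
  ring

theorem midpoint_inr_zero (hn : 1 ≤ n) (a : Fin (n + 1)) :
    (baseRight (Sum.inr a) + apexX (Sum.inr a : Fin n ⊕ Fin (n + 1))) / 2 =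
      nodeX n (2 * a + 1) := by
  have hn' : (0 : ℝ) < n := by positivity
  have ha := a.2
  unfold nodeX
  rw [if_neg (by omega)]
  simp only [baseRight, apexX, vertexX]
  by_cases han : (a : ℕ) = n
  · rw [if_pos (by omega)]
    simp only [Matrix.cons_val, han]
    rw [min_eq_right (by omega)]
    push_cast
    field_simp
    ring
  · rw [if_neg (by omega)]
    simp only [Matrix.cons_val]
    rw [min_eq_left (by omega)]
    push_cast
    field_simp
    ring

theorem midpoint_inr_one (hn : 1 ≤ n) (a : Fin (n + 1)) :
    (baseLeft (Sum.inr a) + apexX (Sum.inr a : Fin n ⊕ Fin (n + 1))) / 2 = nodeX n (2 * a) := by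
  have hn' : (0 : ℝ) < n := by positivity
  have ha := a.2
  unfold nodeX
  simp only [baseLeft, apexX, vertexX]
  by_cases ha0 : (a : ℕ) = 0
  · rw [if_pos (by omega)]
    simp [ha0]
  · rw [if_neg (by omega), if_neg (by omega)]
    simp only [Matrix.cons_val]
    rw [Nat.cast_sub (by omega)]
    push_cast
    field_simp
    ring

theorem midpoint_baseY_apexY (hm : 1 ≤ m) (j : ℕ) (s : Fin n ⊕ Fin (n + 1)) :
    (baseY m j s + apexY m j s) / 2 = (2 * j + 1) / (4 * m) := by
  have hm' : (0 : ℝ) < m := by positivity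
  have h : vertexY n j s 0 + vertexY n j s 2 = 2 * j + 1 := by
    rcases s with a | a <;> simp [vertexY] <;> omega
  have h' : (vertexY n j s 0 : ℝ) + vertexY n j s 2 = 2 * j + 1 := by exact_mod_cast h
  unfold baseY apexY
  rw [← add_div, h']
  field_simp
  ring

end NodalFunctions

/-! ### The best approximation error -/

section Approximation

variable {n m : ℕ}

theorem modelU_left (y : ℝ) : modelU (0, y) = 0 := by simp [modelU]

theorem modelU_right (y : ℝ) : modelU (1, y) = 0 := by simp [modelU]

theorem modelU_bot (x : ℝ) : modelU (x, 0) = 0 := by simp [modelU]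

theorem modelU_top (x : ℝ) : modelU (x, 1) = 0 := by simp [modelU]

/-- The value assigned to the midpoint of the horizontal edge: the same convex combination of
values of `modelU` as on the midline above it. -/
def baseMean (s : Fin n ⊕ Fin (n + 1)) (y : ℝ) : ℝ :=
  ((apexX s - baseLeft s) * modelU ((baseLeft s + apexX s) / 2, y) +
    (baseRight s - apexX s) * modelU ((baseRight s + apexX s) / 2, y)) /
    (baseRight s - baseLeft s)

/-- An element of the nonconforming P1 space close to `modelU`. -/
def approximant (n m : ℕ) : Fin (2 * m) × (Fin n ⊕ Fin (n + 1)) → (Plane →ᵃ[ℝ] ℝ) := fun i =>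
  affineOfMidpoints (baseLeft i.2) (baseRight i.2) (apexX i.2) (baseY m i.1 i.2)
    (apexY m i.1 i.2)
    (modelU ((baseRight i.2 + apexX i.2) / 2, (baseY m i.1 i.2 + apexY m i.1 i.2) / 2))
    (modelU ((baseLeft i.2 + apexX i.2) / 2, (baseY m i.1 i.2 + apexY m i.1 i.2) / 2))
    (baseMean i.2 (baseY m i.1 i.2))

/-- `baseMean` depends only on the column and the line, so the two triangles above and below a
horizontal edge receive the same value; it vanishes on the bottom and top sides because u does. -/
theorem exists_hasNodalValues_approximant (hn : 1 ≤ n) (hm : 1 ≤ m) :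
    ∃ S H O : ℕ → ℕ → ℝ, HasNodalValues n m (approximant n m) S H O := by
  have hm' : (0 : ℝ) < m := by positivity
  refine ⟨fun j i => modelU (nodeX n i, (2 * j + 1) / (4 * m)),
    fun k a => if h : a < n then baseMean (Sum.inl ⟨a, h⟩ : Fin n ⊕ Fin (n + 1))
      (((2 * k : ℕ) : ℝ) / (2 * m)) else 0,
    fun k a => if h : a < n + 1 then baseMean (Sum.inr ⟨a, h⟩ : Fin n ⊕ Fin (n + 1))
      (((2 * k + 1 : ℕ) : ℝ) / (2 * m)) else 0, ?_, ?_, ?_, ?_, ?_, ?_⟩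
  · intro j
    simp only [nodeX, if_true, modelU_left]
  · intro j
    simp only [nodeX, if_true]
    rw [if_neg (by omega), modelU_right]
  · intro a
    simp [baseMean, modelU_bot]
  · intro a
    have : ((2 * m : ℕ) : ℝ) / (2 * m) = 1 := by
      push_cast
      field_simp
    rw [this]
    simp [baseMean, modelU_top]
  · intro j a
    rw [edgeMidpoint_zero, edgeMidpoint_one, edgeMidpoint_two, ← midpoint_inl_zero hn,
      ← midpoint_inl_one hn, ← midpoint_baseY_apexY hm j (Sum.inl a), dif_pos a.2]
    exact ⟨affineOfMidpoints_zero (baseLeft_lt_baseRight hn _) _ _ _ _ _ _,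
      affineOfMidpoints_one _ _ _ _ _ _ _ _,
      affineOfMidpoints_two (baseY_ne_apexY hm _ _) _ _ _ _ _ _⟩
  · intro j a
    rw [edgeMidpoint_zero, edgeMidpoint_one, edgeMidpoint_two, ← midpoint_inr_zero hn,
      ← midpoint_inr_one hn,
      ← midpoint_baseY_apexY hm j (Sum.inr a : Fin n ⊕ Fin (n + 1)), dif_pos a.2]
    exact ⟨affineOfMidpoints_zero (baseLeft_lt_baseRight hn _) _ _ _ _ _ _,
      affineOfMidpoints_one _ _ _ _ _ _ _ _,
      affineOfMidpoints_two (baseY_ne_apexY hm _ _) _ _ _ _ _ _⟩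

theorem slopeX_approximant (hn : 1 ≤ n) (i : Fin (2 * m) × (Fin n ⊕ Fin (n + 1))) :
    slopeX (approximant n m i) =
      (1 - (baseRight i.2 + apexX i.2) / 2 - (baseLeft i.2 + apexX i.2) / 2) *
        ((baseY m i.1 i.2 + apexY m i.1 i.2) / 2 *
          (1 - (baseY m i.1 i.2 + apexY m i.1 i.2) / 2)) := by
  have h0 : baseRight i.2 - baseLeft i.2 ≠ 0 := (sub_pos.2 (baseLeft_lt_baseRight hn _)).ne'
  unfold approximant affineOfMidpoints
  rw [slopeX_affineOfCoeffs, div_eq_iff h0]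
  unfold modelU
  ring

/-- Above the base midpoint, the midline value is the convex combination used in `baseMean`, so the
slope is a mean of difference quotients of u in y. The value of u itself at the base midpoint would
leave an error of order n⁻² in the numerator, hence m/n² in the slope. -/
theorem slopeY_approximant (hn : 1 ≤ n) (hm : 1 ≤ m)
    (i : Fin (2 * m) × (Fin n ⊕ Fin (n + 1))) :
    slopeY (approximant n m i) =
      ((apexX i.2 - baseLeft i.2) *
          ((baseLeft i.2 + apexX i.2) / 2 * (1 - (baseLeft i.2 + apexX i.2) / 2)) +
        (baseRight i.2 - apexX i.2) *
          ((baseRight i.2 + apexX i.2) / 2 * (1 - (baseRight i.2 + apexX i.2) / 2))) /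
        (baseRight i.2 - baseLeft i.2) *
        (1 - (baseY m i.1 i.2 + apexY m i.1 i.2) / 2 - baseY m i.1 i.2) := by
  have h0 : baseRight i.2 - baseLeft i.2 ≠ 0 := (sub_pos.2 (baseLeft_lt_baseRight hn _)).ne'
  have h1 : apexY m i.1 i.2 - baseY m i.1 i.2 ≠ 0 := sub_ne_zero.2 (baseY_ne_apexY hm _ _).symm
  unfold approximant affineOfMidpoints baseMean
  rw [slopeY_affineOfCoeffs, div_eq_iff h1]
  unfold modelU
  field_simp
  ring

theorem abs_mul_one_sub_sub_le {x y : ℝ} (hx : x ∈ Set.Icc (0 : ℝ) 1)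
    (hy : y ∈ Set.Icc (0 : ℝ) 1) : |x * (1 - x) - y * (1 - y)| ≤ |x - y| := by
  rw [show x * (1 - x) - y * (1 - y) = (x - y) * (1 - x - y) by ring, abs_mul]
  exact mul_le_of_le_one_right (abs_nonneg _)
    (abs_le.2 ⟨by linarith [hx.2, hy.2], by linarith [hx.1, hy.1]⟩)

theorem abs_mul_sub_mul_le {a b a' b' ε δ : ℝ} (hb : |b| ≤ 1) (ha' : |a'| ≤ 1)
    (h1 : |a - a'| ≤ ε) (h2 : |b - b'| ≤ δ) : |a * b - a' * b'| ≤ ε + δ := by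
  rw [show a * b - a' * b' = (a - a') * b + a' * (b - b') by ring]
  refine (abs_add_le _ _).trans (add_le_add ?_ ?_)
  · rw [abs_mul]
    exact (mul_le_of_le_one_right (abs_nonneg _) hb).trans h1
  · rw [abs_mul]
    exact (mul_le_of_le_one_left (abs_nonneg _) ha').trans h2

/-- Both components of the gradient are products whose factors are reproduced up to 2l and l, so
each is off by at most 3l, and 9 + 9 = 18. -/
theorem gradient_error_le {p q r b e l x y : ℝ} (hpq : p < q) (hpr : p ≤ r) (hrq : r ≤ q)
    (hp : p ∈ Set.Icc (0 : ℝ) 1) (hq : q ∈ Set.Icc (0 : ℝ) 1) (hb : b ∈ Set.Icc (0 : ℝ) 1)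
    (he : e ∈ Set.Icc (0 : ℝ) 1) (hl : q - p ≤ l) (hl' : |e - b| ≤ l)
    (hx : x ∈ Set.Icc p q) (hy : y ∈ Set.Icc (0 : ℝ) 1) (hyb : |y - b| ≤ |e - b|)
    (hye : |y - e| ≤ |e - b|) :
    (modelUx (x, y) - (1 - (q + r) / 2 - (p + r) / 2) * ((b + e) / 2 * (1 - (b + e) / 2))) ^ 2 +
      (modelUy (x, y) - ((r - p) * ((p + r) / 2 * (1 - (p + r) / 2)) +
        (q - r) * ((q + r) / 2 * (1 - (q + r) / 2))) / (q - p) * (1 - (b + e) / 2 - b)) ^ 2 ≤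
      18 * l ^ 2 := by
  have hl0 : 0 ≤ l := (sub_pos.2 hpq).le.trans hl
  have hx1 : x ∈ Set.Icc (0 : ℝ) 1 := ⟨hp.1.trans hx.1, hx.2.trans hq.2⟩
  have hr : r ∈ Set.Icc (0 : ℝ) 1 := ⟨hp.1.trans hpr, hrq.trans hq.2⟩
  have hX : ∀ z ∈ Set.Icc (0 : ℝ) 1, |z * (1 - z)| ≤ 1 := fun z hz =>
    abs_le.2 ⟨by nlinarith [hz.1, hz.2], by nlinarith [hz.1, hz.2]⟩
  rw [abs_le] at hl' hyb hye
  have hyy : |y - (b + e) / 2| ≤ l := by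
    rcases abs_cases (e - b) with ⟨h1, h2⟩ | ⟨h1, h2⟩ <;> rw [h1] at hyb hye <;>
      exact abs_le.2 ⟨by linarith, by linarith⟩
  have a1 : |modelUx (x, y) - (1 - (q + r) / 2 - (p + r) / 2) *
      ((b + e) / 2 * (1 - (b + e) / 2))| ≤ 2 * l + l := by
    refine abs_mul_sub_mul_le (hX y hy)
      (abs_le.2 ⟨by linarith [hq.2, hp.2, hr.2], by linarith [hq.1, hp.1, hr.1]⟩) ?_
      ((abs_mul_one_sub_sub_le hy (mem_Icc_midpoint hb he)).trans hyy)
    exact abs_le.2 ⟨by simp only; linarith [hx.1, hx.2], by simp only; linarith [hx.1, hx.2]⟩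
  have a2 : |modelUy (x, y) - ((r - p) * ((p + r) / 2 * (1 - (p + r) / 2)) +
        (q - r) * ((q + r) / 2 * (1 - (q + r) / 2))) / (q - p) * (1 - (b + e) / 2 - b)| ≤
      2 * l + l := by
    rw [mul_comm (_ / _)]
    have hbe : |b - e| ≤ l := abs_le.2 ⟨by linarith, by linarith⟩
    refine abs_mul_sub_mul_le (hX x hx1)
      (abs_le.2 ⟨by linarith [hb.2, he.2], by linarith [hb.1, he.1]⟩) ?_ ?_
    · rw [show 1 - 2 * (x, y).2 - (1 - (b + e) / 2 - b) =
        -((y - (b + e) / 2) + (y - b)) by simp only; ring, abs_neg]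
      refine (abs_add_le _ _).trans ?_
      have : |y - b| ≤ l := by
        rcases abs_cases (e - b) with ⟨h1, h2⟩ | ⟨h1, h2⟩ <;> rw [h1] at hyb <;>
          exact abs_le.2 ⟨by linarith, by linarith⟩
      linarith
    · have hqp := sub_pos.2 hpq
      have e1 : x * (1 - x) - ((r - p) * ((p + r) / 2 * (1 - (p + r) / 2)) +
          (q - r) * ((q + r) / 2 * (1 - (q + r) / 2))) / (q - p) =
          ((r - p) * (x * (1 - x) - (p + r) / 2 * (1 - (p + r) / 2)) +
          (q - r) * (x * (1 - x) - (q + r) / 2 * (1 - (q + r) / 2))) / (q - p) := by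
        field_simp
        ring
      simp only
      rw [e1, abs_div, abs_of_pos hqp, div_le_iff₀ hqp]
      have b1 : |x * (1 - x) - (p + r) / 2 * (1 - (p + r) / 2)| ≤ l :=
        (abs_mul_one_sub_sub_le hx1 (mem_Icc_midpoint hp hr)).trans
          (abs_le.2 ⟨by linarith [hx.1, hx.2], by linarith [hx.1, hx.2]⟩)
      have b2 : |x * (1 - x) - (q + r) / 2 * (1 - (q + r) / 2)| ≤ l :=
        (abs_mul_one_sub_sub_le hx1 (mem_Icc_midpoint hq hr)).trans
          (abs_le.2 ⟨by linarith [hx.1, hx.2], by linarith [hx.1, hx.2]⟩)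
      refine (abs_add_le _ _).trans ?_
      rw [abs_mul, abs_mul, abs_of_nonneg (sub_nonneg.2 hpr), abs_of_nonneg (sub_nonneg.2 hrq)]
      calc (r - p) * |x * (1 - x) - (p + r) / 2 * (1 - (p + r) / 2)| +
            (q - r) * |x * (1 - x) - (q + r) / 2 * (1 - (q + r) / 2)| ≤
            (r - p) * l + (q - r) * l :=
          add_le_add (mul_le_mul_of_nonneg_left b1 (sub_nonneg.2 hpr))
            (mul_le_mul_of_nonneg_left b2 (sub_nonneg.2 hrq))
        _ = l * (q - p) := by ring
  have s1 := pow_le_pow_left₀ (abs_nonneg _) a1 2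
  have s2 := pow_le_pow_left₀ (abs_nonneg _) a2 2
  rw [sq_abs] at s1 s2
  linarith

theorem continuous_gradient_error (β γ : ℝ) :
    Continuous fun z => (modelUx z - β) ^ 2 + (modelUy z - γ) ^ 2 :=
  ((continuous_modelUx.sub continuous_const).pow 2).add
    ((continuous_modelUy.sub continuous_const).pow 2)

theorem brokenError_approximant_le (hn : 1 ≤ n) (hnm : n ≤ m) :
    brokenError (babuskaAziz n m) modelU (approximant n m) ≤ 6 / n := by
  have hm : 1 ≤ m := hn.trans hnm
  have hn' : (0 : ℝ) < n := by positivity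
  have hnm' : (n : ℝ) ≤ m := by exact_mod_cast hnm
  rw [brokenError_eq]
  refine Real.sqrt_le_iff.2 ⟨by positivity, ?_⟩
  have h1 : ∀ i : Fin (2 * m) × (Fin n ⊕ Fin (n + 1)),
      ∫ p in triangle (babuskaAziz n m) i, ((modelUx p - slopeX (approximant n m i)) ^ 2 +
        (modelUy p - slopeY (approximant n m i)) ^ 2) ≤ area n m i.2 * (18 * (1 / n) ^ 2) := by
    rintro ⟨j, s⟩
    have hA : area n m s =
        (baseRight s - baseLeft s) * |apexY m j s - baseY m j s| / 2 := by
      rw [abs_apexY_sub_baseY, area]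
    simp only
    rw [triangle_babuskaAziz, hA]
    refine setIntegral_triangle_le (baseLeft_lt_baseRight hn s) (baseY_ne_apexY hm j s)
      (continuous_gradient_error _ _) fun t ht x hx => ?_
    rw [slopeX_approximant hn, slopeY_approximant hn hm]
    have hpq := sub_pos.2 (baseLeft_lt_baseRight hn s)
    have ht' : 0 ≤ 1 - t := sub_nonneg.2 ht.2
    have hx' : 0 ≤ 1 - x := sub_nonneg.2 hx.2
    have hpr := sub_nonneg.2 (baseLeft_le_apexX s)
    have hrq := sub_nonneg.2 (apexX_le_baseRight s)
    refine gradient_error_le (baseLeft_lt_baseRight hn s) (baseLeft_le_apexX s)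
      (apexX_le_baseRight s) (baseLeft_mem hn s) (baseRight_mem hn s) (baseY_mem j.2 s)
      (apexY_mem j.2 s) (baseRight_sub_baseLeft_le hn s) ?_ ⟨?_, ?_⟩
      (mem_Icc_of_mem_triangle (baseLeft_mem hn s) (baseRight_mem hn s)
      (apexX_mem hn s) (baseY_mem j.2 s) (apexY_mem j.2 s) ht hx).2 ?_ ?_
    · rw [abs_apexY_sub_baseY]
      exact one_div_le_one_div_of_le (by positivity) (by linarith)
    · have := mul_nonneg (mul_nonneg ht' hx.1) hpq.le
      have := mul_nonneg ht.1 hpr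
      linarith
    · have := mul_nonneg (mul_nonneg ht' hx') hpq.le
      have := mul_nonneg ht.1 hrq
      linarith
    · rw [add_sub_cancel_left, abs_mul, abs_of_nonneg ht.1]
      exact mul_le_of_le_one_left (abs_nonneg _) ht.2
    · rw [show baseY m j s + t * (apexY m j s - baseY m j s) - apexY m j s =
        -((1 - t) * (apexY m j s - baseY m j s)) by ring, abs_neg, abs_mul, abs_of_nonneg ht']
      exact mul_le_of_le_one_left (abs_nonneg _) (by linarith [ht.1])
  refine (Finset.sum_le_sum fun i _ => h1 i).trans ?_
  rw [← Finset.sum_mul]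
  calc (∑ i : Fin (2 * m) × (Fin n ⊕ Fin (n + 1)), area n m i.2) * (18 * (1 / (n : ℝ)) ^ 2) ≤
      3 / 2 * (18 * (1 / (n : ℝ)) ^ 2) := by
        gcongr
        exact sum_area_le hn hm
    _ ≤ (6 / (n : ℝ)) ^ 2 := by
        rw [show (6 / (n : ℝ)) ^ 2 = 36 * (1 / (n : ℝ)) ^ 2 by ring]
        linarith [sq_nonneg (1 / (n : ℝ))]

theorem sum_range_odd_mul (M : ℝ) (k : ℕ) :
    ∑ c ∈ Finset.range k, (2 * c + 1 : ℝ) * (2 * M - (2 * c + 1)) =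
      2 * M * k ^ 2 - k * (4 * k ^ 2 - 1) / 3 := by
  induction k with
  | zero => simp
  | succ k ih =>
    rw [Finset.sum_range_succ, ih]
    push_cast
    ring

theorem sum_range_two_mul_half (f : ℕ → ℝ) (m : ℕ) :
    ∑ j ∈ Finset.range (2 * m), f (j / 2) = 2 * ∑ k ∈ Finset.range m, f k := by
  induction m with
  | zero => simp
  | succ m ih =>
    rw [mul_add, mul_one, Finset.sum_range_succ, Finset.sum_range_succ, ih,
      show (2 * m) / 2 = m by omega, show (2 * m + 1) / 2 = m by omega, Finset.sum_range_succ]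
    ring

/-- The sum of y(1 - y) over the odd lines is explicit and at least m/6. The squares are reduced to
it by the tangent inequality z² ≥ z/3 - 1/36 at z = 1/6, the mean of y(1 - y) on [0, 1]. -/
theorem le_sum_sq_odd_lines (hm : 1 ≤ m) : (m : ℝ) / 36 ≤ ∑ k ∈ Finset.range m,
    ((2 * k + 1 : ℝ) / (2 * m) * (1 - (2 * k + 1) / (2 * m))) ^ 2 := by
  have hm' : (0 : ℝ) < m := by positivity
  have h1 : (m : ℝ) / 6 ≤ ∑ k ∈ Finset.range m,
      ((2 * k + 1 : ℝ) / (2 * m) * (1 - (2 * k + 1) / (2 * m))) := by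
    have h2 : ∀ k : ℕ, ((2 * k + 1 : ℝ) / (2 * m) * (1 - (2 * k + 1) / (2 * m))) =
        (2 * k + 1 : ℝ) * (2 * m - (2 * k + 1)) * (1 / (4 * m ^ 2)) := by
      intro k
      field_simp
      ring
    simp only [h2]
    rw [← Finset.sum_mul, sum_range_odd_mul, mul_one_div, le_div_iff₀ (by positivity)]
    nlinarith
  have h3 : ∑ k ∈ Finset.range m,
      ((2 * k + 1 : ℝ) / (2 * m) * (1 - (2 * k + 1) / (2 * m)) * (1 / 3) - 1 / 36) ≤
      ∑ k ∈ Finset.range m, ((2 * k + 1 : ℝ) / (2 * m) * (1 - (2 * k + 1) / (2 * m))) ^ 2 := by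
    refine Finset.sum_le_sum fun k _ => ?_
    generalize (2 * k + 1 : ℝ) / (2 * m) * (1 - (2 * k + 1) / (2 * m)) = z
    linarith [sq_nonneg (z - 1 / 6)]
  refine le_trans ?_ h3
  rw [Finset.sum_sub_distrib, ← Finset.sum_mul, Finset.sum_const, Finset.card_range,
    nsmul_eq_mul]
  linarith

/-- Piecewise affine functions cannot approximate `modelU` better than to first order. -/
theorem le_brokenError (hn : 1 ≤ n) (hm : 1 ≤ m)
    (v : Fin (2 * m) × (Fin n ⊕ Fin (n + 1)) → (Plane →ᵃ[ℝ] ℝ)) :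
    1 / 81 / n ≤ brokenError (babuskaAziz n m) modelU v := by
  have hm' : (0 : ℝ) < m := by positivity
  have hn' : (0 : ℝ) < n := by positivity
  rw [brokenError_eq]
  refine Real.le_sqrt_of_sq_le ?_
  have h0 : ∀ i : Fin (2 * m) × (Fin n ⊕ Fin (n + 1)),
      0 ≤ ∫ p in triangle (babuskaAziz n m) i,
        ((modelUx p - slopeX (v i)) ^ 2 + (modelUy p - slopeY (v i)) ^ 2) := fun i =>
    integral_nonneg fun p => add_nonneg (sq_nonneg _) (sq_nonneg _)
  -- Only the `Sum.inl` triangles are used: their base has the full width 1/n, and their apex lies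
  -- on an odd line, away from the boundary.
  have h1 : ∀ (j : Fin (2 * m)) (a : Fin n),
      (1 / n) ^ 3 * (1 / (2 * m)) *
        ((2 * ((j / 2 : ℕ) : ℝ) + 1) / (2 * m) *
          (1 - (2 * ((j / 2 : ℕ) : ℝ) + 1) / (2 * m))) ^ 2 / 180 ≤
      ∫ p in triangle (babuskaAziz n m) (j, Sum.inl a),
        ((modelUx p - slopeX (v (j, Sum.inl a))) ^ 2 +
          (modelUy p - slopeY (v (j, Sum.inl a))) ^ 2) := by
    intro j a
    have e1 : baseRight (Sum.inl a : Fin n ⊕ Fin (n + 1)) - baseLeft (Sum.inl a) = 1 / n := by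
      simp [baseRight, baseLeft, vertexX]
      field_simp
      ring
    have e2 : apexY m j (Sum.inl a : Fin n ⊕ Fin (n + 1)) =
        (2 * ((j / 2 : ℕ) : ℝ) + 1) / (2 * m) := by
      simp [apexY, vertexY]
    have h2 := le_setIntegral_modelUx_sub_sq (r := apexX (Sum.inl a : Fin n ⊕ Fin (n + 1)))
      (baseLeft_lt_baseRight hn (Sum.inl a))
      (baseY_ne_apexY hm j (Sum.inl a)) (baseY_mem j.2 (Sum.inl a)) (apexY_mem j.2 (Sum.inl a))
      (slopeX (v (j, Sum.inl a)))
    rw [abs_apexY_sub_baseY, e1, e2, ← e2, ← triangle_babuskaAziz, e2] at h2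
    refine h2.trans ?_
    exact setIntegral_mono_on
      (integrableOn_mesh (f := fun z => (modelUx z - slopeX (v (j, Sum.inl a))) ^ 2)
        ((continuous_modelUx.sub continuous_const).pow 2) _)
      (integrableOn_mesh (continuous_gradient_error _ _) _)
      (isCompact_convexHull_range _).measurableSet
      fun z _ => le_add_of_nonneg_right (sq_nonneg _)
  rw [sum_mesh]
  have h2 : ∑ j : Fin (2 * m), ∑ _a : Fin n, (1 / n : ℝ) ^ 3 * (1 / (2 * m)) *
        ((2 * ((j / 2 : ℕ) : ℝ) + 1) / (2 * m) *
          (1 - (2 * ((j / 2 : ℕ) : ℝ) + 1) / (2 * m))) ^ 2 / 180 ≤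
      ∑ j : Fin (2 * m), (∑ a : Fin n, (∫ p in triangle (babuskaAziz n m) (j, Sum.inl a),
        ((modelUx p - slopeX (v (j, Sum.inl a))) ^ 2 +
          (modelUy p - slopeY (v (j, Sum.inl a))) ^ 2)) +
        ∑ a : Fin (n + 1), ∫ p in triangle (babuskaAziz n m) (j, Sum.inr a),
        ((modelUx p - slopeX (v (j, Sum.inr a))) ^ 2 +
          (modelUy p - slopeY (v (j, Sum.inr a))) ^ 2)) := by
    refine Finset.sum_le_sum fun j _ => ?_
    exact (Finset.sum_le_sum fun a _ => h1 j a).trans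
      (le_add_of_nonneg_right (Finset.sum_nonneg fun a _ => h0 _))
  refine le_trans ?_ h2
  simp only [Finset.sum_const, Finset.card_univ, Fintype.card_fin, nsmul_eq_mul]
  have h3 := sum_range_two_mul_half
    (fun k => ((2 * (k : ℝ) + 1) / (2 * m) * (1 - (2 * (k : ℝ) + 1) / (2 * m))) ^ 2) m
  rw [Finset.sum_range] at h3
  have h4 : ∑ j : Fin (2 * m), (n : ℝ) * ((1 / n : ℝ) ^ 3 * (1 / (2 * m)) *
        ((2 * ((j / 2 : ℕ) : ℝ) + 1) / (2 * m) *
          (1 - (2 * ((j / 2 : ℕ) : ℝ) + 1) / (2 * m))) ^ 2 / 180) =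
      (n : ℝ) * (1 / (n : ℝ)) ^ 3 * (1 / (2 * (m : ℝ))) / 180 * ∑ j : Fin (2 * m),
        ((2 * ((j / 2 : ℕ) : ℝ) + 1) / (2 * m) *
          (1 - (2 * ((j / 2 : ℕ) : ℝ) + 1) / (2 * m))) ^ 2 := by
    rw [Finset.mul_sum]
    exact Finset.sum_congr rfl fun j _ => by ring
  rw [h4, h3]
  have h5 := le_sum_sq_odd_lines hm
  -- 6480 = 180 · 36, rounded up to 6561 = 81².
  calc (1 / 81 / n : ℝ) ^ 2 ≤ n * (1 / (n : ℝ)) ^ 3 * (1 / (2 * (m : ℝ))) / 180 *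
        (2 * (m / 36)) := by
        rw [show (n : ℝ) * (1 / n) ^ 3 * (1 / (2 * m)) / 180 * (2 * (m / 36)) =
          (1 / n) ^ 2 * (1 / 6480) by field_simp; norm_num]
        rw [show (1 / 81 / n : ℝ) ^ 2 = (1 / n) ^ 2 * (1 / 6561) by field_simp; norm_num]
        gcongr
        norm_num
    _ ≤ _ := by gcongr

theorem bestApproxError_le (hn : 1 ≤ n) (hnm : n ≤ m) :
    bestApproxError (babuskaAziz n m) modelU ≤ 6 / n := by
  have hm : 1 ≤ m := hn.trans hnm
  obtain ⟨S, H, O, h⟩ := exists_hasNodalValues_approximant hn hm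
  refine (csInf_le (a := brokenError (babuskaAziz n m) modelU (approximant n m)) ?_ ?_).trans
    (brokenError_approximant_le hn hnm)
  · refine ⟨0, ?_⟩
    rintro _ ⟨v, -, rfl⟩
    exact Real.sqrt_nonneg _
  · exact ⟨approximant n m, h.mem hn hm, rfl⟩

theorem le_bestApproxError (hn : 1 ≤ n) (hm : 1 ≤ m) :
    1 / 81 / n ≤ bestApproxError (babuskaAziz n m) modelU := by
  obtain ⟨S, H, O, h⟩ := exists_hasNodalValues_approximant hn hm
  refine le_csInf (Set.nonempty_of_mem (x := brokenError (babuskaAziz n m) modelU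
    (approximant n m)) ?_) ?_
  · exact ⟨approximant n m, h.mem hn hm, rfl⟩
  · rintro _ ⟨v, -, rfl⟩
    exact le_brokenError hn hm v

end Approximation

/-! ### Existence and uniqueness of the Galerkin solution -/

section Galerkin

variable {n m : ℕ}

theorem crouzeixRaviart_zero_mem (hn : 1 ≤ n) (hm : 1 ≤ m) :
    (0 : Fin (2 * m) × (Fin n ⊕ Fin (n + 1)) → (Plane →ᵃ[ℝ] ℝ)) ∈
      crouzeixRaviart (babuskaAziz n m) := by
  rw [mem_crouzeixRaviart_iff (babuskaAziz_vertices_ne hn hm)]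
  simp

/-- The nonconforming P1 space as a vector space. -/
def crouzeixRaviartSubmodule (hn : 1 ≤ n) (hm : 1 ≤ m) :
    Submodule ℝ (Fin (2 * m) × (Fin n ⊕ Fin (n + 1)) → (Plane →ᵃ[ℝ] ℝ)) where
  carrier := crouzeixRaviart (babuskaAziz n m)
  zero_mem' := crouzeixRaviart_zero_mem hn hm
  add_mem' := by
    intro v w hv hw
    rw [mem_crouzeixRaviart_iff (babuskaAziz_vertices_ne hn hm)] at *
    refine ⟨fun i i₂ k k₂ hi he => ?_, fun i k hb => ?_⟩
    · simp [hv.1 i i₂ k k₂ hi he, hw.1 i i₂ k k₂ hi he]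
    · simp [hv.2 i k hb, hw.2 i k hb]
  smul_mem' := by
    intro c v hv
    rw [mem_crouzeixRaviart_iff (babuskaAziz_vertices_ne hn hm)] at *
    refine ⟨fun i i₂ k k₂ hi he => ?_, fun i k hb => ?_⟩
    · simp [hv.1 i i₂ k k₂ hi he]
    · simp [hv.2 i k hb]

theorem energy_add_left (v v' w : Fin (2 * m) × (Fin n ⊕ Fin (n + 1)) → (Plane →ᵃ[ℝ] ℝ)) :
    energy n m (v + v') w = energy n m v w + energy n m v' w := by
  unfold energy
  rw [← Finset.sum_add_distrib]
  refine Finset.sum_congr rfl fun i _ => ?_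
  simp only [Pi.add_apply, slopeX_add, slopeY_add]
  ring

theorem energy_sub_left (v v' w : Fin (2 * m) × (Fin n ⊕ Fin (n + 1)) → (Plane →ᵃ[ℝ] ℝ)) :
    energy n m (v - v') w = energy n m v w - energy n m v' w := by
  unfold energy
  rw [← Finset.sum_sub_distrib]
  refine Finset.sum_congr rfl fun i _ => ?_
  simp only [Pi.sub_apply, slopeX_sub, slopeY_sub]
  ring

theorem energy_smul_left (c : ℝ)
    (v w : Fin (2 * m) × (Fin n ⊕ Fin (n + 1)) → (Plane →ᵃ[ℝ] ℝ)) :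
    energy n m (c • v) w = c * energy n m v w := by
  unfold energy
  rw [Finset.mul_sum]
  refine Finset.sum_congr rfl fun i _ => ?_
  simp only [Pi.smul_apply, slopeX_smul, slopeY_smul]
  ring

theorem energy_comm (v w : Fin (2 * m) × (Fin n ⊕ Fin (n + 1)) → (Plane →ᵃ[ℝ] ℝ)) :
    energy n m v w = energy n m w v := by
  unfold energy
  exact Finset.sum_congr rfl fun i _ => by ring

/-- The linear functional `(f, ·)`. -/
def loadFunctional (n m : ℕ) :
    (Fin (2 * m) × (Fin n ⊕ Fin (n + 1)) → (Plane →ᵃ[ℝ] ℝ)) →ₗ[ℝ] ℝ where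
  toFun w := load (babuskaAziz n m) modelF (pieces w)
  map_add' v w := by
    unfold load
    rw [← Finset.sum_add_distrib]
    refine Finset.sum_congr rfl fun i _ => ?_
    rw [← integral_add
      (integrableOn_mesh (f := fun z => modelF z * pieces v i z)
        (continuous_modelF.mul (continuous_affine (v i))) i)
      (integrableOn_mesh (f := fun z => modelF z * pieces w i z)
        (continuous_modelF.mul (continuous_affine (w i))) i)]
    congr 1
    ext z
    simp [pieces]
    ring
  map_smul' c w := by
    unfold load
    rw [RingHom.id_apply, smul_eq_mul, Finset.mul_sum]
    refine Finset.sum_congr rfl fun i _ => ?_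
    rw [← integral_const_mul]
    congr 1
    ext z
    simp [pieces]
    ring

/-- The energy form on the nonconforming P1 space. -/
def energyForm (hn : 1 ≤ n) (hm : 1 ≤ m) : crouzeixRaviartSubmodule hn hm →ₗ[ℝ]
    Module.Dual ℝ (crouzeixRaviartSubmodule hn hm) :=
  LinearMap.mk₂ ℝ (fun v w => energy n m v.1 w.1)
    (fun v v' w => energy_add_left v.1 v'.1 w.1) (fun c v w => energy_smul_left c v.1 w.1)
    (fun v w w' => by
      rw [energy_comm, energy_comm v.1 w.1, energy_comm v.1 w'.1]
      exact energy_add_left w.1 w'.1 v.1)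
    (fun c v w => by
      rw [energy_comm, energy_comm v.1 w.1]
      exact energy_smul_left c w.1 v.1)

/-- Definiteness gives injectivity, and the dual of a finite-dimensional space has the same
dimension. -/
theorem energyForm_bijective (hn : 1 ≤ n) (hm : 1 ≤ m) :
    Function.Bijective (energyForm hn hm) := by
  have hinj : Function.Injective (energyForm hn hm) := by
    rw [injective_iff_map_eq_zero]
    intro v hv
    obtain ⟨S, H, O, h⟩ := exists_hasNodalValues hn hm v.2
    have h1 : energy n m v.1 v.1 = 0 := LinearMap.congr_fun hv v
    exact Subtype.ext (eq_zero_of_energy_eq_zero hn hm h h1)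
  exact ⟨hinj, (LinearMap.injective_iff_surjective_of_finrank_eq_finrank
    Subspace.dual_finrank_eq.symm).1 hinj⟩

theorem existsUnique_isGalerkinSolution (hn : 1 ≤ n) (hm : 1 ≤ m) :
    ∃! v, IsGalerkinSolution (babuskaAziz n m) modelF v := by
  obtain ⟨v, hv, huniq⟩ := (energyForm_bijective hn hm).existsUnique
    ((loadFunctional n m).comp (crouzeixRaviartSubmodule hn hm).subtype)
  refine ⟨v.1, ⟨v.2, fun w hw => ?_⟩, fun v' hv' => ?_⟩
  · rw [brokenInner_pieces hn hm]
    exact LinearMap.congr_fun hv ⟨w, hw⟩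
  · have := huniq ⟨v', hv'.1⟩ (LinearMap.ext fun w => by
      have := hv'.2 w.1 w.2
      rwa [brokenInner_pieces hn hm] at this)
    exact congrArg Subtype.val this

end Galerkin

/-! ### Strang's lemma: from consistency to error bounds -/

section ErrorBounds

variable {n m : ℕ}

/-- The Cauchy-Schwarz inequality for `(u - v, w)`. -/
theorem abs_brokenInner_sub_energy_le (hn : 1 ≤ n) (hm : 1 ≤ m)
    (v w : Fin (2 * m) × (Fin n ⊕ Fin (n + 1)) → (Plane →ᵃ[ℝ] ℝ)) :
    |brokenInner (babuskaAziz n m) (fun _ => modelU) (pieces w) - energy n m v w| ≤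
      brokenError (babuskaAziz n m) modelU v * Real.sqrt (energy n m w w) := by
  set X := brokenInner (babuskaAziz n m) (fun _ => modelU) (pieces w) - energy n m v w with hX
  set E := ∑ i, ∫ p in triangle (babuskaAziz n m) i,
        ((modelUx p - slopeX (v i)) ^ 2 + (modelUy p - slopeY (v i)) ^ 2) with hE
  have hE0 : 0 ≤ E := Finset.sum_nonneg fun i _ =>
    integral_nonneg fun p => add_nonneg (sq_nonneg _) (sq_nonneg _)
  -- The quadratic polynomial is |u - v - t w|², so its discriminant is not positive.
  have key : ∀ t : ℝ, 0 ≤ energy n m w w * (t * t) + (-2 * X) * t + E := by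
    intro t
    have h1 : energy n m w w * (t * t) + (-2 * X) * t + E =
        ∑ i, ∫ p in triangle (babuskaAziz n m) i,
          ((modelUx p - slopeX (v i) - t * slopeX (w i)) ^ 2 +
            (modelUy p - slopeY (v i) - t * slopeY (w i)) ^ 2) := by
      rw [hX, brokenInner_modelU, hE]
      unfold energy
      rw [Finset.sum_mul, ← Finset.sum_sub_distrib, Finset.mul_sum, Finset.sum_mul,
        ← Finset.sum_add_distrib, ← Finset.sum_add_distrib]
      refine Finset.sum_congr rfl fun i _ => ?_
      have c1 := setIntegral_mesh_const hn hm i.1 i.2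
        ((slopeX (w i) * slopeX (w i) + slopeY (w i) * slopeY (w i)) * (t * t) +
          2 * t * (slopeX (v i) * slopeX (w i) + slopeY (v i) * slopeY (w i)))
      have c2 : ∫ p in triangle (babuskaAziz n m) i,
          ((modelUx p - slopeX (v i) - t * slopeX (w i)) ^ 2 +
            (modelUy p - slopeY (v i) - t * slopeY (w i)) ^ 2) =
          (∫ p in triangle (babuskaAziz n m) i,
            ((modelUx p - slopeX (v i)) ^ 2 + (modelUy p - slopeY (v i)) ^ 2)) +
          ((∫ p in triangle (babuskaAziz n m) i,
            (-2 * t) * (modelUx p * slopeX (w i) + modelUy p * slopeY (w i))) +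
          ∫ _ in triangle (babuskaAziz n m) i,
            ((slopeX (w i) * slopeX (w i) + slopeY (w i) * slopeY (w i)) * (t * t) +
          2 * t * (slopeX (v i) * slopeX (w i) + slopeY (v i) * slopeY (w i)))) := by
        have i1 := integrableOn_mesh (continuous_gradient_error (slopeX (v i)) (slopeY (v i))) i
        have i2 := integrableOn_mesh (f := fun p => (-2 * t) *
          (modelUx p * slopeX (w i) + modelUy p * slopeY (w i)))
          (continuous_const.mul (continuous_grad_modelU _ _)) i
        have i3 := integrableOn_mesh (f := fun _ =>
          ((slopeX (w i) * slopeX (w i) + slopeY (w i) * slopeY (w i)) * (t * t) +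
          2 * t * (slopeX (v i) * slopeX (w i) + slopeY (v i) * slopeY (w i))))
          continuous_const i
        have i4 := integrableOn_mesh (f := fun p => (-2 * t) *
          (modelUx p * slopeX (w i) + modelUy p * slopeY (w i)) +
          ((slopeX (w i) * slopeX (w i) + slopeY (w i) * slopeY (w i)) * (t * t) +
          2 * t * (slopeX (v i) * slopeX (w i) + slopeY (v i) * slopeY (w i))))
          ((continuous_const.mul (continuous_grad_modelU _ _)).add continuous_const) i
        rw [← integral_add i2 i3, ← integral_add i1 i4]
        congr 1
        ext p
        ring
      rw [c2, c1, integral_const_mul]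
      ring
    rw [h1]
    exact Finset.sum_nonneg fun i _ =>
      integral_nonneg fun p => add_nonneg (sq_nonneg _) (sq_nonneg _)
  have hd := discrim_le_zero key
  rw [brokenError_eq, ← hE, ← Real.sqrt_mul hE0]
  refine Real.abs_le_sqrt ?_
  unfold discrim at hd
  linarith

/-- Here n ≤ m enters: the approximation error is absorbed by the consistency bound. -/
theorem one_div_le_min (hn : 1 ≤ n) (hnm : n ≤ m) :
    1 / (n : ℝ) ≤ min 1 ((m : ℝ) / n ^ 2) := by
  have hn' : (1 : ℝ) ≤ n := by exact_mod_cast hn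
  have hnm' : (n : ℝ) ≤ m := by exact_mod_cast hnm
  refine le_min ?_ ?_
  · rw [div_le_one (by linarith)]
    exact hn'
  · rw [div_le_div_iff₀ (by linarith) (by positivity)]
    nlinarith

theorem brokenError_sq_le (hn : 1 ≤ n) (hm : 1 ≤ m)
    (u v : Fin (2 * m) × (Fin n ⊕ Fin (n + 1)) → (Plane →ᵃ[ℝ] ℝ)) :
    brokenError (babuskaAziz n m) modelU u ^ 2 ≤
      2 * brokenError (babuskaAziz n m) modelU v ^ 2 + 2 * energy n m (v - u) (v - u) := by
  have h0 : ∀ w : Fin (2 * m) × (Fin n ⊕ Fin (n + 1)) → (Plane →ᵃ[ℝ] ℝ),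
      0 ≤ ∑ i, ∫ p in triangle (babuskaAziz n m) i,
        ((modelUx p - slopeX (w i)) ^ 2 + (modelUy p - slopeY (w i)) ^ 2) := fun w =>
    Finset.sum_nonneg fun i _ =>
      integral_nonneg fun p => add_nonneg (sq_nonneg _) (sq_nonneg _)
  rw [brokenError_eq, brokenError_eq, Real.sq_sqrt (h0 u), Real.sq_sqrt (h0 v)]
  unfold energy
  rw [Finset.mul_sum, Finset.mul_sum, ← Finset.sum_add_distrib]
  refine Finset.sum_le_sum fun i _ => ?_
  have c1 := setIntegral_mesh_const hn hm i.1 i.2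
    (2 * (slopeX ((v - u) i) * slopeX ((v - u) i) + slopeY ((v - u) i) * slopeY ((v - u) i)))
  have c2 : 2 * (area n m i.2 * (slopeX ((v - u) i) * slopeX ((v - u) i) +
      slopeY ((v - u) i) * slopeY ((v - u) i))) =
      area n m i.2 * (2 * (slopeX ((v - u) i) * slopeX ((v - u) i) +
        slopeY ((v - u) i) * slopeY ((v - u) i))) := by ring
  have i1 := integrableOn_mesh (continuous_gradient_error (slopeX (v i)) (slopeY (v i))) i
  have i2 := integrableOn_mesh (f := fun _ => 2 * (slopeX ((v - u) i) * slopeX ((v - u) i) +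
        slopeY ((v - u) i) * slopeY ((v - u) i))) continuous_const i
  rw [c2, ← c1, ← integral_const_mul, ← integral_add (i1.const_mul 2) i2]
  refine integral_mono (integrableOn_mesh (continuous_gradient_error _ _) i)
    ((i1.const_mul 2).add i2) fun p => ?_
  simp only [Pi.sub_apply, slopeX_sub, slopeY_sub]
  nlinarith [sq_nonneg ((modelUx p - slopeX (v i)) - (slopeX (v i) - slopeX (u i))),
    sq_nonneg ((modelUy p - slopeY (v i)) - (slopeY (v i) - slopeY (u i)))]

/-- The upper bound for the Galerkin error. -/
theorem IsGalerkinSolution.brokenError_le (hn : 1 ≤ n) (hnm : n ≤ m)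
    {u : Fin (2 * m) × (Fin n ⊕ Fin (n + 1)) → (Plane →ᵃ[ℝ] ℝ)}
    (hu : IsGalerkinSolution (babuskaAziz n m) modelF u) :
    brokenError (babuskaAziz n m) modelU u ≤ 145 * min 1 ((m : ℝ) / n ^ 2) := by
  have hm : 1 ≤ m := hn.trans hnm
  obtain ⟨S, H, O, hv⟩ := exists_hasNodalValues_approximant hn hm
  set v := approximant n m
  have hmem : v - u ∈ crouzeixRaviart (babuskaAziz n m) :=
    (crouzeixRaviartSubmodule hn hm).sub_mem (hv.mem hn hm) hu.1
  obtain ⟨S', H', O', hd⟩ := exists_hasNodalValues hn hm hmem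
  have hmin := one_div_le_min hn hnm
  set μ := min 1 ((m : ℝ) / n ^ 2)
  have hv6 : brokenError (babuskaAziz n m) modelU v ≤ 6 * μ := by
    refine (brokenError_approximant_le hn hnm).trans ?_
    rw [div_eq_mul_one_div]
    linarith
  have hv0 : 0 ≤ brokenError (babuskaAziz n m) modelU v := Real.sqrt_nonneg _
  have hN := energy_self_nonneg hn hm (v - u)
  -- By the Galerkin equation, |v - u|² is the consistency functional at v - u, minus the product of
  -- the approximation error with v - u; hence 102 = 96 + 6.
  have h1 : energy n m (v - u) (v - u) ≤ 102 * μ * Real.sqrt (energy n m (v - u) (v - u)) := by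
    have h2 := hu.2 _ hmem
    rw [brokenInner_pieces hn hm] at h2
    have h3 := abs_brokenInner_sub_energy_le hn hm v (v - u)
    have h4 := abs_consistency_le hn hnm hd
    have h5 : energy n m (v - u) (v - u) = consistency n m (v - u) -
        (brokenInner (babuskaAziz n m) (fun _ => modelU) (pieces (v - u)) -
          energy n m v (v - u)) := by
      rw [consistency, ← h2]
      conv_lhs => rw [energy_sub_left]
      ring
    have h6 := mul_le_mul_of_nonneg_right hv6 (Real.sqrt_nonneg (energy n m (v - u) (v - u)))
    have h7 := le_abs_self (consistency n m (v - u))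
    have h8 := neg_abs_le (brokenInner (babuskaAziz n m) (fun _ => modelU) (pieces (v - u)) -
          energy n m v (v - u))
    conv_lhs => rw [h5]
    linarith
  have hμ : 0 ≤ μ := le_trans (by positivity) hmin
  have h2 : Real.sqrt (energy n m (v - u) (v - u)) ≤ 102 * μ := by
    rcases (Real.sqrt_nonneg (energy n m (v - u) (v - u))).eq_or_lt with h | h
    · rw [← h]
      positivity
    · refine le_of_mul_le_mul_right ?_ h
      rw [Real.mul_self_sqrt hN]
      exact h1
  have h3 : energy n m (v - u) (v - u) ≤ (102 * μ) ^ 2 := (Real.sqrt_le_left (by positivity)).1 h2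
  have h4 := brokenError_sq_le hn hm u v
  have h5 := pow_le_pow_left₀ hv0 hv6 2
  -- 2 · 6² + 2 · 102² = 20880 ≤ 145².
  refine abs_le_of_sq_le_sq' ?_ (by positivity) |>.2
  nlinarith [sq_nonneg μ]

theorem consistencyError_le (hn : 1 ≤ n) (hnm : n ≤ m) :
    consistencyError (babuskaAziz n m) modelU modelF ≤ 96 * min 1 ((m : ℝ) / n ^ 2) := by
  have hm : 1 ≤ m := hn.trans hnm
  -- Nonnegativity of the bound covers an empty set of test functions, whose supremum is 0 by
  -- convention.
  refine Real.sSup_le ?_ (by positivity)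
  rintro _ ⟨w, hw, hw1, rfl⟩
  obtain ⟨S, H, O, h⟩ := exists_hasNodalValues hn hm hw
  have h1 := abs_consistency_le hn hnm h
  rw [← brokenNorm_pieces hn hm, hw1, mul_one] at h1
  exact h1

theorem consistency_smul (c : ℝ)
    (w : Fin (2 * m) × (Fin n ⊕ Fin (n + 1)) → (Plane →ᵃ[ℝ] ℝ)) :
    consistency n m (c • w) = c * consistency n m w := by
  have h1 : load (babuskaAziz n m) modelF (pieces (c • w)) =
      c * load (babuskaAziz n m) modelF (pieces w) := (loadFunctional n m).map_smul c w
  have h2 : brokenInner (babuskaAziz n m) (fun _ => modelU) (pieces (c • w)) =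
      c * brokenInner (babuskaAziz n m) (fun _ => modelU) (pieces w) := by
    rw [brokenInner_modelU, brokenInner_modelU, Finset.mul_sum]
    refine Finset.sum_congr rfl fun i _ => ?_
    rw [← integral_const_mul]
    congr 1
    ext p
    simp only [Pi.smul_apply, slopeX_smul, slopeY_smul]
    ring
  unfold consistency
  rw [h1, h2]
  ring

/-- Test functions give lower bounds for the consistency error. -/
theorem abs_consistency_le_consistencyError_mul (hn : 1 ≤ n) (hnm : n ≤ m)
    {w : Fin (2 * m) × (Fin n ⊕ Fin (n + 1)) → (Plane →ᵃ[ℝ] ℝ)}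
    (hw : w ∈ crouzeixRaviart (babuskaAziz n m)) :
    |consistency n m w| ≤ consistencyError (babuskaAziz n m) modelU modelF *
      Real.sqrt (energy n m w w) := by
  have hm : 1 ≤ m := hn.trans hnm
  set N := Real.sqrt (energy n m w w) with hNdef
  -- A function of norm zero cannot be normalised, but the upper bound shows that the functional
  -- vanishes on it.
  rcases (Real.sqrt_nonneg (energy n m w w)).eq_or_lt with h | h
  · obtain ⟨S, H, O, hw'⟩ := exists_hasNodalValues hn hm hw
    have := abs_consistency_le hn hnm hw'
    rw [← h, mul_zero] at this
    rw [hNdef, ← h, mul_zero]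
    exact this
  · rw [← hNdef] at h
    have hmem : N⁻¹ • w ∈ crouzeixRaviart (babuskaAziz n m) :=
      (crouzeixRaviartSubmodule hn hm).smul_mem _ hw
    have h1 : brokenNorm (babuskaAziz n m) (pieces (N⁻¹ • w)) = 1 := by
      rw [brokenNorm_pieces hn hm, energy_smul_left, energy_comm, energy_smul_left, ← mul_assoc,
        Real.sqrt_mul (by positivity), ← hNdef, Real.sqrt_mul_self (by positivity),
        inv_mul_cancel₀ h.ne']
    have h2 : |consistency n m (N⁻¹ • w)| ≤
        consistencyError (babuskaAziz n m) modelU modelF := by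
      refine le_csSup ⟨96 * min 1 ((m : ℝ) / n ^ 2), ?_⟩ ?_
      · rintro _ ⟨w', hw', hw1, rfl⟩
        obtain ⟨S, H, O, h'⟩ := exists_hasNodalValues hn hm hw'
        have h1 := abs_consistency_le hn hnm h'
        rw [← brokenNorm_pieces hn hm, hw1, mul_one] at h1
        exact h1
      · exact ⟨_, hmem, h1, rfl⟩
    rw [consistency_smul, abs_mul, abs_of_pos (inv_pos.2 h), inv_mul_le_iff₀ h] at h2
    linarith

/-- The Galerkin error dominates the consistency functional. -/
theorem IsGalerkinSolution.abs_consistency_le (hn : 1 ≤ n) (hm : 1 ≤ m)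
    {u w : Fin (2 * m) × (Fin n ⊕ Fin (n + 1)) → (Plane →ᵃ[ℝ] ℝ)}
    (hu : IsGalerkinSolution (babuskaAziz n m) modelF u)
    (hw : w ∈ crouzeixRaviart (babuskaAziz n m)) :
    |consistency n m w| ≤ brokenError (babuskaAziz n m) modelU u *
      Real.sqrt (energy n m w w) := by
  rw [consistency, ← hu.2 w hw, brokenInner_pieces hn hm]
  exact abs_brokenInner_sub_energy_le hn hm u w

end ErrorBounds

/-! ### Edge defects of an isosceles triangle -/

section IsoscelesTriangle

/-- The sum of the edge defects of an isosceles triangle with orientation `ε`, half base `h`, height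
`d` and midline centre `(x, y)` for the affine function that vanishes at the midpoint of the base
and that has the slopes `ε * σ / 2` and `h * δ / (2 * d)`. -/
def isoscelesDefect (h d x y ε σ δ : ℝ) : ℝ :=
  -σ * (1 - 2 * x) * (1 - 2 * y) * (h ^ 3 / 4 + h * d ^ 2 / 12) -
    σ * ε * h ^ 3 * d * (1 - 2 * x) / 4 + δ * (1 - 2 * y) * h ^ 2 * (h ^ 2 - d ^ 2) / 12 +
    δ * ε * h ^ 2 * d * (y * (1 - y) - x * (1 - x)) / 6 - δ * ε * h ^ 2 * d ^ 3 / 40 +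
    δ * ε * h ^ 4 * d / 15

/-- The x-slope carries the factor ε, which cancels against the orientation in the leading term:
upward and downward triangles contribute to it with the same sign. -/
theorem edgeDefect_isosceles {h d x y ε σ δ : ℝ} (hd : d ≠ 0) (hε : ε = 1 ∨ ε = -1) :
    ε * (edgeDefect (ε * σ / 2) (h * δ / (2 * d)) (x - h, y - ε * d / 2) (x + h, y - ε * d / 2) +
      edgeDefect (ε * σ / 2) (h * δ / (2 * d)) (x + h, y - ε * d / 2) (x, y + ε * d / 2) +
      edgeDefect (ε * σ / 2) (h * δ / (2 * d)) (x, y + ε * d / 2) (x - h, y - ε * d / 2)) =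
    isoscelesDefect h d x y ε σ δ := by
  unfold edgeDefect isoscelesDefect
  rcases hε with rfl | rfl
  · field_simp
    ring
  · field_simp
    ring

/-- All terms but the first carry an additional factor d, or a factor δ ≤ h together with h⁴, and so
are small compared with the h³ in the leading term. -/
theorem abs_isoscelesDefect_add_le {h d x y ε σ δ : ℝ} (hd : 0 ≤ d) (hdh : d ≤ h) (h1 : h ≤ 1)
    (hx : x ∈ Set.Icc (0 : ℝ) 1) (hy : y ∈ Set.Icc (0 : ℝ) 1) (hε : |ε| = 1) (hσ : |σ| ≤ 1)
    (hδ : |δ| ≤ h) :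
    |isoscelesDefect h d x y ε σ δ +
        σ * (1 - 2 * x) * (1 - 2 * y) * (h ^ 3 / 4 + h * d ^ 2 / 12)| ≤
      h ^ 3 * d / 2 + h ^ 5 / 12 := by
  have h0 : 0 ≤ h := hd.trans hdh
  have ax : |1 - 2 * x| ≤ 1 := abs_le.2 ⟨by linarith [hx.2], by linarith [hx.1]⟩
  have ay : |1 - 2 * y| ≤ 1 := abs_le.2 ⟨by linarith [hy.2], by linarith [hy.1]⟩
  have axy : |y * (1 - y) - x * (1 - x)| ≤ 1 :=
    (abs_mul_one_sub_sub_le hy hx).trans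
      (abs_le.2 ⟨by linarith [hx.2, hy.1], by linarith [hx.1, hy.2]⟩)
  have ahd : |h ^ 2 - d ^ 2| ≤ h ^ 2 := abs_le.2 ⟨by nlinarith, by nlinarith⟩
  have hh : h ^ 2 ≤ 1 := by nlinarith
  have hdd : d ^ 2 ≤ 1 := by nlinarith
  have e1 : |σ * ε * h ^ 3 * d * (1 - 2 * x) / 4| ≤ h ^ 3 * d / 4 := by
    rw [abs_div, abs_mul, abs_mul, abs_mul, abs_mul, hε, abs_of_nonneg hd,
      abs_of_nonneg (by positivity : 0 ≤ h ^ 3), abs_of_pos (by norm_num : (0 : ℝ) < 4)]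
    refine div_le_div_of_nonneg_right ?_ (by norm_num)
    calc |σ| * 1 * h ^ 3 * d * |1 - 2 * x| ≤ 1 * 1 * h ^ 3 * d * 1 := by gcongr
      _ = h ^ 3 * d := by ring
  have e2 : |δ * (1 - 2 * y) * h ^ 2 * (h ^ 2 - d ^ 2) / 12| ≤ h ^ 5 / 12 := by
    rw [abs_div, abs_mul, abs_mul, abs_mul, abs_of_nonneg (by positivity : 0 ≤ h ^ 2),
      abs_of_pos (by norm_num : (0 : ℝ) < 12)]
    gcongr
    calc |δ| * |1 - 2 * y| * h ^ 2 * |h ^ 2 - d ^ 2| ≤ h * 1 * h ^ 2 * h ^ 2 := by gcongr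
      _ = h ^ 5 := by ring
  have e3 : |δ * ε * h ^ 2 * d * (y * (1 - y) - x * (1 - x)) / 6| ≤ h ^ 3 * d / 6 := by
    rw [abs_div, abs_mul, abs_mul, abs_mul, abs_mul, hε, abs_of_nonneg hd,
      abs_of_nonneg (by positivity : 0 ≤ h ^ 2), abs_of_pos (by norm_num : (0 : ℝ) < 6)]
    refine div_le_div_of_nonneg_right ?_ (by norm_num)
    calc |δ| * 1 * h ^ 2 * d * |y * (1 - y) - x * (1 - x)| ≤ h * 1 * h ^ 2 * d * 1 := by gcongr
      _ = h ^ 3 * d := by ring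
  have e4 : |δ * ε * h ^ 2 * d ^ 3 / 40 - δ * ε * h ^ 4 * d / 15| ≤ h ^ 3 * d / 15 := by
    rw [show δ * ε * h ^ 2 * d ^ 3 / 40 - δ * ε * h ^ 4 * d / 15 =
      δ * ε * h ^ 2 * d * ((d ^ 2 / 40 * 15 - h ^ 2) / 15) by ring, abs_mul, abs_mul, abs_mul,
      abs_mul, hε, abs_of_nonneg hd, abs_of_nonneg (by positivity : 0 ≤ h ^ 2)]
    have : |(d ^ 2 / 40 * 15 - h ^ 2) / 15| ≤ 1 / 15 :=
      abs_le.2 ⟨by linarith [sq_nonneg d], by linarith [sq_nonneg h]⟩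
    calc |δ| * 1 * h ^ 2 * d * |(d ^ 2 / 40 * 15 - h ^ 2) / 15| ≤
          h * 1 * h ^ 2 * d * (1 / 15) := by gcongr
      _ = h ^ 3 * d / 15 := by ring
  -- Needed because 1/4 + 1/6 + 1/15 is rounded up to 1/2.
  have e5 : 0 ≤ h ^ 3 * d := by positivity
  unfold isoscelesDefect
  rw [abs_le] at e1 e2 e3 e4 ⊢
  constructor <;> linarith [e1.1, e1.2, e2.1, e2.2, e3.1, e3.2, e4.1, e4.2]

end IsoscelesTriangle

/-! ### The oscillating test function -/

section OscillatingFunction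

variable {n m : ℕ}

/-- The amplitude of the oscillation along a strip. -/
def amplitude (n i : ℕ) : ℝ :=
  if i = 0 ∨ i = 2 * n + 1 then 0 else
    ((i : ℝ) - 1) * (2 * n - i) * (2 * n + 1 - 2 * i) / (2 * n) ^ 3

/-- The ordinate of the midline of a strip. -/
def midlineY (m j : ℕ) : ℝ := (2 * j + 1) / (4 * m)

/-- The oscillating values at the nodes on the midlines. -/
def oscillatingNodes (n m j i : ℕ) : ℝ :=
  (-1) ^ (j + i) * (amplitude n i * (1 - 2 * midlineY m j) / (4 * n))

/-- The function that oscillates along the strips and vanishes at the horizontal midpoints. -/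
def oscillating (n m : ℕ) : Fin (2 * m) × (Fin n ⊕ Fin (n + 1)) → (Plane →ᵃ[ℝ] ℝ) :=
  nodalFunction n m (oscillatingNodes n m) 0 0

theorem hasNodalValues_oscillating (hn : 1 ≤ n) (hm : 1 ≤ m) :
    HasNodalValues n m (oscillating n m) (oscillatingNodes n m) 0 0 :=
  hasNodalValues_nodalFunction hn hm (fun j => by simp [oscillatingNodes, amplitude])
    (fun j => by simp [oscillatingNodes, amplitude]) (fun _ => rfl) (fun _ => rfl)

/-- The position of a triangle in its strip, counted from the left. -/
def column : Fin n ⊕ Fin (n + 1) → ℕ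
  | Sum.inl a => 2 * a + 1
  | Sum.inr a => 2 * a

theorem orient_eq_column (j : ℕ) (s : Fin n ⊕ Fin (n + 1)) :
    orient n j s = -(-1) ^ (j + column s) := by
  rcases s with a | a <;> simp [orient, column, pow_add, pow_mul]

theorem column_le (s : Fin n ⊕ Fin (n + 1)) : column s ≤ 2 * n := by
  rcases s with a | a <;> have := a.2 <;> simp only [column] <;> omega

theorem sum_column (f : ℕ → ℝ) :
    ∑ s : Fin n ⊕ Fin (n + 1), f (column s) = ∑ c ∈ Finset.range (2 * n + 1), f c := by
  rw [sum_range_two_mul_add_one, Fintype.sum_sum_type, Finset.sum_range, Finset.sum_range]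
  rfl

theorem vertices_eq_column (s : Fin n ⊕ Fin (n + 1)) (h0 : column s ≠ 0)
    (h1 : column s ≠ 2 * n) :
    baseLeft s = column s / (2 * n) - 1 / (2 * n) ∧
      baseRight s = column s / (2 * n) + 1 / (2 * n) ∧ apexX s = column s / (2 * n) := by
  rcases s with a | a
  · simp only [baseLeft, baseRight, apexX, vertexX, column, Matrix.cons_val]
    push_cast
    exact ⟨by ring, by ring, trivial⟩
  · have := a.2
    simp only [column] at h0 h1
    simp only [baseLeft, baseRight, apexX, vertexX, column, Matrix.cons_val]
    rw [min_eq_left (by omega), Nat.cast_sub (by omega)]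
    push_cast
    exact ⟨by ring, by ring, trivial⟩

theorem oscillating_eq (j : Fin (2 * m)) (s : Fin n ⊕ Fin (n + 1)) :
    oscillating n m (j, s) = affineOfMidpoints (baseLeft s) (baseRight s) (apexX s) (baseY m j s)
      (apexY m j s) (oscillatingNodes n m j (column s + 1)) (oscillatingNodes n m j (column s))
      0 := by
  rcases s with a | a <;> rfl

/-- The sum of the amplitudes at both ends of the midline of a triangle. -/
def amplitudeSum (n c : ℕ) : ℝ := amplitude n c + amplitude n (c + 1)

/-- The difference of the amplitudes at both ends of the midline of a triangle. -/
def amplitudeDiff (n c : ℕ) : ℝ := amplitude n (c + 1) - amplitude n c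

/-- The amplitude, a discrete version of x(1 - x)(1 - 2x), vanishes at both nodes of the
right-angled triangles at the sides. The test function is zero there, and only isosceles triangles
matter. -/
theorem amplitude_eq_zero {i : ℕ} (hi : i = 0 ∨ i = 1 ∨ i = 2 * n ∨ i = 2 * n + 1) :
    amplitude n i = 0 := by
  unfold amplitude
  split_ifs with h
  · rfl
  · rcases hi with h | h | h | h
    · exact absurd (Or.inl h) ‹_›
    · rw [h]
      simp
    · rw [h]
      simp
    · exact absurd (Or.inr h) ‹_›

/-- Because of the alternating sign the difference of neighbouring nodal values involves the sum of
the amplitudes, and their mean involves the difference. Thus the x-slope is of order 1, and the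
y-slope only of order m/n². -/
theorem slopes_oscillating (hn : 1 ≤ n) (hm : 1 ≤ m) (j : Fin (2 * m))
    (s : Fin n ⊕ Fin (n + 1)) :
    slopeX (oscillating n m (j, s)) =
        orient n j s * (amplitudeSum n (column s) * (1 - 2 * midlineY m j)) / 2 ∧
      slopeY (oscillating n m (j, s)) = 1 / (2 * n) *
        (amplitudeDiff n (column s) * (1 - 2 * midlineY m j)) / (2 * (1 / (2 * m))) := by
  have hn' : (0 : ℝ) < n := by positivity
  have hm' : (0 : ℝ) < m := by positivity
  rw [oscillating_eq]
  unfold affineOfMidpoints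
  rw [slopeX_affineOfCoeffs, slopeY_affineOfCoeffs]
  unfold amplitudeSum amplitudeDiff
  by_cases h : column s = 0 ∨ column s = 2 * n
  · have e1 : amplitude n (column s) = 0 := amplitude_eq_zero (by omega)
    have e2 : amplitude n (column s + 1) = 0 := amplitude_eq_zero (by omega)
    simp [oscillatingNodes, e1, e2]
  · obtain ⟨e1, e2, e3⟩ := vertices_eq_column s (fun h' => h (Or.inl h')) (fun h' => h (Or.inr h'))
    rw [apexY_sub_baseY, e1, e2, e3, orient_eq_column]
    unfold oscillatingNodes
    rw [← add_assoc, pow_succ]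
    rcases neg_one_pow_eq_or ℝ ((j : ℕ) + column s) with h' | h' <;> rw [h'] <;>
      constructor <;> field_simp <;> ring

theorem orient_mul_triangleDefect_oscillating (hn : 1 ≤ n) (hm : 1 ≤ m) (j : Fin (2 * m))
    (s : Fin n ⊕ Fin (n + 1)) :
    orient n j s * triangleDefect m j s (slopeX (oscillating n m (j, s)))
        (slopeY (oscillating n m (j, s))) =
      isoscelesDefect (1 / (2 * n)) (1 / (2 * m)) (column s / (2 * n)) (midlineY m j)
        (orient n j s) (amplitudeSum n (column s) * (1 - 2 * midlineY m j))
        (amplitudeDiff n (column s) * (1 - 2 * midlineY m j)) := by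
  have hm' : (0 : ℝ) < m := by positivity
  obtain ⟨hX, hY⟩ := slopes_oscillating hn hm j s
  by_cases h : column s = 0 ∨ column s = 2 * n
  · have e1 : amplitude n (column s) = 0 := amplitude_eq_zero (by omega)
    have e2 : amplitude n (column s + 1) = 0 := amplitude_eq_zero (by omega)
    rw [hX, hY]
    simp [amplitudeSum, amplitudeDiff, e1, e2, triangleDefect, edgeDefect, isoscelesDefect]
  · obtain ⟨e1, e2, e3⟩ := vertices_eq_column s (fun h' => h (Or.inl h')) (fun h' => h (Or.inr h'))
    have hb := midpoint_baseY_apexY hm j s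
    have he := apexY_sub_baseY (n := n) (m := m) j s
    have b1 : baseY m j s = midlineY m j - orient n j s * (1 / (2 * m)) / 2 := by
      unfold midlineY
      rw [mul_one_div]
      linarith
    have b2 : apexY m j s = midlineY m j + orient n j s * (1 / (2 * m)) / 2 := by
      unfold midlineY
      rw [mul_one_div]
      linarith
    rw [← edgeDefect_isosceles (one_div_pos.2 (by positivity : (0 : ℝ) < 2 * m)).ne'
      (eq_or_eq_neg_of_abs_eq (abs_orient j s)), ← hX, ← hY, triangleDefect, e1, e2, e3, b1, b2]

theorem midlineY_mem (j : Fin (2 * m)) : midlineY m j ∈ Set.Icc (0 : ℝ) 1 := by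
  have hj : (j : ℝ) + 1 ≤ 2 * m := by exact_mod_cast j.2
  have hj0 : (0 : ℝ) ≤ j := Nat.cast_nonneg _
  unfold midlineY
  refine ⟨by positivity, ?_⟩
  rw [div_le_one (by linarith)]
  linarith

theorem abs_one_sub_two_mul_midlineY (j : Fin (2 * m)) : |1 - 2 * midlineY m j| ≤ 1 :=
  abs_le.2 ⟨by linarith [(midlineY_mem j).2], by linarith [(midlineY_mem j).1]⟩

theorem abs_amplitude_le (hn : 1 ≤ n) {i : ℕ} (hi : i ≤ 2 * n + 1) : |amplitude n i| ≤ 1 / 2 := by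
  unfold amplitude
  split_ifs with h
  · simp
  · push Not at h
    have hn' : (1 : ℝ) ≤ n := by exact_mod_cast hn
    have h1 : (1 : ℝ) ≤ i := by exact_mod_cast Nat.one_le_iff_ne_zero.2 h.1
    have h2 : (i : ℝ) ≤ 2 * n := by exact_mod_cast (show i ≤ 2 * n by omega)
    rw [abs_div, abs_of_pos (by positivity : (0 : ℝ) < (2 * n) ^ 3), div_le_iff₀ (by positivity),
      abs_mul]
    have a1 : |((i : ℝ) - 1) * (2 * n - i)| ≤ (2 * n) ^ 2 / 2 := by
      rw [abs_of_nonneg (mul_nonneg (by linarith) (by linarith))]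
      nlinarith [sq_nonneg ((i : ℝ) - n)]
    have a2 : |(2 * n + 1 - 2 * i : ℝ)| ≤ 2 * n := abs_le.2 ⟨by linarith, by linarith⟩
    calc |((i : ℝ) - 1) * (2 * n - i)| * |(2 * n + 1 - 2 * i : ℝ)| ≤
        (2 * n) ^ 2 / 2 * (2 * n) := by gcongr
      _ = 1 / 2 * (2 * n) ^ 3 := by ring

theorem abs_amplitudeSum_le (hn : 1 ≤ n) {c : ℕ} (hc : c ≤ 2 * n) : |amplitudeSum n c| ≤ 1 :=
  (abs_add_le _ _).trans (by
    linarith [abs_amplitude_le hn (show c ≤ 2 * n + 1 by omega),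
      abs_amplitude_le hn (show c + 1 ≤ 2 * n + 1 by omega)])

theorem amplitude_of_mem {i : ℕ} (h1 : 1 ≤ i) (h2 : i ≤ 2 * n) : amplitude n i =
    ((i : ℝ) - 1) * (2 * n - i) * (2 * n + 1 - 2 * i) / (2 * n) ^ 3 :=
  if_neg (by omega)

theorem abs_amplitudeDiff_le (hn : 1 ≤ n) {c : ℕ} (hc : c ≤ 2 * n) :
    |amplitudeDiff n c| ≤ 1 / (2 * n) := by
  have hn' : (1 : ℝ) ≤ n := by exact_mod_cast hn
  unfold amplitudeDiff
  by_cases h : c = 0 ∨ c = 2 * n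
  · rw [amplitude_eq_zero (i := c) (by omega), amplitude_eq_zero (i := c + 1) (by omega)]
    simp
  · push Not at h
    have h1 : (1 : ℝ) ≤ c := by exact_mod_cast Nat.one_le_iff_ne_zero.2 h.1
    have h2 : (c : ℝ) + 1 ≤ 2 * n := by exact_mod_cast (show c + 1 ≤ 2 * n by omega)
    rw [amplitude_of_mem (i := c) (by omega) (by omega), amplitude_of_mem (by omega) (by omega),
      ← sub_div, abs_div, abs_of_pos (by positivity : (0 : ℝ) < (2 * n) ^ 3),
      div_le_div_iff₀ (by positivity) (by positivity)]
    push_cast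
    -- Discrete counterpart of the bound 1 for the derivative 1 - 6x + 6x² of x(1 - x)(1 - 2x) on
    -- [0, 1].
    have key : |((c : ℝ) + 1 - 1) * (2 * n - (c + 1)) * (2 * n + 1 - 2 * (c + 1)) -
        (c - 1) * (2 * n - c) * (2 * n + 1 - 2 * c)| ≤ (2 * n) ^ 2 := by
      generalize (n : ℝ) = N at *
      generalize (c : ℝ) = x at *
      rw [abs_le]
      constructor
      · nlinarith [sq_nonneg (x - N)]
      · nlinarith [mul_nonneg (sub_nonneg.2 h1) (sub_nonneg.2 h2)]
    calc _ ≤ (2 * n : ℝ) ^ 2 * (2 * n) := by gcongr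
      _ = _ := by ring

end OscillatingFunction

/-! ### Size of the consistency functional on the test function -/

section MainTerm

variable {n m : ℕ}

theorem sum_range_amplitude_aux (A : ℝ) (k : ℕ) :
    ∑ t ∈ Finset.range k, ((t : ℝ) * (A - t) * (A - 2 * t) +
        (t + 1) * (A - (t + 1)) * (A - 2 * (t + 1))) * (A - 1 - 2 * t) =
      4 / 15 * k - 2 / 3 * k * A ^ 2 + k ^ 2 * A + k ^ 2 * A ^ 3 - 2 / 3 * k ^ 3 -
        10 / 3 * k ^ 3 * A ^ 2 + 4 * k ^ 4 * A - 8 / 5 * k ^ 5 := by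
  induction k with
  | zero => simp
  | succ k ih =>
    rw [Finset.sum_range_succ, ih]
    push_cast
    ring

/-- The amplitude has the sign of the weight 1 - 2x, up to the discrete shift. With k = 2n - 1 the
sum is (k-2)(k-1)k(k+1)(k+2) / (15(k+1)⁴), and n ≥ 6 gives k - 2 ≥ 3(k+1)/4. -/
theorem le_sum_amplitudeSum (hn : 6 ≤ n) : (n : ℝ) / 30 ≤
    ∑ c ∈ Finset.range (2 * n + 1), amplitudeSum n c * (1 - 2 * (c / (2 * n))) := by
  obtain ⟨k, hk⟩ : ∃ k, 2 * n = k + 1 := ⟨2 * n - 1, by omega⟩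
  have hk11 : (11 : ℝ) ≤ k := by exact_mod_cast (show 11 ≤ k by omega)
  have hkR : (2 * n : ℝ) = k + 1 := by exact_mod_cast hk
  have e0 : amplitudeSum n 0 = 0 := by
    rw [amplitudeSum, amplitude_eq_zero (by omega), amplitude_eq_zero (by omega), add_zero]
  have e1 : amplitudeSum n (2 * n) = 0 := by
    rw [amplitudeSum, amplitude_eq_zero (by omega), amplitude_eq_zero (by omega), add_zero]
  rw [Finset.sum_range_succ, e1, zero_mul, add_zero]
  rw [hk, Finset.sum_range_succ', e0, zero_mul, add_zero]
  have e2 : ∀ t ∈ Finset.range k,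
      amplitudeSum n (t + 1) * (1 - 2 * (((t + 1 : ℕ) : ℝ) / (2 * n))) =
      (((t : ℝ) * (k - t) * (k - 2 * t) +
        (t + 1) * (k - (t + 1)) * (k - 2 * (t + 1))) * (k - 1 - 2 * t)) * (1 / (k + 1) ^ 4) := by
    intro t ht
    have ht := Finset.mem_range.1 ht
    rw [amplitudeSum, amplitude_of_mem (by omega) (by omega),
      amplitude_of_mem (by omega) (by omega), hkR]
    push_cast
    field_simp
    ring
  rw [Finset.sum_congr rfl e2, ← Finset.sum_mul, sum_range_amplitude_aux, mul_one_div,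
    le_div_iff₀ (by positivity), show (n : ℝ) = (k + 1) / 2 by linarith]
  have h1 : 3 / 4 * ((k : ℝ) + 1) ≤ k - 2 := by linarith
  have h2 : (3 / 4 * ((k : ℝ) + 1)) * (3 / 4 * (k + 1)) * (3 / 4 * (k + 1)) * (k + 1) * (k + 1) ≤
      (k - 2) * (k - 1) * k * (k + 1) * (k + 2) := by
    have a2 := mul_nonneg (by linarith : (0 : ℝ) ≤ k - 2) (by linarith : (0 : ℝ) ≤ k - 1)
    have a3 := mul_nonneg a2 (by linarith : (0 : ℝ) ≤ k)
    gcongr <;> linarith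
  have h3 : (0 : ℝ) ≤ (k + 1) ^ 5 := by positivity
  linarith

theorem sum_range_sq_aux (M : ℝ) (k : ℕ) :
    ∑ j ∈ Finset.range k, (M - (2 * j + 1)) ^ 2 =
      k * M ^ 2 - 2 * k ^ 2 * M + k * (4 * k ^ 2 - 1) / 3 := by
  induction k with
  | zero => simp
  | succ k ih =>
    rw [Finset.sum_range_succ, ih]
    push_cast
    ring

theorem le_sum_midlineY (hm : 1 ≤ m) :
    (m : ℝ) / 2 ≤ ∑ j : Fin (2 * m), (1 - 2 * midlineY m j) ^ 2 := by
  have hm' : (1 : ℝ) ≤ m := by exact_mod_cast hm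
  have h1 : ∀ j : ℕ, (1 - 2 * midlineY m j) ^ 2 =
      ((2 * m : ℝ) - (2 * j + 1)) ^ 2 * (1 / (2 * m) ^ 2) := by
    intro j
    unfold midlineY
    field_simp
    ring
  simp only [h1]
  rw [← Finset.sum_mul, ← Finset.sum_range (fun j => ((2 * m : ℝ) - (2 * j + 1)) ^ 2),
    sum_range_sq_aux, mul_one_div, le_div_iff₀ (by positivity)]
  push_cast
  nlinarith [mul_nonneg (by linarith : (0 : ℝ) ≤ m) (by nlinarith : (0 : ℝ) ≤ (m : ℝ) ^ 2 - 1)]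

/-- The leading defects sum to a product over rows and columns of size at least m/(1920 n²), with h³
from each of about 4nm triangles. The other terms cost at most half of it once n ≥ 2000. -/
theorem le_abs_consistency_oscillating (hn : 2000 ≤ n) (hnm : n ≤ m) :
    (m : ℝ) / n ^ 2 / 3840 ≤ |consistency n m (oscillating n m)| := by
  have hn1 : 1 ≤ n := by omega
  have hm : 1 ≤ m := by omega
  have hn' : (2000 : ℝ) ≤ n := by exact_mod_cast hn
  have hnm' : (n : ℝ) ≤ m := by exact_mod_cast hnm
  set h : ℝ := 1 / (2 * n) with hh
  set d : ℝ := 1 / (2 * m) with hd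
  have hd0 : 0 < d := by positivity
  have hdh : d ≤ h := one_div_le_one_div_of_le (by positivity) (by linarith)
  have hhs : h ≤ 1 / 4000 := one_div_le_one_div_of_le (by norm_num) (by linarith)
  have hh0 : 0 < h := hd0.trans_le hdh
  set κ : ℝ := h ^ 3 / 4 + h * d ^ 2 / 12 with hκ
  set main := ∑ j : Fin (2 * m), ∑ c ∈ Finset.range (2 * n + 1),
    amplitudeSum n c * (1 - 2 * midlineY m j) * (1 - 2 * (c / (2 * n))) *
      (1 - 2 * midlineY m j) * κ with hmain
  have h1 : |consistency n m (oscillating n m) + main| ≤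
      (2 * m) * ((2 * n + 1) * (h ^ 3 * d / 2 + h ^ 5 / 12)) := by
    rw [consistency_eq_sum_defect hn1 hm (hasNodalValues_oscillating hn1 hm),
      Fintype.sum_prod_type, hmain, ← Finset.sum_add_distrib]
    refine (Finset.abs_sum_le_sum_abs _ _).trans ((Finset.sum_le_card_nsmul _ _
      ((2 * n + 1) * (h ^ 3 * d / 2 + h ^ 5 / 12)) fun j _ => ?_).trans_eq ?_)
    · rw [← sum_column (n := n) (fun c => amplitudeSum n c * (1 - 2 * midlineY m j) *
        (1 - 2 * (c / (2 * n))) * (1 - 2 * midlineY m j) * κ), ← Finset.sum_add_distrib]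
      refine (Finset.abs_sum_le_sum_abs _ _).trans ((Finset.sum_le_card_nsmul _ _
        (h ^ 3 * d / 2 + h ^ 5 / 12) fun s _ => ?_).trans_eq ?_)
      · simp only
        rw [orient_mul_triangleDefect_oscillating hn1 hm]
        have hθ := abs_one_sub_two_mul_midlineY j
        refine abs_isoscelesDefect_add_le hd0.le hdh (by linarith) ⟨by positivity, ?_⟩
          (midlineY_mem j) (abs_orient _ _) ?_ ?_
        · rw [div_le_one (by positivity)]
          exact_mod_cast column_le s
        · rw [abs_mul]
          exact mul_le_one₀ (abs_amplitudeSum_le hn1 (column_le s)) (abs_nonneg _) hθ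
        · rw [abs_mul]
          exact (mul_le_of_le_one_right (abs_nonneg _) hθ).trans
            (abs_amplitudeDiff_le hn1 (column_le s))
      · rw [Finset.card_univ, Fintype.card_sum, Fintype.card_fin, Fintype.card_fin, nsmul_eq_mul]
        push_cast
        ring
    · rw [Finset.card_univ, Fintype.card_fin, nsmul_eq_mul]
      push_cast
      ring
  have h2 : m / 2 * (n / 30) * (h ^ 3 / 4) ≤ main := by
    have e : main = (∑ j : Fin (2 * m), (1 - 2 * midlineY m j) ^ 2) *
        (∑ c ∈ Finset.range (2 * n + 1), amplitudeSum n c * (1 - 2 * (c / (2 * n)))) * κ := by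
      rw [hmain, Finset.sum_mul_sum, Finset.sum_mul]
      refine Finset.sum_congr rfl fun j _ => ?_
      rw [Finset.sum_mul]
      exact Finset.sum_congr rfl fun c _ => by ring
    rw [e]
    have := le_sum_midlineY hm
    have := le_sum_amplitudeSum (n := n) (by omega)
    gcongr
    · exact mul_nonneg (Finset.sum_nonneg fun j _ => sq_nonneg (1 - 2 * midlineY m j))
        (le_trans (by positivity) this)
    · rw [hκ]
      have : 0 ≤ h * d ^ 2 / 12 := by positivity
      linarith
  have en : (n : ℝ) = 1 / (2 * h) := by
    rw [hh]
    field_simp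
  have em : (m : ℝ) = 1 / (2 * d) := by
    rw [hd]
    field_simp
  -- In units of h²/d the main term is at least 1/960, the claimed bound is 1/1920, and the
  -- remainder (1 + h)(d/2 + h²/12) is below 1/1920 because d ≤ h ≤ 1/4000.
  have h3 : (m : ℝ) / n ^ 2 / 3840 + (2 * m) * ((2 * n + 1) * (h ^ 3 * d / 2 + h ^ 5 / 12)) ≤
      m / 2 * (n / 30) * (h ^ 3 / 4) := by
    rw [em, en]
    clear_value h d
    have e1 : 1 / (2 * d) / (1 / (2 * h)) ^ 2 / 3840 + 2 * (1 / (2 * d)) *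
        ((2 * (1 / (2 * h)) + 1) * (h ^ 3 * d / 2 + h ^ 5 / 12)) =
        h ^ 2 / d * (1 / 1920 + (1 + h) * (d / 2 + h ^ 2 / 12)) := by
      field_simp
      ring
    have e2 : 1 / (2 * d) / 2 * (1 / (2 * h) / 30) * (h ^ 3 / 4) = h ^ 2 / d * (1 / 960) := by
      field_simp
      ring
    rw [e1, e2]
    gcongr
    nlinarith
  have h4 := neg_abs_le (consistency n m (oscillating n m) : ℝ)
  have h5 := (abs_le.1 h1).2
  linarith

theorem energy_oscillating_le (hn : 1 ≤ n) (hm : 1 ≤ m) :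
    Real.sqrt (energy n m (oscillating n m) (oscillating n m)) ≤ 2 * max 1 ((m : ℝ) / n ^ 2) := by
  have hn' : (0 : ℝ) < n := by positivity
  have hm' : (0 : ℝ) < m := by positivity
  set R := max 1 ((m : ℝ) / n ^ 2) with hR
  have hR1 : 1 ≤ R := le_max_left _ _
  have hR2 : (m : ℝ) / n ^ 2 ≤ R := le_max_right _ _
  refine Real.sqrt_le_iff.2 ⟨by positivity, ?_⟩
  have h1 : energy n m (oscillating n m) (oscillating n m) ≤
      ∑ i : Fin (2 * m) × (Fin n ⊕ Fin (n + 1)), area n m i.2 * (2 * R ^ 2) := by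
    unfold energy
    refine Finset.sum_le_sum fun i _ => mul_le_mul_of_nonneg_left ?_ (area_pos hn hm i.2).le
    obtain ⟨j, s⟩ := i
    obtain ⟨hX, hY⟩ := slopes_oscillating hn hm j s
    have hθ := abs_one_sub_two_mul_midlineY j
    have aX : |slopeX (oscillating n m (j, s))| ≤ R := by
      rw [hX, abs_div, abs_mul, abs_orient, abs_mul, abs_two]
      have := mul_le_one₀ (abs_amplitudeSum_le hn (column_le s)) (abs_nonneg _) hθ
      linarith
    have aY : |slopeY (oscillating n m (j, s))| ≤ R := by
      rw [hY, abs_div, abs_mul, abs_mul, abs_of_pos (by positivity : (0 : ℝ) < 1 / (2 * n)),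
        abs_of_pos (by positivity : (0 : ℝ) < 2 * (1 / (2 * m)))]
      have := (mul_le_of_le_one_right (abs_nonneg _) hθ).trans
        (abs_amplitudeDiff_le hn (column_le s))
      calc _ ≤ 1 / (2 * n) * (1 / (2 * n)) / (2 * (1 / (2 * m : ℝ))) := by gcongr
        _ = m / n ^ 2 / 4 := by
          field_simp
          norm_num
        _ ≤ R := by linarith
    have s1 := pow_le_pow_left₀ (abs_nonneg _) aX 2
    have s2 := pow_le_pow_left₀ (abs_nonneg _) aY 2
    rw [sq_abs] at s1 s2
    linarith
  rw [← Finset.sum_mul] at h1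
  have h2 := mul_le_mul_of_nonneg_right (sum_area_le (n := n) hn hm)
    (by positivity : 0 ≤ 2 * R ^ 2)
  nlinarith

/-- The functional has size at least of order m/n² = min · max, and the norm is at most 2 max, so
division leaves the minimum. It applies both to the Galerkin error and to the consistency error as
E. -/
theorem min_le_of_oscillating {E : ℝ} (hn : 2000 ≤ n) (hnm : n ≤ m)
    (hE : |consistency n m (oscillating n m)| ≤
      E * Real.sqrt (energy n m (oscillating n m) (oscillating n m))) :
    1 / 7680 * min 1 ((m : ℝ) / n ^ 2) ≤ E := by
  have hn1 : 1 ≤ n := by omega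
  have hm : 1 ≤ m := by omega
  have hn' : (0 : ℝ) < n := by positivity
  have hm' : (0 : ℝ) < m := by positivity
  have h1 := le_abs_consistency_oscillating hn hnm
  have h2 := energy_oscillating_le hn1 hm
  have h0 : (0 : ℝ) < m / n ^ 2 := by positivity
  have hmm := min_mul_max 1 ((m : ℝ) / n ^ 2)
  have hR : 0 < max 1 ((m : ℝ) / n ^ 2) := lt_max_of_lt_left one_pos
  have hE0 : 0 ≤ E := by
    by_contra hneg
    push Not at hneg
    have := mul_nonpos_of_nonpos_of_nonneg hneg.le
      (Real.sqrt_nonneg (energy n m (oscillating n m) (oscillating n m)))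
    have : (0 : ℝ) < m / n ^ 2 / 3840 := by positivity
    linarith
  have h3 := mul_le_mul_of_nonneg_left h2 hE0
  refine le_of_mul_le_mul_right ?_ hR
  rw [mul_assoc, hmm]
  linarith

end MainTerm

/-! ### Lower bounds and conclusion -/

section TwoSidedBounds

variable {n m : ℕ}

theorem IsGalerkinSolution.le_brokenError (hn : 1 ≤ n) (hnm : n ≤ m)
    {u : Fin (2 * m) × (Fin n ⊕ Fin (n + 1)) → (Plane →ᵃ[ℝ] ℝ)}
    (hu : IsGalerkinSolution (babuskaAziz n m) modelF u) :
    1 / 162000 * min 1 ((m : ℝ) / n ^ 2) ≤ brokenError (babuskaAziz n m) modelU u := by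
  have hm : 1 ≤ m := hn.trans hnm
  have hn' : (0 : ℝ) < n := by positivity
  have hmin : 0 ≤ min 1 ((m : ℝ) / n ^ 2) := by positivity
  rcases le_or_gt 2000 n with h | h
  · have := min_le_of_oscillating h hnm
      (hu.abs_consistency_le hn hm ((hasNodalValues_oscillating hn hm).mem hn hm))
    linarith
  -- For n below 2000 the approximation error is bounded below by a constant: 81 · 2000 = 162000.
  · refine le_trans ?_ (NonconformingP1.le_brokenError hn hm u)
    have h1 : min 1 ((m : ℝ) / n ^ 2) ≤ 1 := min_le_left _ _
    have h2 : (n : ℝ) ≤ 2000 := by exact_mod_cast h.le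
    rw [le_div_iff₀ hn']
    nlinarith

theorem le_consistencyError (hn : 2000 ≤ n) (hnm : n ≤ m) :
    1 / 7680 * min 1 ((m : ℝ) / n ^ 2) ≤ consistencyError (babuskaAziz n m) modelU modelF := by
  have hn1 : 1 ≤ n := by omega
  have hm : 1 ≤ m := by omega
  exact min_le_of_oscillating hn hnm (abs_consistency_le_consistencyError_mul hn1 hnm
    ((hasNodalValues_oscillating hn1 hm).mem hn1 hm))

end TwoSidedBounds

theorem tendsto_zero_of_tendsto_min {α : Type*} {l : Filter α} {f : α → ℝ}
    (h : Tendsto (fun a => min 1 (f a)) l (𝓝 0)) : Tendsto f l (𝓝 0) := by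
  refine h.congr' ?_
  filter_upwards [h.eventually_lt_const one_pos] with a ha
  exact min_eq_right ((min_lt_iff.1 ha).resolve_left (lt_irrefl 1)).le

end NonconformingP1
end

open NonconformingP1 in
theorem theorem3 :
    (∀ n m : ℕ, 1 ≤ n → n ≤ m → ∃! v, IsGalerkinSolution (babuskaAziz n m) modelF v) ∧
    (∃ c C : ℝ, 0 < c ∧ 0 < C ∧ ∀ n m : ℕ, 1 ≤ n → n ≤ m →
      ∀ v, IsGalerkinSolution (babuskaAziz n m) modelF v →
        c * min 1 ((m : ℝ) / (n : ℝ) ^ 2) ≤ brokenError (babuskaAziz n m) modelU v ∧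
        brokenError (babuskaAziz n m) modelU v ≤ C * min 1 ((m : ℝ) / (n : ℝ) ^ 2)) ∧
    (∀ n m : ℕ → ℕ, (∀ l, 1 ≤ n l ∧ n l ≤ m l) → Tendsto n atTop atTop →
      ∀ v : (l : ℕ) → Fin (2 * m l) × (Fin (n l) ⊕ Fin (n l + 1)) → (Plane →ᵃ[ℝ] ℝ),
        (∀ l, IsGalerkinSolution (babuskaAziz (n l) (m l)) modelF (v l)) →
        Tendsto (fun l => brokenError (babuskaAziz (n l) (m l)) modelU (v l)) atTop (𝓝 0) →
        Tendsto (fun l => (m l : ℝ) / (n l : ℝ) ^ 2) atTop (𝓝 0)) ∧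
    (∃ c C : ℝ, 0 < c ∧ 0 < C ∧ ∀ n m : ℕ, 1 ≤ n → n ≤ m →
      c / n ≤ bestApproxError (babuskaAziz n m) modelU ∧
      bestApproxError (babuskaAziz n m) modelU ≤ C / n) ∧
    (∃ (c C K : ℝ) (n₀ : ℕ), 0 < c ∧ 0 < C ∧
      (∀ n m : ℕ, 1 ≤ n → n ≤ m →
        consistencyError (babuskaAziz n m) modelU modelF ≤ C * min 1 ((m : ℝ) / (n : ℝ) ^ 2)) ∧
      (∀ n m : ℕ, 1 ≤ n → n ≤ m → n₀ ≤ n → K * n ≤ m →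
        c * min 1 ((m : ℝ) / (n : ℝ) ^ 2) ≤
          consistencyError (babuskaAziz n m) modelU modelF)) := by
  refine ⟨fun n m hn hnm => existsUnique_isGalerkinSolution hn (hn.trans hnm),
    ⟨1 / 162000, 145, by norm_num, by norm_num, fun n m hn hnm v hv =>
      ⟨hv.le_brokenError hn hnm, hv.brokenError_le hn hnm⟩⟩, ?_,
    ⟨1 / 81, 6, by norm_num, by norm_num, fun n m hn hnm =>
      ⟨le_bestApproxError hn (hn.trans hnm), bestApproxError_le hn hnm⟩⟩,
    ⟨1 / 7680, 96, 1, 2000, by norm_num, by norm_num,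
      fun n m hn hnm => consistencyError_le hn hnm,
      fun n m _ hnm hn _ => le_consistencyError hn hnm⟩⟩
  intro n m hnm _ v hv hE
  refine tendsto_zero_of_tendsto_min (squeeze_zero (fun l => by positivity)
    (fun l => ?_) (by simpa using hE.const_mul 162000))
  have := (hv l).le_brokenError (hnm l).1 (hnm l).2
  linarith
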